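/- Let $(\mathcal Q,\Delta)$ be a compact quantum group: $\mathcal Q$ is a unital $C^*$-algebra and $\Delta:\mathcal Q\to\mathcal Q\otimes\mathcal Q$ (minimal tensor product) is a unital $*$-homomorphism with $(\Delta\otimes\mathrm{id})\Delta=(\mathrm{id}\otimes\Delta)\Delta$ such that the linear spans of $\Delta(\mathcal Q)(1\otimes\mathcal Q)$ and $\Delta(\mathcal Q)(\mathcal Q\otimes 1)$ are norm dense in $\mathcal Q\otimes\mathcal Q$. All Hilbert spaces below are finite dimensional. A corepresentation of $\mathcal Q$ on $H$ is a unitary $V\in B(H)\otimes\mathcal Q$ with $(\mathrm{id}\otimes\Delta)(V)=V_{12}V_{13}$. A unitary $\Omega\in\mathcal Q\otimes\mathcal Q$ is a right 2-cocycle if $(\mathrm{id}\otimes\Delta)(\Omega)(1\otimes\Omega)=(\Delta\otimes\mathrm{id})(\Omega)(\Omega\otimes1)$, and a left 2-cocycle if $(1\otimes\Omega)(\mathrm{id}\otimes\Delta)(\Omega)=(\Omega\otimes1)(\Delta\otimes\mathrm{id})(\Omega)$. It is invariant if $\Omega\Delta(x)=\Delta(x)\Omega$ for all $x\in\mathcal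 Q$. A right projective corepresentation with right 2-cocycle $\Omega$ is a unitary $U\in B(H)\otimes\mathcal Q$ with $(\mathrm{id}\otimes\Delta(\cdot)\Omega)(U)=U_{12}U_{13}$. For $U\in B(H)\otimes\mathcal Q$ and $V\in B(K)\otimes\mathcal Q$ put $U\otimes V:=U_{13}V_{23}\in B(H\otimes K)\otimes\mathcal Q$. A conjugate of a unitary $U\in B(H)\otimes\mathcal Q$ is a unitary $\bar U\in B(\bar H)\otimes\mathcal Q$ for which there are linear maps $R_s:\mathbb C\to\bar H\otimes H$ and $R_t:\mathbb C\to H\otimes\bar H$ with $(\bar U\otimes U)(R_s\otimes1)=R_s\otimes1$, $(U\otimes\bar U)(R_t\otimes1)=R_t\otimes1$, $(R_s^*\otimes\mathrm{id}_{\bar H})(\mathrm{id}_{\bar H}\otimes R_t)=\mathrm{id}_{\bar H}$ and $(R_t^*\otimes\mathrm{id}_H)(\mathrm{id}_H\otimes R_s)=\mathrm{id}_H$. A unitary $U$ that has a conjugate is strongly right projective if $U\otimes V\otimes\bar U$ is a corepresentation for every corepresentation $V$ and every conjugate $\bar U$ of $U$, and strongly left projective if $\bar U\otimes V\otimes U$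 is a corepresentation for every corepresentation $V$ and every conjugate $\bar U$ of $U$. Then: (a) If $H\neq0$ and $U\in B(H)\otimes\mathcal Q$ is a right projective corepresentation with right 2-cocycle $\Omega$, then $U$ is strongly right projective if and only if $\Omega\Delta(x)=\Delta(x)\Omega$ for all $x\in\mathcal Q$. (b) An element $U\in B(H)\otimes\mathcal Q$ is strongly right projective if and only if it is strongly left projective. (c) An element $\Omega\in\mathcal Q\otimes\mathcal Q$ is an invariant right 2-cocycle if and only if it is an invariant left 2-cocycle. -/

import Mathlib

universe u
open scoped TensorProduct Kronecker
open UniformSpace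

namespace CQG
noncomputable section

set_option linter.unusedSectionVars false

/-- A C⋆-seminorm on a complex ⋆-algebra. -/
structure CStarSeminorm (X : Type u) [Ring X] [StarRing X] [Algebra ℂ X] extends
    RingSeminorm X where
  smul_le' : ∀ (c : ℂ) (x : X), toFun (c • x) ≤ ‖c‖ * toFun x
  star_mul_self' : ∀ x : X, toFun x * toFun x ≤ toFun (star x * x)

section Completion

variable {X : Type u} [Ring X] [StarRing X] [Algebra ℂ X] [StarModule ℂ X]

/-- A copy of `X`, topologised by the C⋆-seminorm `p`. -/
def CStarSeminorm.Carrier (_p : CStarSeminorm X) : Type u := X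

variable (p : CStarSeminorm X)

instance : Ring p.Carrier := inferInstanceAs (Ring X)
instance : StarRing p.Carrier := inferInstanceAs (StarRing X)
instance : Algebra ℂ p.Carrier := inferInstanceAs (Algebra ℂ X)
instance : StarModule ℂ p.Carrier := inferInstanceAs (StarModule ℂ X)

/-- `p`, as a seminorm on the additive group of the copy of `X`. -/
def CStarSeminorm.addGroupSeminorm : AddGroupSeminorm p.Carrier := p.toAddGroupSeminorm

instance : SeminormedRing p.Carrier where
  __ := (inferInstance : Ring p.Carrier)
  __ := p.addGroupSeminorm.toSeminormedAddCommGroup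
  norm_mul_le := p.mul_le'

theorem CStarSeminorm.norm_def (x : p.Carrier) : ‖x‖ = p.toFun x := rfl

instance : NormedAlgebra ℂ p.Carrier where
  norm_smul_le := p.smul_le'

theorem CStarSeminorm.norm_star_le (x : p.Carrier) : ‖star x‖ ≤ ‖x‖ := by
  have h : ‖star x‖ * ‖star x‖ ≤ ‖star (star x) * star x‖ := p.star_mul_self' (star x)
  have h3 := h.trans (norm_mul_le _ _)
  rw [star_star] at h3
  by_contra hlt
  push Not at hlt
  nlinarith [norm_nonneg x]

theorem CStarSeminorm.norm_star (x : p.Carrier) : ‖star x‖ = ‖x‖ :=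
  le_antisymm (p.norm_star_le x) (by simpa using p.norm_star_le (star x))

instance : NormedStarGroup p.Carrier := ⟨p.norm_star_le⟩

/-- The C⋆-algebra obtained from `X` by separation and completion for `p`. -/
abbrev CStarSeminorm.Completion : Type u := UniformSpace.Completion p.Carrier

theorem CStarSeminorm.uniformContinuous_star :
    UniformContinuous (star : p.Carrier → p.Carrier) :=
  (starNormedAddGroupHom (E := p.Carrier)).uniformContinuous

instance : Star p.Completion := ⟨UniformSpace.Completion.map star⟩

theorem CStarSeminorm.coe_star (x : p.Carrier) :
    star (x : p.Completion) = ((star x : p.Carrier) : p.Completion) :=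
  Completion.map_coe p.uniformContinuous_star x

theorem CStarSeminorm.continuous_star : Continuous (star : p.Completion → p.Completion) :=
  Completion.continuous_map

instance : StarRing p.Completion where
  star_involutive x := by
    induction x using Completion.induction_on with
    | hp => exact isClosed_eq (p.continuous_star.comp p.continuous_star) continuous_id
    | ih x => simp [p.coe_star]
  star_mul x y := by
    induction x, y using Completion.induction_on₂ with
    | hp =>
      exact isClosed_eq (p.continuous_star.comp (by fun_prop))
        ((p.continuous_star.comp continuous_snd).mul (p.continuous_star.comp continuous_fst))
    | ih x y => simp only [p.coe_star, ← Completion.coe_mul, star_mul]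
  star_add x y := by
    induction x, y using Completion.induction_on₂ with
    | hp =>
      exact isClosed_eq (p.continuous_star.comp (by fun_prop))
        ((p.continuous_star.comp continuous_fst).add (p.continuous_star.comp continuous_snd))
    | ih x y => simp only [p.coe_star, ← Completion.coe_add, star_add]

theorem CStarSeminorm.star_smul' (c : ℂ) (x : p.Completion) : star (c • x) = star c • star x := by
  have h1 : Continuous fun x : p.Completion => star (c • x) :=
    p.continuous_star.comp (continuous_const_smul c)
  have h2 : Continuous fun x : p.Completion => star c • star x :=
    (continuous_const_smul (star c)).comp p.continuous_star
  induction x using Completion.induction_on with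
  | hp => exact isClosed_eq h1 h2
  | ih x =>
    rw [p.coe_star, ← Completion.coe_smul, p.coe_star, ← Completion.coe_smul, star_smul]

instance : CStarAlgebra p.Completion where
  norm_mul_self_le x := by
    induction x using Completion.induction_on with
    | hp =>
      exact isClosed_le (by fun_prop) (continuous_norm.comp (p.continuous_star.mul continuous_id))
    | ih x =>
      rw [p.coe_star, ← Completion.coe_mul, Completion.norm_coe, Completion.norm_coe]
      exact p.star_mul_self' x
  norm_smul_le := norm_smul_le
  star_smul := p.star_smul'

/-- The identity map from `X` to its copy. -/
def CStarSeminorm.toCarrier : X →⋆ₐ[ℂ] p.Carrier := StarAlgHom.id ℂ X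

/-- The identity map from the copy of `X` to `X`. -/
def CStarSeminorm.ofCarrier : p.Carrier →⋆ₐ[ℂ] X := StarAlgHom.id ℂ X

/-- The C⋆-algebra obtained from `X` by separation and completion for `p`. -/
def CStarSeminorm.Completed : Type u := p.Completion

instance : CStarAlgebra p.Completed := inferInstanceAs (CStarAlgebra p.Completion)

/-- The canonical ⋆-homomorphism from `X` to its completion. -/
def CStarSeminorm.ι : X →⋆ₐ[ℂ] p.Completed where
  toFun x := ((p.toCarrier x : p.Carrier) : p.Completion)
  map_one' := Completion.coe_one p.Carrier
  map_mul' x y := Completion.coe_mul (p.toCarrier x) (p.toCarrier y)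
  map_zero' := Completion.coe_zero
  map_add' x y := Completion.coe_add (p.toCarrier x) (p.toCarrier y)
  commutes' _ := rfl
  map_star' x := (p.coe_star (p.toCarrier x)).symm

theorem CStarSeminorm.norm_ι (x : X) : ‖p.ι x‖ = p.toFun x :=
  Completion.norm_coe (p.toCarrier x)

theorem CStarSeminorm.denseRange_ι : DenseRange p.ι :=
  Completion.denseRange_coe (α := p.Carrier)

theorem CStarSeminorm.continuous_of_le {Y : Type*} [CStarAlgebra Y] (f : X →⋆ₐ[ℂ] Y)
    (hf : ∀ x, ‖f x‖ ≤ p.toFun x) : Continuous (f.comp p.ofCarrier) :=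
  AddMonoidHomClass.continuous_of_bound (f.comp p.ofCarrier) 1 fun x => by
    rw [one_mul]; exact hf x

/-- Extension of a contractive ⋆-homomorphism to the completion. -/
def CStarSeminorm.extend {Y : Type*} [CStarAlgebra Y] (f : X →⋆ₐ[ℂ] Y)
    (hf : ∀ x, ‖f x‖ ≤ p.toFun x) : p.Completion →⋆ₐ[ℂ] Y where
  __ := Completion.extensionHom ((f.comp p.ofCarrier : p.Carrier →⋆ₐ[ℂ] Y) : p.Carrier →+* Y)
    (p.continuous_of_le f hf)
  commutes' c := by
    refine (Completion.extensionHom_coe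
      ((f.comp p.ofCarrier : p.Carrier →⋆ₐ[ℂ] Y) : p.Carrier →+* Y)
      (p.continuous_of_le f hf) (algebraMap ℂ p.Carrier c)).trans ?_
    exact (f.comp p.ofCarrier).commutes' c
  map_star' x := by
    have key := Completion.extensionHom_coe
      ((f.comp p.ofCarrier : p.Carrier →⋆ₐ[ℂ] Y) : p.Carrier →+* Y) (p.continuous_of_le f hf)
    induction x using Completion.induction_on with
    | hp =>
      exact isClosed_eq (Completion.continuous_extension.comp p.continuous_star)
        (Completion.continuous_extension.star)
    | ih x =>
      rw [p.coe_star]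
      refine (key _).trans ((map_star (f.comp p.ofCarrier) x).trans (congrArg star ?_))
      exact (key x).symm

/-- Extension of a contractive ⋆-homomorphism to the completion. -/
def CStarSeminorm.lift {Y : Type*} [CStarAlgebra Y] (f : X →⋆ₐ[ℂ] Y)
    (hf : ∀ x, ‖f x‖ ≤ p.toFun x) : p.Completed →⋆ₐ[ℂ] Y where
  toFun := p.extend f hf
  map_one' := map_one (p.extend f hf)
  map_mul' := map_mul (p.extend f hf)
  map_zero' := map_zero (p.extend f hf)
  map_add' := map_add (p.extend f hf)
  commutes' := (p.extend f hf).commutes'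
  map_star' := map_star (p.extend f hf)

theorem CStarSeminorm.lift_ι {Y : Type*} [CStarAlgebra Y] (f : X →⋆ₐ[ℂ] Y)
    (hf : ∀ x, ‖f x‖ ≤ p.toFun x) (x : X) : p.lift f hf (p.ι x) = f x :=
  Completion.extensionHom_coe
    ((f.comp p.ofCarrier : p.Carrier →⋆ₐ[ℂ] Y) : p.Carrier →+* Y) (p.continuous_of_le f hf)
    (p.toCarrier x)

theorem continuous_starHom {A B : Type*} [CStarAlgebra A] [CStarAlgebra B] (f : A →⋆ₐ[ℂ] B) :
    Continuous f :=
  AddMonoidHomClass.continuous_of_bound f 1 fun x => by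
    rw [one_mul]; exact NonUnitalStarAlgHom.norm_apply_le f x

/-- A family of ⋆-homomorphisms is pointwise bounded. -/
def PointwiseBounded {I : Type*} {Y : I → Type*} [∀ i, CStarAlgebra (Y i)]
    (F : ∀ i, X →⋆ₐ[ℂ] Y i) : Prop :=
  ∀ x, ∃ c : ℝ, ∀ i, ‖F i x‖ ≤ c

section Sup

variable {I : Type*} {Y : I → Type*} [∀ i, CStarAlgebra (Y i)] (F : ∀ i, X →⋆ₐ[ℂ] Y i)
  (hF : PointwiseBounded F)

theorem PointwiseBounded.le_iSup {I : Type*} {Y : I → Type*} [∀ i, CStarAlgebra (Y i)]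
    (F : ∀ i, X →⋆ₐ[ℂ] Y i) (hF : PointwiseBounded F) (x : X) (i : I) : ‖F i x‖ ≤ ⨆ i, ‖F i x‖ :=
  le_ciSup (f := fun i => ‖F i x‖) ⟨_, Set.forall_mem_range.2 (hF x).choose_spec⟩ i

/-- The C⋆-seminorm `x ↦ sup ‖f x‖`, over a pointwise bounded family of ⋆-homomorphisms `f` into
C⋆-algebras. -/
def supSeminorm : CStarSeminorm X where
  toFun x := ⨆ i, ‖F i x‖
  map_zero' := by simp
  neg' x := by simp
  add_le' x y := Real.iSup_le (fun i => by
      rw [map_add]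
      exact (norm_add_le _ _).trans (add_le_add (hF.le_iSup F x i) (hF.le_iSup F y i)))
    (add_nonneg (Real.iSup_nonneg fun _ => norm_nonneg _) (Real.iSup_nonneg fun _ => norm_nonneg _))
  mul_le' x y := Real.iSup_le (fun i => by
      rw [map_mul]
      exact (norm_mul_le _ _).trans (mul_le_mul (hF.le_iSup F x i) (hF.le_iSup F y i)
        (norm_nonneg _) (Real.iSup_nonneg fun _ => norm_nonneg _)))
    (mul_nonneg (Real.iSup_nonneg fun _ => norm_nonneg _) (Real.iSup_nonneg fun _ => norm_nonneg _))
  smul_le' c x := Real.iSup_le (fun i => by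
      rw [map_smul, norm_smul]
      exact mul_le_mul_of_nonneg_left (hF.le_iSup F x i) (norm_nonneg _))
    (mul_nonneg (norm_nonneg _) (Real.iSup_nonneg fun _ => norm_nonneg _))
  star_mul_self' x := by
    have h : ⨆ i, ‖F i x‖ ≤ √(⨆ i, ‖F i (star x * x)‖) :=
      Real.iSup_le (fun i => by
        refine Real.le_sqrt_of_sq_le ?_
        have h2 : ‖F i x‖ ^ 2 = ‖F i (star x * x)‖ := by
          rw [map_mul, map_star, CStarRing.norm_star_mul_self, sq]
        rw [h2]
        exact hF.le_iSup F _ i) (Real.sqrt_nonneg _)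
    have h0 : 0 ≤ ⨆ i, ‖F i (star x * x)‖ := Real.iSup_nonneg fun _ => norm_nonneg _
    have h1 : 0 ≤ ⨆ i, ‖F i x‖ := Real.iSup_nonneg fun _ => norm_nonneg _
    calc _ ≤ _ := mul_le_mul h h h1 (Real.sqrt_nonneg _)
      _ = _ := Real.mul_self_sqrt h0

/-- The extension of the `i`-th member of the family to the completion. -/
def supExtend (i : I) : (supSeminorm F hF).Completed →⋆ₐ[ℂ] Y i :=
  (supSeminorm F hF).lift (F i) fun x => hF.le_iSup F x i

theorem supExtend_ι (i : I) (x : X) : supExtend F hF i ((supSeminorm F hF).ι x) = F i x :=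
  CStarSeminorm.lift_ι _ _ _ x

theorem norm_le_of_supExtend_le (z : (supSeminorm F hF).Completed) {c : ℝ} (hc : 0 ≤ c)
    (h : ∀ i, ‖supExtend F hF i z‖ ≤ c) : ‖z‖ ≤ c := by
  refine le_of_forall_pos_le_add fun ε hε => ?_
  obtain ⟨x, hx⟩ := (supSeminorm F hF).denseRange_ι.exists_dist_lt z (half_pos hε)
  rw [dist_eq_norm] at hx
  have h1 : ‖(supSeminorm F hF).ι x‖ ≤ c + ε / 2 := by
    rw [CStarSeminorm.norm_ι]
    refine Real.iSup_le (fun i => ?_) (by positivity)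
    have h2 : F i x = supExtend F hF i z - supExtend F hF i (z - (supSeminorm F hF).ι x) := by
      rw [map_sub, sub_sub_cancel, supExtend_ι]
    rw [h2]
    refine (norm_sub_le _ _).trans (add_le_add (h i) ?_)
    exact (NonUnitalStarAlgHom.norm_apply_le (supExtend F hF i) _).trans hx.le
  calc ‖z‖ = ‖(z - (supSeminorm F hF).ι x) + (supSeminorm F hF).ι x‖ := by simp
    _ ≤ _ := norm_add_le _ _
    _ ≤ c + ε := by linarith

end Sup

end Completion

section Hilbert

variable (H K L : Type u) [NormedAddCommGroup H] [InnerProductSpace ℂ H]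
  [NormedAddCommGroup K] [InnerProductSpace ℂ K] [NormedAddCommGroup L] [InnerProductSpace ℂ L]

/-- The Hilbert space tensor product: the completion of the algebraic tensor product for the inner
product `⟪h ⊗ k, h' ⊗ k'⟫ = ⟪h, h'⟫ * ⟪k, k'⟫`. -/
abbrev HilbertTensor : Type u := UniformSpace.Completion (H ⊗[ℂ] K)

variable {H K L}

/-- The elementary tensor `h ⊗ k` in the Hilbert space tensor product. -/
def HilbertTensor.tmul (h : H) (k : K) : HilbertTensor H K := ((h ⊗ₜ[ℂ] k : H ⊗[ℂ] K) : _)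

theorem HilbertTensor.add_tmul (h h' : H) (k : K) :
    tmul (h + h') k = tmul h k + tmul h' k := by
  simp [tmul, TensorProduct.add_tmul, Completion.coe_add]

theorem HilbertTensor.tmul_add (h : H) (k k' : K) :
    tmul h (k + k') = tmul h k + tmul h k' := by
  simp [tmul, TensorProduct.tmul_add, Completion.coe_add]

theorem HilbertTensor.smul_tmul (c : ℂ) (h : H) (k : K) : tmul (c • h) k = c • tmul h k := by
  simp [tmul, ← TensorProduct.smul_tmul', Completion.coe_smul]

theorem HilbertTensor.tmul_smul (c : ℂ) (h : H) (k : K) : tmul h (c • k) = c • tmul h k := by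
  simp [tmul, Completion.coe_smul]

theorem HilbertTensor.ext {Y : Type*} [NormedAddCommGroup Y] [NormedSpace ℂ Y]
    {S T : HilbertTensor H K →L[ℂ] Y}
    (h : ∀ x y, S (HilbertTensor.tmul x y) = T (HilbertTensor.tmul x y)) : S = T := by
  ext z
  induction z using Completion.induction_on with
  | hp => exact isClosed_eq S.continuous T.continuous
  | ih z =>
    induction z using TensorProduct.induction_on with
    | zero => rw [Completion.coe_zero, map_zero, map_zero]
    | tmul x y => exact h x y
    | add a b ha hb => rw [Completion.coe_add, map_add, map_add, ha, hb]

/-- The bounded operator `S ⊗ T` on the Hilbert space tensor product. -/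
def opTensor (S : H →L[ℂ] H) (T : K →L[ℂ] K) : HilbertTensor H K →L[ℂ] HilbertTensor H K :=
  (TensorProduct.mapL S T).completion

theorem opTensor_tmul (S : H →L[ℂ] H) (T : K →L[ℂ] K) (x : H) (y : K) :
    opTensor S T (HilbertTensor.tmul x y) = HilbertTensor.tmul (S x) (T y) :=
  ContinuousLinearMap.completion_apply_coe _ _

theorem opTensor_mul (S S' : H →L[ℂ] H) (T T' : K →L[ℂ] K) :
    opTensor (S * S') (T * T') = opTensor S T * opTensor S' T' :=
  HilbertTensor.ext fun x y => by simp [opTensor_tmul]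

theorem opTensor_one : opTensor (1 : H →L[ℂ] H) (1 : K →L[ℂ] K) = 1 :=
  HilbertTensor.ext fun x y => by simp [opTensor_tmul]

theorem opTensor_add_left (S S' : H →L[ℂ] H) (T : K →L[ℂ] K) :
    opTensor (S + S') T = opTensor S T + opTensor S' T :=
  HilbertTensor.ext fun x y => by
    simp [opTensor_tmul, HilbertTensor.add_tmul]

theorem opTensor_add_right (S : H →L[ℂ] H) (T T' : K →L[ℂ] K) :
    opTensor S (T + T') = opTensor S T + opTensor S T' :=
  HilbertTensor.ext fun x y => by
    simp [opTensor_tmul, HilbertTensor.tmul_add]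

theorem opTensor_smul_left (c : ℂ) (S : H →L[ℂ] H) (T : K →L[ℂ] K) :
    opTensor (c • S) T = c • opTensor S T :=
  HilbertTensor.ext fun x y => by
    simp [opTensor_tmul, HilbertTensor.smul_tmul]

theorem opTensor_smul_right (c : ℂ) (S : H →L[ℂ] H) (T : K →L[ℂ] K) :
    opTensor S (c • T) = c • opTensor S T :=
  HilbertTensor.ext fun x y => by
    simp [opTensor_tmul, HilbertTensor.tmul_smul]

theorem opTensor_star [CompleteSpace H] [CompleteSpace K] (S : H →L[ℂ] H) (T : K →L[ℂ] K) :
    opTensor (star S) (star T) = star (opTensor S T) := by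
  refine (ContinuousLinearMap.eq_adjoint_iff _ _).mpr fun x y => ?_
  induction x, y using Completion.induction_on₂ with
  | hp => apply isClosed_eq <;> fun_prop
  | ih x y =>
    simp only [opTensor, ContinuousLinearMap.completion_apply_coe, Completion.inner_coe]
    induction x using TensorProduct.induction_on with
    | zero => simp
    | add a b ha hb => simp only [map_add, inner_add_left, ha, hb]
    | tmul a b =>
      induction y using TensorProduct.induction_on with
      | zero => simp
      | add c d hc hd => simp only [map_add, inner_add_right, hc, hd]
      | tmul c d =>
        simp [ContinuousLinearMap.star_eq_adjoint, ContinuousLinearMap.adjoint_inner_left]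

variable (H K) in
/-- The amplification `S ↦ S ⊗ 1`. -/
def ampLeftAux [CompleteSpace H] [CompleteSpace K] :
    (H →L[ℂ] H) →⋆ₐ[ℂ] (HilbertTensor H K →L[ℂ] HilbertTensor H K) where
  toFun S := opTensor S 1
  map_one' := opTensor_one
  map_mul' S S' := by rw [← opTensor_mul, mul_one]
  map_zero' := by simpa using opTensor_smul_left (0 : ℂ) (0 : H →L[ℂ] H) (1 : K →L[ℂ] K)
  map_add' S S' := opTensor_add_left S S' 1
  commutes' c := by
    rw [Algebra.algebraMap_eq_smul_one, opTensor_smul_left, opTensor_one,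
      Algebra.algebraMap_eq_smul_one]
  map_star' S := by rw [← opTensor_star, star_one]

variable (H K) in
/-- The amplification `T ↦ 1 ⊗ T`. -/
def ampRightAux [CompleteSpace H] [CompleteSpace K] :
    (K →L[ℂ] K) →⋆ₐ[ℂ] (HilbertTensor H K →L[ℂ] HilbertTensor H K) where
  toFun T := opTensor 1 T
  map_one' := opTensor_one
  map_mul' S S' := by rw [← opTensor_mul, mul_one]
  map_zero' := by simpa using opTensor_smul_right (0 : ℂ) (1 : H →L[ℂ] H) (0 : K →L[ℂ] K)
  map_add' S S' := opTensor_add_right 1 S S'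
  commutes' c := by
    rw [Algebra.algebraMap_eq_smul_one, opTensor_smul_right, opTensor_one,
      Algebra.algebraMap_eq_smul_one]
  map_star' S := by rw [← opTensor_star, star_one]

variable (H) in
/-- The C⋆-algebra of bounded operators on a Hilbert space. -/
def BoundedOp [CompleteSpace H] : Type u := H →L[ℂ] H

instance [CompleteSpace H] : CStarAlgebra (BoundedOp H) :=
  inferInstanceAs (CStarAlgebra (H →L[ℂ] H))

/-- A ⋆-homomorphism between algebras of bounded operators. -/
def toBoundedOp [CompleteSpace H] [CompleteSpace K] (f : (H →L[ℂ] H) →⋆ₐ[ℂ] (K →L[ℂ] K)) :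
    BoundedOp H →⋆ₐ[ℂ] BoundedOp K where
  toFun := f
  map_one' := f.map_one'
  map_mul' := f.map_mul'
  map_zero' := f.map_zero'
  map_add' := f.map_add'
  commutes' := f.commutes'
  map_star' := f.map_star'

variable (H K) in
/-- The amplification `S ↦ S ⊗ 1`. -/
def ampLeft [CompleteSpace H] [CompleteSpace K] :
    BoundedOp H →⋆ₐ[ℂ] BoundedOp (HilbertTensor H K) := toBoundedOp (ampLeftAux H K)

variable (H K) in
/-- The amplification `T ↦ 1 ⊗ T`. -/
def ampRight [CompleteSpace H] [CompleteSpace K] :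
    BoundedOp K →⋆ₐ[ℂ] BoundedOp (HilbertTensor H K) := toBoundedOp (ampRightAux H K)

theorem opTensor_commute (S : H →L[ℂ] H) (T : K →L[ℂ] K) :
    opTensor S 1 * opTensor 1 T = opTensor 1 T * opTensor S 1 := by
  rw [← opTensor_mul, ← opTensor_mul, mul_one, one_mul, mul_one, one_mul]

theorem ampLeft_commute_ampRight [CompleteSpace H] [CompleteSpace K] (S : BoundedOp H)
    (T : BoundedOp K) : Commute (ampLeft H K S) (ampRight H K T) :=
  opTensor_commute (H := H) (K := K) S T

theorem denseRange_mapIsometry {H' K' : Type*} [NormedAddCommGroup H'] [InnerProductSpace ℂ H']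
    [NormedAddCommGroup K'] [InnerProductSpace ℂ K'] (f : H →ₗᵢ[ℂ] H') (g : K →ₗᵢ[ℂ] K')
    (hf : DenseRange f) (hg : DenseRange g) : DenseRange (TensorProduct.mapIsometry f g) := by
  intro z
  change z ∈ closure (LinearMap.range (TensorProduct.mapIsometry f g).toLinearMap : Set _)
  rw [← Submodule.topologicalClosure_coe]
  induction z using TensorProduct.induction_on with
  | zero => exact zero_mem _
  | add a b ha hb => exact add_mem ha hb
  | tmul x y =>
    refine map_mem_closure₂ (TensorProduct.continuous_tmul (𝕜 := ℂ) (E := H') (F := K')) (hf x) (hg y) ?_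
    rintro _ ⟨a, rfl⟩ _ ⟨b, rfl⟩
    exact ⟨a ⊗ₜ b, rfl⟩

variable (H K L) in
/-- The canonical embedding of the algebraic into the iterated Hilbert space tensor product. -/
def hilbertEmbLeft : (H ⊗[ℂ] K) ⊗[ℂ] L →ₗᵢ[ℂ] HilbertTensor (HilbertTensor H K) L :=
  (Completion.toComplₗᵢ (𝕜 := ℂ)).comp
    (TensorProduct.mapIsometry (Completion.toComplₗᵢ (𝕜 := ℂ) (E := H ⊗[ℂ] K))
      (LinearIsometry.id (R := ℂ) (E := L)))

variable (H K L) in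
/-- The canonical embedding of the algebraic into the iterated Hilbert space tensor product. -/
def hilbertEmbRight : H ⊗[ℂ] (K ⊗[ℂ] L) →ₗᵢ[ℂ] HilbertTensor H (HilbertTensor K L) :=
  (Completion.toComplₗᵢ (𝕜 := ℂ)).comp
    (TensorProduct.mapIsometry (LinearIsometry.id (R := ℂ) (E := H))
      (Completion.toComplₗᵢ (𝕜 := ℂ) (E := K ⊗[ℂ] L)))

theorem denseRange_hilbertEmbLeft : DenseRange (hilbertEmbLeft H K L) :=
  Completion.denseRange_coe.comp (denseRange_mapIsometry _ _ Completion.denseRange_coe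
    Function.surjective_id.denseRange) (Completion.continuous_coe _)

theorem denseRange_hilbertEmbRight : DenseRange (hilbertEmbRight H K L) :=
  Completion.denseRange_coe.comp (denseRange_mapIsometry _ _
    Function.surjective_id.denseRange Completion.denseRange_coe) (Completion.continuous_coe _)

variable (H K L) in
/-- The canonical unitary from `(H ⊗ K) ⊗ L` onto `H ⊗ (K ⊗ L)`. -/
def hilbertAssoc : HilbertTensor (HilbertTensor H K) L ≃ₗᵢ[ℂ] HilbertTensor H (HilbertTensor K L) :=
  (TensorProduct.assoc ℂ H K L).extendOfIsometry (hilbertEmbLeft H K L).toLinearMap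
    (hilbertEmbRight H K L).toLinearMap denseRange_hilbertEmbLeft denseRange_hilbertEmbRight
    fun x => ((hilbertEmbRight H K L).norm_map _).trans
      ((TensorProduct.norm_assoc x).trans ((hilbertEmbLeft H K L).norm_map x).symm)

theorem hilbertAssoc_tmul (x : H) (y : K) (z : L) :
    hilbertAssoc H K L (HilbertTensor.tmul (HilbertTensor.tmul x y) z) =
      HilbertTensor.tmul x (HilbertTensor.tmul y z) :=
  LinearEquiv.extendOfIsometry_eq _ _ _ _ _ _ ((x ⊗ₜ y) ⊗ₜ z)

/-- Conjugation by a unitary between Hilbert spaces. -/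
def conj [CompleteSpace H] [CompleteSpace K] (W : H ≃ₗᵢ[ℂ] K) :
    (H →L[ℂ] H) →⋆ₐ[ℂ] (K →L[ℂ] K) where
  toFun S := (W : H →L[ℂ] K) ∘L S ∘L (W.symm : K →L[ℂ] H)
  map_one' := by ext; simp
  map_mul' S T := by ext; simp
  map_zero' := by ext; simp
  map_add' S T := by ext; simp
  commutes' c := by ext; simp [Algebra.algebraMap_eq_smul_one]
  map_star' S := by
    refine (ContinuousLinearMap.eq_adjoint_iff _ _).mpr fun x y => ?_
    calc inner ℂ (W ((star S) (W.symm x))) y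
        = inner ℂ (W ((star S) (W.symm x))) (W (W.symm y)) := by simp
      _ = inner ℂ (W (W.symm x)) (W (S (W.symm y))) := by
          rw [W.inner_map_map, W.inner_map_map, ContinuousLinearMap.star_eq_adjoint,
            ContinuousLinearMap.adjoint_inner_left]
      _ = inner ℂ x (W (S (W.symm y))) := by simp

theorem conj_opTensor [CompleteSpace H] [CompleteSpace K] [CompleteSpace L] (S : H →L[ℂ] H)
    (T : K →L[ℂ] K) (R : L →L[ℂ] L) :
    conj (hilbertAssoc H K L) (opTensor (opTensor S T) R) = opTensor S (opTensor T R) := by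
  have h : (hilbertAssoc H K L : _ →L[ℂ] _) ∘L opTensor (opTensor S T) R =
      opTensor S (opTensor T R) ∘L (hilbertAssoc H K L : _ →L[ℂ] _) := by
    refine DFunLike.coe_injective (denseRange_hilbertEmbLeft.equalizer
      (ContinuousLinearMap.continuous _) (ContinuousLinearMap.continuous _) (funext fun z => ?_))
    have hh : ((hilbertAssoc H K L : _ →L[ℂ] _) ∘L opTensor (opTensor S T) R).toLinearMap ∘ₗ
        (hilbertEmbLeft H K L).toLinearMap =
        (opTensor S (opTensor T R) ∘L (hilbertAssoc H K L : _ →L[ℂ] _)).toLinearMap ∘ₗ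
        (hilbertEmbLeft H K L).toLinearMap := by
      refine TensorProduct.ext_threefold fun x y w => ?_
      change hilbertAssoc H K L (opTensor (opTensor S T) R
        (HilbertTensor.tmul (HilbertTensor.tmul x y) w)) = opTensor S (opTensor T R)
        (hilbertAssoc H K L (HilbertTensor.tmul (HilbertTensor.tmul x y) w))
      simp only [opTensor_tmul, hilbertAssoc_tmul]
    exact DFunLike.congr_fun hh z
  ext z
  have h2 := DFunLike.congr_fun h ((hilbertAssoc H K L).symm z)
  refine Eq.trans h2 ?_
  change opTensor S (opTensor T R) (hilbertAssoc H K L ((hilbertAssoc H K L).symm z)) = _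
  rw [LinearIsometryEquiv.apply_symm_apply]

variable (H K L) in
/-- Conjugation by the canonical unitary from `(H ⊗ K) ⊗ L` onto `H ⊗ (K ⊗ L)`. -/
def reassoc [CompleteSpace H] [CompleteSpace K] [CompleteSpace L] :
    BoundedOp (HilbertTensor (HilbertTensor H K) L) →⋆ₐ[ℂ]
      BoundedOp (HilbertTensor H (HilbertTensor K L)) :=
  toBoundedOp (conj (hilbertAssoc H K L))

variable [CompleteSpace H] [CompleteSpace K] [CompleteSpace L]

theorem reassoc_left (S : BoundedOp H) :
    reassoc H K L (ampLeft _ L (ampLeft H K S)) = ampLeft H (HilbertTensor K L) S :=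
  (conj_opTensor (H := H) (K := K) (L := L) S 1 1).trans
    (congrArg (opTensor (H := H) (K := HilbertTensor K L) S) opTensor_one)

theorem reassoc_middle (S : BoundedOp K) :
    reassoc H K L (ampLeft _ L (ampRight H K S)) = ampRight H _ (ampLeft K L S) :=
  conj_opTensor (H := H) (K := K) (L := L) 1 S 1

theorem reassoc_right (S : BoundedOp L) :
    reassoc H K L (ampRight _ L S) = ampRight H _ (ampRight K L S) :=
  (congrArg (conj (hilbertAssoc H K L)) (congrArg
    (fun Z => opTensor (H := HilbertTensor H K) (K := L) Z S) opTensor_one.symm)).trans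
    (conj_opTensor (H := H) (K := K) (L := L) 1 1 S)

end Hilbert


section Algebraic

variable {A B C X : Type u} [Ring A] [StarRing A] [Algebra ℂ A] [StarModule ℂ A]
  [Ring B] [StarRing B] [Algebra ℂ B] [StarModule ℂ B]
  [Ring C] [StarRing C] [Algebra ℂ C] [StarModule ℂ C]

/-- The ⋆-homomorphism `a ⊗ b ↦ f a * g b` for ⋆-homomorphisms with commuting ranges. -/
def starLift {Y : Type*} [Ring Y] [StarRing Y] [Algebra ℂ Y] (f : A →⋆ₐ[ℂ] Y) (g : B →⋆ₐ[ℂ] Y)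
    (hfg : ∀ a b, Commute (f a) (g b)) : A ⊗[ℂ] B →⋆ₐ[ℂ] Y where
  __ := Algebra.TensorProduct.lift f.toAlgHom g.toAlgHom hfg
  map_star' x := by
    change Algebra.TensorProduct.lift f.toAlgHom g.toAlgHom hfg (star x) =
      star (Algebra.TensorProduct.lift f.toAlgHom g.toAlgHom hfg x)
    induction x using TensorProduct.induction_on with
    | zero => simp
    | add a b ha hb => rw [star_add, map_add, map_add, star_add, ha, hb]
    | tmul a b =>
      rw [TensorProduct.star_tmul, Algebra.TensorProduct.lift_tmul,
        Algebra.TensorProduct.lift_tmul]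
      change f (star a) * g (star b) = star (f a * g b)
      rw [map_star, map_star, star_mul, ← star_mul, ← star_mul, (hfg a b).eq]

theorem starLift_tmul {Y : Type*} [Ring Y] [StarRing Y] [Algebra ℂ Y] (f : A →⋆ₐ[ℂ] Y)
    (g : B →⋆ₐ[ℂ] Y) (hfg : ∀ a b, Commute (f a) (g b)) (a : A) (b : B) :
    starLift f g hfg (a ⊗ₜ b) = f a * g b :=
  Algebra.TensorProduct.lift_tmul f.toAlgHom g.toAlgHom hfg a b

variable (A B) in
/-- `a ↦ a ⊗ 1` into the algebraic tensor product. -/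
def includeLeftStar : A →⋆ₐ[ℂ] A ⊗[ℂ] B where
  __ := (Algebra.TensorProduct.includeLeft : A →ₐ[ℂ] A ⊗[ℂ] B)
  map_star' a := by
    change star a ⊗ₜ[ℂ] (1 : B) = star (a ⊗ₜ[ℂ] (1 : B))
    rw [TensorProduct.star_tmul, star_one]

variable (A B) in
/-- `b ↦ 1 ⊗ b` into the algebraic tensor product. -/
def includeRightStar : B →⋆ₐ[ℂ] A ⊗[ℂ] B where
  __ := (Algebra.TensorProduct.includeRight : B →ₐ[ℂ] A ⊗[ℂ] B)
  map_star' b := by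
    change (1 : A) ⊗ₜ[ℂ] star b = star ((1 : A) ⊗ₜ[ℂ] b)
    rw [TensorProduct.star_tmul, star_one]

theorem starHom_ext {Y : Type*} [Ring Y] [StarRing Y] [Algebra ℂ Y] {f g : A ⊗[ℂ] B →⋆ₐ[ℂ] Y}
    (h : ∀ a b, f (a ⊗ₜ b) = g (a ⊗ₜ b)) : f = g := by
  ext x
  induction x using TensorProduct.induction_on with
  | zero => simp
  | add a b ha hb => rw [map_add, map_add, ha, hb]
  | tmul a b => exact h a b


section Rep

variable {H K L : Type u} [NormedAddCommGroup H] [InnerProductSpace ℂ H] [CompleteSpace H]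
  [NormedAddCommGroup K] [InnerProductSpace ℂ K] [CompleteSpace K]
  [NormedAddCommGroup L] [InnerProductSpace ℂ L] [CompleteSpace L]

/-- The tensor product representation `π ⊗ σ` on the Hilbert space tensor product. -/
def tensorRep (π : A →⋆ₐ[ℂ] BoundedOp H) (σ : B →⋆ₐ[ℂ] BoundedOp K) :
    A ⊗[ℂ] B →⋆ₐ[ℂ] BoundedOp (HilbertTensor H K) :=
  starLift ((ampLeft H K).comp π) ((ampRight H K).comp σ)
    fun a b => ampLeft_commute_ampRight (π a) (σ b)

theorem tensorRep_tmul (π : A →⋆ₐ[ℂ] BoundedOp H) (σ : B →⋆ₐ[ℂ] BoundedOp K) (a : A) (b : B) :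
    tensorRep π σ (a ⊗ₜ b) = ampLeft H K (π a) * ampRight H K (σ b) :=
  starLift_tmul _ _ _ a b

theorem norm_tensorRep_tmul_le (π : A →⋆ₐ[ℂ] BoundedOp H) (σ : B →⋆ₐ[ℂ] BoundedOp K) (a : A)
    (b : B) : ‖tensorRep π σ (a ⊗ₜ b)‖ ≤ ‖π a‖ * ‖σ b‖ := by
  rw [tensorRep_tmul]
  exact (norm_mul_le _ _).trans (mul_le_mul
    (NonUnitalStarAlgHom.norm_apply_le (ampLeft H K) _)
    (NonUnitalStarAlgHom.norm_apply_le (ampRight H K) _) (norm_nonneg _) (norm_nonneg _))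

end Rep

/-- A ⋆-representation of a complex ⋆-algebra by bounded operators on a Hilbert space. -/
structure HilbertRep (A : Type u) [Ring A] [StarRing A] [Algebra ℂ A] where
  /-- The Hilbert space. -/
  space : Type u
  [normed : NormedAddCommGroup space]
  [inner : InnerProductSpace ℂ space]
  [complete : CompleteSpace space]
  /-- The representation. -/
  hom : A →⋆ₐ[ℂ] BoundedOp space

attribute [instance] HilbertRep.normed HilbertRep.inner HilbertRep.complete

theorem PointwiseBounded.tensor {I J : Type*} {H : I → Type u} {K : J → Type u}
    [∀ i, NormedAddCommGroup (H i)] [∀ i, InnerProductSpace ℂ (H i)] [∀ i, CompleteSpace (H i)]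
    [∀ j, NormedAddCommGroup (K j)] [∀ j, InnerProductSpace ℂ (K j)] [∀ j, CompleteSpace (K j)]
    {F : ∀ i, A →⋆ₐ[ℂ] BoundedOp (H i)} {G : ∀ j, B →⋆ₐ[ℂ] BoundedOp (K j)}
    (hF : PointwiseBounded F) (hG : PointwiseBounded G) :
    PointwiseBounded fun ij : I × J => tensorRep (F ij.1) (G ij.2) := by
  intro x
  induction x using TensorProduct.induction_on with
  | zero => exact ⟨0, fun i => by rw [map_zero, norm_zero]⟩
  | add a b ha hb =>
    obtain ⟨c, hc⟩ := ha
    obtain ⟨d, hd⟩ := hb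
    exact ⟨c + d, fun i => by
      rw [map_add]; exact (norm_add_le _ _).trans (add_le_add (hc i) (hd i))⟩
  | tmul a b =>
    obtain ⟨c, hc⟩ := hF a
    obtain ⟨d, hd⟩ := hG b
    exact ⟨c * d, fun i => (norm_tensorRep_tmul_le _ _ a b).trans (mul_le_mul (hc i.1) (hd i.2)
      (norm_nonneg _) ((norm_nonneg _).trans (hc i.1)))⟩

end Algebraic

section Tensor

variable {A B C D : Type u} [CStarAlgebra A] [CStarAlgebra B] [CStarAlgebra C] [CStarAlgebra D]

variable (A) in
theorem pointwiseBounded_hom : PointwiseBounded fun R : HilbertRep A => R.hom :=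
  fun a => ⟨‖a‖, fun R => NonUnitalStarAlgHom.norm_apply_le R.hom a⟩

variable (A B) in
theorem pointwiseBounded₂ : PointwiseBounded
    fun i : HilbertRep A × HilbertRep B => tensorRep i.1.hom i.2.hom :=
  (pointwiseBounded_hom A).tensor (pointwiseBounded_hom B)

variable (A B C) in
theorem pointwiseBounded₃ : PointwiseBounded
    fun i : HilbertRep A × HilbertRep B × HilbertRep C =>
      tensorRep i.1.hom (tensorRep i.2.1.hom i.2.2.hom) :=
  PointwiseBounded.tensor (H := fun R : HilbertRep A => R.space)
    (K := fun i : HilbertRep B × HilbertRep C => HilbertTensor i.1.space i.2.space)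
    (F := fun R => R.hom) (G := fun i => tensorRep i.1.hom i.2.hom)
    (pointwiseBounded_hom A) (pointwiseBounded₂ B C)

variable (A B) in
/-- The spatial (minimal) C⋆-seminorm `x ↦ sup ‖(π ⊗ σ) x‖` on the algebraic tensor product, the
supremum being over all representations `π` of `A` and `σ` of `B` on Hilbert spaces. -/
def spatialSeminorm : CStarSeminorm (A ⊗[ℂ] B) :=
  supSeminorm (fun i : HilbertRep A × HilbertRep B => tensorRep i.1.hom i.2.hom)
    (pointwiseBounded₂ A B)

variable (A B C) in
/-- The spatial (minimal) C⋆-seminorm `x ↦ sup ‖(π ⊗ σ ⊗ τ) x‖` on the algebraic tensor product of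
three C⋆-algebras. -/
def spatialSeminorm₃ : CStarSeminorm (A ⊗[ℂ] (B ⊗[ℂ] C)) :=
  supSeminorm (fun i : HilbertRep A × HilbertRep B × HilbertRep C =>
    tensorRep i.1.hom (tensorRep i.2.1.hom i.2.2.hom)) (pointwiseBounded₃ A B C)

variable (A B) in
/-- The spatial (minimal) C⋆-tensor product `A ⊗ B`. -/
def SpatialTensor : Type u := (spatialSeminorm A B).Completed

variable (A B C) in
/-- The spatial (minimal) C⋆-tensor product `A ⊗ B ⊗ C`. -/
def SpatialTensor₃ : Type u := (spatialSeminorm₃ A B C).Completed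

instance : CStarAlgebra (SpatialTensor A B) :=
  inferInstanceAs (CStarAlgebra (spatialSeminorm A B).Completed)

instance : CStarAlgebra (SpatialTensor₃ A B C) :=
  inferInstanceAs (CStarAlgebra (spatialSeminorm₃ A B C).Completed)

variable (A B) in
/-- The canonical map from the algebraic to the spatial tensor product. -/
def ι₂ : A ⊗[ℂ] B →⋆ₐ[ℂ] SpatialTensor A B := (spatialSeminorm A B).ι

variable (A B C) in
/-- The canonical map from the algebraic to the spatial tensor product. -/
def ι₃ : A ⊗[ℂ] (B ⊗[ℂ] C) →⋆ₐ[ℂ] SpatialTensor₃ A B C := (spatialSeminorm₃ A B C).ι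

theorem denseRange_ι₂ : DenseRange (ι₂ A B) := (spatialSeminorm A B).denseRange_ι

/-- Extension of a contractive ⋆-homomorphism to the spatial tensor product. -/
def lift₂ (f : A ⊗[ℂ] B →⋆ₐ[ℂ] D) (hf : ∀ x, ‖f x‖ ≤ ‖ι₂ A B x‖) : SpatialTensor A B →⋆ₐ[ℂ] D :=
  (spatialSeminorm A B).lift f fun x => (hf x).trans_eq ((spatialSeminorm A B).norm_ι x)

theorem lift₂_ι₂ (f : A ⊗[ℂ] B →⋆ₐ[ℂ] D) (hf : ∀ x, ‖f x‖ ≤ ‖ι₂ A B x‖) (x : A ⊗[ℂ] B) :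
    lift₂ f hf (ι₂ A B x) = f x :=
  CStarSeminorm.lift_ι _ _ _ x

variable {H K L : Type u} [NormedAddCommGroup H] [InnerProductSpace ℂ H] [CompleteSpace H]
  [NormedAddCommGroup K] [InnerProductSpace ℂ K] [CompleteSpace K]
  [NormedAddCommGroup L] [InnerProductSpace ℂ L] [CompleteSpace L]

theorem norm_tensorRep_le (π : A →⋆ₐ[ℂ] BoundedOp H) (σ : B →⋆ₐ[ℂ] BoundedOp K) (x : A ⊗[ℂ] B) :
    ‖tensorRep π σ x‖ ≤ ‖ι₂ A B x‖ :=
  ((pointwiseBounded₂ A B).le_iSup _ x (⟨H, π⟩, ⟨K, σ⟩)).trans_eq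
    ((spatialSeminorm A B).norm_ι x).symm

/-- The extension of `π ⊗ σ` to the spatial tensor product. -/
def spatialRep (π : A →⋆ₐ[ℂ] BoundedOp H) (σ : B →⋆ₐ[ℂ] BoundedOp K) :
    SpatialTensor A B →⋆ₐ[ℂ] BoundedOp (HilbertTensor H K) :=
  lift₂ (tensorRep π σ) (norm_tensorRep_le π σ)

theorem spatialRep_ι₂ (π : A →⋆ₐ[ℂ] BoundedOp H) (σ : B →⋆ₐ[ℂ] BoundedOp K) (x : A ⊗[ℂ] B) :
    spatialRep π σ (ι₂ A B x) = tensorRep π σ x :=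
  lift₂_ι₂ _ _ x

/-- The extension of `π ⊗ σ ⊗ τ` to the spatial tensor product. -/
def spatialRep₃ (π : A →⋆ₐ[ℂ] BoundedOp H) (σ : B →⋆ₐ[ℂ] BoundedOp K) (τ : C →⋆ₐ[ℂ] BoundedOp L) :
    SpatialTensor₃ A B C →⋆ₐ[ℂ]
      BoundedOp (HilbertTensor H (HilbertTensor K L)) :=
  supExtend _ (pointwiseBounded₃ A B C) (⟨H, π⟩, ⟨K, σ⟩, ⟨L, τ⟩)

theorem spatialRep₃_ι₃ (π : A →⋆ₐ[ℂ] BoundedOp H) (σ : B →⋆ₐ[ℂ] BoundedOp K)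
    (τ : C →⋆ₐ[ℂ] BoundedOp L) (x : A ⊗[ℂ] (B ⊗[ℂ] C)) :
    spatialRep₃ π σ τ (ι₃ A B C x) = tensorRep π (tensorRep σ τ) x :=
  supExtend_ι _ (pointwiseBounded₃ A B C) (⟨H, π⟩, ⟨K, σ⟩, ⟨L, τ⟩) x

theorem norm_le_of_spatialRep₃_le (z : SpatialTensor₃ A B C) {c : ℝ} (hc : 0 ≤ c)
    (h : ∀ (R : HilbertRep A) (S : HilbertRep B) (T : HilbertRep C),
      ‖spatialRep₃ R.hom S.hom T.hom z‖ ≤ c) : ‖z‖ ≤ c :=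
  norm_le_of_supExtend_le _ (pointwiseBounded₃ A B C) z hc fun i => h i.1 i.2.1 i.2.2

theorem spatialHom_ext {f g : SpatialTensor A B →⋆ₐ[ℂ] D}
    (h : ∀ a b, f (ι₂ A B (a ⊗ₜ b)) = g (ι₂ A B (a ⊗ₜ b))) : f = g := by
  have h1 : f.comp (ι₂ A B) = g.comp (ι₂ A B) := starHom_ext h
  exact DFunLike.coe_injective (denseRange_ι₂.equalizer (continuous_starHom f)
    (continuous_starHom g) (funext fun x => DFunLike.congr_fun h1 x))

variable (A B) in
/-- `a ↦ a ⊗ 1`. -/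
def inLeft : A →⋆ₐ[ℂ] SpatialTensor A B := (ι₂ A B).comp (includeLeftStar A B)

variable (A B) in
/-- `b ↦ 1 ⊗ b`. -/
def inRight : B →⋆ₐ[ℂ] SpatialTensor A B := (ι₂ A B).comp (includeRightStar A B)

theorem tensorRep_left {A B : Type u} [CStarAlgebra A] [CStarAlgebra B]
    (π : A →⋆ₐ[ℂ] BoundedOp H) (σ : B →⋆ₐ[ℂ] BoundedOp K) (a : A) :
    tensorRep π σ (a ⊗ₜ 1) = ampLeft H K (π a) := by
  rw [tensorRep_tmul, map_one, map_one, mul_one]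

theorem tensorRep_right {A B : Type u} [CStarAlgebra A] [CStarAlgebra B]
    (π : A →⋆ₐ[ℂ] BoundedOp H) (σ : B →⋆ₐ[ℂ] BoundedOp K) (b : B) :
    tensorRep π σ (1 ⊗ₜ b) = ampRight H K (σ b) := by
  rw [tensorRep_tmul, map_one, map_one, one_mul]

/-! The maps `a ↦ a ⊗ 1 ⊗ 1`, `b ↦ 1 ⊗ b ⊗ 1`, `c ↦ 1 ⊗ 1 ⊗ c`, `x ↦ 1 ⊗ x` and `x ↦ x ⊗ 1` into
the threefold tensor product. -/

variable (A B C) in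
/-- `a ↦ a ⊗ 1 ⊗ 1`. -/
def leg₁ : A →⋆ₐ[ℂ] SpatialTensor₃ A B C := (ι₃ A B C).comp (includeLeftStar A (B ⊗[ℂ] C))

variable (A B C) in
/-- `x ↦ 1 ⊗ x` on the algebraic tensor product. -/
def leg₂₃Alg : B ⊗[ℂ] C →⋆ₐ[ℂ] SpatialTensor₃ A B C :=
  (ι₃ A B C).comp (includeRightStar A (B ⊗[ℂ] C))

variable (A B C) in
/-- `b ↦ 1 ⊗ b ⊗ 1`. -/
def leg₂ : B →⋆ₐ[ℂ] SpatialTensor₃ A B C := (leg₂₃Alg A B C).comp (includeLeftStar B C)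

variable (A B C) in
/-- `c ↦ 1 ⊗ 1 ⊗ c`. -/
def leg₃ : C →⋆ₐ[ℂ] SpatialTensor₃ A B C := (leg₂₃Alg A B C).comp (includeRightStar B C)

theorem leg₁_commute_leg₂₃Alg (a : A) (x : B ⊗[ℂ] C) :
    Commute (leg₁ A B C a) (leg₂₃Alg A B C x) := by
  have h : Commute (includeLeftStar A (B ⊗[ℂ] C) a) (includeRightStar A (B ⊗[ℂ] C) x) := by
    change (a ⊗ₜ[ℂ] (1 : B ⊗[ℂ] C)) * ((1 : A) ⊗ₜ[ℂ] x) =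
      ((1 : A) ⊗ₜ[ℂ] x) * (a ⊗ₜ[ℂ] (1 : B ⊗[ℂ] C))
    simp
  exact h.map (ι₃ A B C)

section

variable (π : A →⋆ₐ[ℂ] BoundedOp H) (σ : B →⋆ₐ[ℂ] BoundedOp K) (τ : C →⋆ₐ[ℂ] BoundedOp L)

theorem spatialRep₃_leg₁ (a : A) :
    spatialRep₃ π σ τ (leg₁ A B C a) = ampLeft H (HilbertTensor K L) (π a) := by
  refine (spatialRep₃_ι₃ π σ τ (a ⊗ₜ 1)).trans ?_
  rw [tensorRep_tmul, map_one, map_one, mul_one]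

theorem spatialRep₃_leg₂₃Alg (x : B ⊗[ℂ] C) :
    spatialRep₃ π σ τ (leg₂₃Alg A B C x) = ampRight H (HilbertTensor K L) (tensorRep σ τ x) := by
  refine (spatialRep₃_ι₃ π σ τ (1 ⊗ₜ x)).trans ?_
  rw [tensorRep_tmul, map_one, map_one, one_mul]

theorem spatialRep₃_leg₂ (b : B) :
    spatialRep₃ π σ τ (leg₂ A B C b) = ampRight H (HilbertTensor K L) (ampLeft K L (σ b)) :=
  (spatialRep₃_leg₂₃Alg π σ τ (b ⊗ₜ 1)).trans (congrArg _ (tensorRep_left σ τ b))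

theorem spatialRep₃_leg₃ (c : C) :
    spatialRep₃ π σ τ (leg₃ A B C c) = ampRight H (HilbertTensor K L) (ampRight K L (τ c)) :=
  (spatialRep₃_leg₂₃Alg π σ τ (1 ⊗ₜ c)).trans (congrArg _ (tensorRep_right σ τ c))

end

/-- A ⋆-homomorphism from an algebraic tensor product into `A ⊗ B ⊗ C` is contractive for the
spatial norm if it becomes a tensor product of representations in each representation of
`A ⊗ B ⊗ C`, up to a ⋆-homomorphism. -/
theorem norm_le_of_rep {A' B' : Type u} [CStarAlgebra A'] [CStarAlgebra B']
    (f : A' ⊗[ℂ] B' →⋆ₐ[ℂ] SpatialTensor₃ A B C)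
    (h : ∀ (R : HilbertRep A) (S : HilbertRep B) (T : HilbertRep C),
      ∃ (R' : HilbertRep A') (S' : HilbertRep B')
        (φ : BoundedOp (HilbertTensor R'.space S'.space) →⋆ₐ[ℂ]
          BoundedOp (HilbertTensor R.space (HilbertTensor S.space T.space))),
        ∀ a b, spatialRep₃ R.hom S.hom T.hom (f (a ⊗ₜ b)) =
          φ (tensorRep R'.hom S'.hom (a ⊗ₜ b))) (x : A' ⊗[ℂ] B') :
    ‖f x‖ ≤ ‖ι₂ A' B' x‖ := by
  refine norm_le_of_spatialRep₃_le _ (norm_nonneg _) fun R S T => ?_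
  obtain ⟨R', S', φ, hφ⟩ := h R S T
  have key : (spatialRep₃ R.hom S.hom T.hom).comp f = φ.comp (tensorRep R'.hom S'.hom) :=
    starHom_ext hφ
  have hx : spatialRep₃ R.hom S.hom T.hom (f x) = φ (tensorRep R'.hom S'.hom x) :=
    DFunLike.congr_fun key x
  rw [hx]
  exact (NonUnitalStarAlgHom.norm_apply_le φ _).trans (norm_tensorRep_le _ _ x)

variable (A B C) in
/-- `x ↦ 1 ⊗ x`. -/
def leg₂₃ : SpatialTensor B C →⋆ₐ[ℂ] SpatialTensor₃ A B C :=
  lift₂ (leg₂₃Alg A B C) (norm_le_of_rep _ fun R S T =>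
    ⟨S, T, ampRight R.space _, fun _ _ => spatialRep₃_leg₂₃Alg R.hom S.hom T.hom _⟩)

theorem leg₂₃_ι₂ (x : B ⊗[ℂ] C) : leg₂₃ A B C (ι₂ B C x) = leg₂₃Alg A B C x :=
  lift₂_ι₂ _ _ x

theorem leg₁_commute_leg₂₃ (a : A) (x : SpatialTensor B C) :
    Commute (leg₁ A B C a) (leg₂₃ A B C x) := by
  have h : (fun x => leg₁ A B C a * leg₂₃ A B C x) = fun x => leg₂₃ A B C x * leg₁ A B C a := by
    refine denseRange_ι₂.equalizer ((continuous_starHom _).const_mul _)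
      ((continuous_starHom _).mul_const _) (funext fun x => ?_)
    change leg₁ A B C a * leg₂₃ A B C (ι₂ B C x) = leg₂₃ A B C (ι₂ B C x) * leg₁ A B C a
    rw [leg₂₃_ι₂]
    exact leg₁_commute_leg₂₃Alg a x
  exact congrFun h x

theorem leg₁_commute_leg₂ (a : A) (b : B) : Commute (leg₁ A B C a) (leg₂ A B C b) :=
  leg₁_commute_leg₂₃Alg a (b ⊗ₜ 1)

variable (A B C) in
/-- `a ⊗ b ↦ a ⊗ b ⊗ 1` on the algebraic tensor product. -/
def leg₁₂Alg : A ⊗[ℂ] B →⋆ₐ[ℂ] SpatialTensor₃ A B C :=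
  starLift (leg₁ A B C) (leg₂ A B C) fun a b => leg₁_commute_leg₂ a b

theorem spatialRep₃_leg₁₂Alg (π : A →⋆ₐ[ℂ] BoundedOp H) (σ : B →⋆ₐ[ℂ] BoundedOp K)
    (τ : C →⋆ₐ[ℂ] BoundedOp L) (a : A) (b : B) :
    spatialRep₃ π σ τ (leg₁₂Alg A B C (a ⊗ₜ b)) =
      reassoc H K L (ampLeft _ L (tensorRep π σ (a ⊗ₜ b))) := by
  rw [leg₁₂Alg, starLift_tmul, map_mul, spatialRep₃_leg₁, spatialRep₃_leg₂, tensorRep_tmul,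
    map_mul, map_mul, reassoc_left, reassoc_middle]

variable (A B C) in
/-- `x ↦ x ⊗ 1`. -/
def leg₁₂ : SpatialTensor A B →⋆ₐ[ℂ] SpatialTensor₃ A B C :=
  lift₂ (leg₁₂Alg A B C) (norm_le_of_rep _ fun R S T =>
    ⟨R, S, (reassoc _ _ _).comp (ampLeft _ T.space), fun a b =>
      spatialRep₃_leg₁₂Alg R.hom S.hom T.hom a b⟩)

theorem leg₁₂_ι₂ (x : A ⊗[ℂ] B) : leg₁₂ A B C (ι₂ A B x) = leg₁₂Alg A B C x :=
  lift₂_ι₂ _ _ x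

theorem leg₁₂_commute_leg₃ (x : SpatialTensor A B) (c : C) :
    Commute (leg₁₂ A B C x) (leg₃ A B C c) := by
  have h : (fun x => leg₁₂ A B C x * leg₃ A B C c) = fun x => leg₃ A B C c * leg₁₂ A B C x := by
    refine denseRange_ι₂.equalizer ((continuous_starHom _).mul_const _)
      ((continuous_starHom _).const_mul _) (funext fun x => ?_)
    change leg₁₂ A B C (ι₂ A B x) * leg₃ A B C c = leg₃ A B C c * leg₁₂ A B C (ι₂ A B x)
    rw [leg₁₂_ι₂]
    induction x using TensorProduct.induction_on with
    | zero => rw [map_zero, zero_mul, mul_zero]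
    | add a b ha hb => rw [map_add, add_mul, mul_add, ha, hb]
    | tmul a b =>
      rw [leg₁₂Alg, starLift_tmul]
      have h1 : Commute (leg₁ A B C a) (leg₃ A B C c) := leg₁_commute_leg₂₃Alg a (1 ⊗ₜ c)
      have h2 : Commute (leg₂ A B C b) (leg₃ A B C c) := by
        have h3 : Commute (includeLeftStar B C b) (includeRightStar B C c) := by
          change (b ⊗ₜ[ℂ] (1 : C)) * ((1 : B) ⊗ₜ[ℂ] c) = ((1 : B) ⊗ₜ[ℂ] c) * (b ⊗ₜ[ℂ] (1 : C))
          simp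
        exact h3.map (leg₂₃Alg A B C)
      exact h1.mul_left h2
  exact congrFun h x

theorem spatialRep₃_leg₂₃ (π : A →⋆ₐ[ℂ] BoundedOp H) (σ : B →⋆ₐ[ℂ] BoundedOp K)
    (τ : C →⋆ₐ[ℂ] BoundedOp L) (x : SpatialTensor B C) :
    spatialRep₃ π σ τ (leg₂₃ A B C x) = ampRight H (HilbertTensor K L) (spatialRep σ τ x) := by
  have h : (spatialRep₃ π σ τ).comp (leg₂₃ A B C) = (ampRight H _).comp (spatialRep σ τ) := by
    refine spatialHom_ext fun b c => ?_
    change spatialRep₃ π σ τ (leg₂₃ A B C (ι₂ B C (b ⊗ₜ c))) =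
      ampRight H _ (spatialRep σ τ (ι₂ B C (b ⊗ₜ c)))
    rw [leg₂₃_ι₂, spatialRep₃_leg₂₃Alg, spatialRep_ι₂]
  exact DFunLike.congr_fun h x

theorem spatialRep₃_leg₁₂ (π : A →⋆ₐ[ℂ] BoundedOp H) (σ : B →⋆ₐ[ℂ] BoundedOp K)
    (τ : C →⋆ₐ[ℂ] BoundedOp L) (x : SpatialTensor A B) :
    spatialRep₃ π σ τ (leg₁₂ A B C x) = reassoc H K L (ampLeft _ L (spatialRep π σ x)) := by
  have h : (spatialRep₃ π σ τ).comp (leg₁₂ A B C) =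
      ((reassoc H K L).comp (ampLeft _ L)).comp (spatialRep π σ) := by
    refine spatialHom_ext fun b c => ?_
    change spatialRep₃ π σ τ (leg₁₂ A B C (ι₂ A B (b ⊗ₜ c))) =
      reassoc H K L (ampLeft _ L (spatialRep π σ (ι₂ A B (b ⊗ₜ c))))
    rw [leg₁₂_ι₂, spatialRep₃_leg₁₂Alg, spatialRep_ι₂]
  exact DFunLike.congr_fun h x

/-- `id ⊗ f` on the algebraic tensor product. -/
def idTensorAlg (f : B →⋆ₐ[ℂ] SpatialTensor C D) : A ⊗[ℂ] B →⋆ₐ[ℂ] SpatialTensor₃ A C D :=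
  starLift (leg₁ A C D) ((leg₂₃ A C D).comp f) fun a b => leg₁_commute_leg₂₃ a (f b)

/-- `f ⊗ id` on the algebraic tensor product. -/
def tensorIdAlg (f : A →⋆ₐ[ℂ] SpatialTensor C D) : A ⊗[ℂ] B →⋆ₐ[ℂ] SpatialTensor₃ C D B :=
  starLift ((leg₁₂ C D B).comp f) (leg₃ C D B) fun a b => leg₁₂_commute_leg₃ (f a) b

/-- `id ⊗ f : A ⊗ B → A ⊗ (C ⊗ D)`, for a ⋆-homomorphism `f : B → C ⊗ D`. -/
def idTensor (f : B →⋆ₐ[ℂ] SpatialTensor C D) : SpatialTensor A B →⋆ₐ[ℂ] SpatialTensor₃ A C D :=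
  lift₂ (idTensorAlg f) (norm_le_of_rep _ fun R S T =>
    ⟨R, ⟨HilbertTensor S.space T.space, (spatialRep S.hom T.hom).comp f⟩, StarAlgHom.id ℂ _,
      fun a b => by
        refine (congrArg _ (starLift_tmul _ _ _ a b)).trans ?_
        refine (map_mul _ _ _).trans ?_
        refine (congrArg₂ (· * ·) (spatialRep₃_leg₁ R.hom S.hom T.hom a)
          (spatialRep₃_leg₂₃ R.hom S.hom T.hom (f b))).trans ?_
        exact (tensorRep_tmul R.hom ((spatialRep S.hom T.hom).comp f) a b).symm⟩)

/-- `f ⊗ id : A ⊗ B → (C ⊗ D) ⊗ B`, for a ⋆-homomorphism `f : A → C ⊗ D`. -/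
def tensorId (f : A →⋆ₐ[ℂ] SpatialTensor C D) : SpatialTensor A B →⋆ₐ[ℂ] SpatialTensor₃ C D B :=
  lift₂ (tensorIdAlg f) (norm_le_of_rep _ fun R S T =>
    ⟨⟨HilbertTensor R.space S.space, (spatialRep R.hom S.hom).comp f⟩, T, reassoc _ _ _,
      fun a b => by
        refine (congrArg _ (starLift_tmul _ _ _ a b)).trans ?_
        refine (map_mul _ _ _).trans ?_
        refine (congrArg₂ (· * ·) (spatialRep₃_leg₁₂ R.hom S.hom T.hom (f a))
          ((spatialRep₃_leg₃ R.hom S.hom T.hom b).trans (reassoc_right _).symm)).trans ?_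
        refine (map_mul _ _ _).symm.trans (congrArg _ ?_)
        exact (tensorRep_tmul ((spatialRep R.hom S.hom).comp f) T.hom a b).symm⟩)

end Tensor

/-! ### Compact quantum groups, cocycles and corepresentations -/

/-- A compact quantum group structure on the unital C⋆-algebra `Q`: a coassociative unital
⋆-homomorphism `Δ : Q → Q ⊗ Q` such that the linear spans of `Δ(Q)(1 ⊗ Q)` and of `Δ(Q)(Q ⊗ 1)` are
norm dense in `Q ⊗ Q`. -/
structure CompactQuantumGroup (Q : Type u) [CStarAlgebra Q] where
  /-- The comultiplication `Δ`. -/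
  comul : Q →⋆ₐ[ℂ] SpatialTensor Q Q
  /-- Coassociativity: `(Δ ⊗ id)Δ = (id ⊗ Δ)Δ`. -/
  coassoc : ∀ x, tensorId comul (comul x) = idTensor comul (comul x)
  /-- Density of `Δ(Q)(1 ⊗ Q)`. -/
  dense_right : Dense (Submodule.span ℂ
    (Set.range fun p : Q × Q => comul p.1 * inRight Q Q p.2) : Set (SpatialTensor Q Q))
  /-- Density of `Δ(Q)(Q ⊗ 1)`. -/
  dense_left : Dense (Submodule.span ℂ
    (Set.range fun p : Q × Q => comul p.1 * inLeft Q Q p.2) : Set (SpatialTensor Q Q))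

namespace CompactQuantumGroup

variable {Q : Type u} [CStarAlgebra Q] (G : CompactQuantumGroup Q)

/-- A unitary `Ω` in `Q ⊗ Q` is a right 2-cocycle if
`(id ⊗ Δ)(Ω) (1 ⊗ Ω) = (Δ ⊗ id)(Ω) (Ω ⊗ 1)`. -/
def IsRightCocycle (Ω : SpatialTensor Q Q) : Prop :=
  Ω ∈ unitary (SpatialTensor Q Q) ∧
    idTensor G.comul Ω * leg₂₃ Q Q Q Ω = tensorId G.comul Ω * leg₁₂ Q Q Q Ω

/-- A unitary `Ω` in `Q ⊗ Q` is a left 2-cocycle if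
`(1 ⊗ Ω) (id ⊗ Δ)(Ω) = (Ω ⊗ 1) (Δ ⊗ id)(Ω)`. -/
def IsLeftCocycle (Ω : SpatialTensor Q Q) : Prop :=
  Ω ∈ unitary (SpatialTensor Q Q) ∧
    leg₂₃ Q Q Q Ω * idTensor G.comul Ω = leg₁₂ Q Q Q Ω * tensorId G.comul Ω

/-- `Ω` is invariant if it commutes with `Δ x` for all `x`. -/
def IsInvariant (Ω : SpatialTensor Q Q) : Prop :=
  ∀ x, Ω * G.comul x = G.comul x * Ω

/-! For a Hilbert space `H` with a finite orthonormal basis indexed by `n`, the C⋆-algebra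
`B(H) ⊗ Q` is the algebra of `n × n` matrices over `Q`. In these terms `(id ⊗ f)(U)` is `U.map f`,
`U₁₂` is `U.map (inLeft Q Q)`, `U₁₃` is `U.map (inRight Q Q)`, and the tensor product
`U ⊗ V = U₁₃ V₂₃`, in `B(H ⊗ K) ⊗ Q`, is the Kronecker product of matrices. -/

section Corep

variable {n : Type*} [Fintype n] [DecidableEq n]

/-- A finite-dimensional unitary corepresentation: `(id ⊗ Δ)(V) = V₁₂ V₁₃`. -/
def IsCorepresentation (V : Matrix n n Q) : Prop :=
  V ∈ unitary (Matrix n n Q) ∧ V.map G.comul = V.map (inLeft Q Q) * V.map (inRight Q Q)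

/-- `U` is a unitary right projective corepresentation with right 2-cocycle `Ω`:
`(id ⊗ Δ(·)Ω)(U) = U₁₂ U₁₃`. -/
def IsRightProjective (U : Matrix n n Q) (Ω : SpatialTensor Q Q) : Prop :=
  U ∈ unitary (Matrix n n Q) ∧ G.IsRightCocycle Ω ∧
    U.map (fun x => G.comul x * Ω) = U.map (inLeft Q Q) * U.map (inRight Q Q)

/-- The vector `∑ s i j • (i ⊗ j ⊗ 1)`, with entries in `Q`, given by a vector with entries `s`. -/
def scalarVec {m : Type*} (s : Matrix m n ℂ) : m × n → Q := fun p => algebraMap ℂ Q (s p.1 p.2)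

/-- `Ubar`, in `B(H̄) ⊗ Q`, is a conjugate of `U`, in `B(H) ⊗ Q`: it is unitary, and there are
vectors `s` in `H̄ ⊗ H`, fixed by `Ubar ⊗ U`, and `t` in `H ⊗ H̄`, fixed by `U ⊗ Ubar`, which solve
the conjugate equations `(s* ⊗ id)(id ⊗ t) = id` on `H̄` and `(t* ⊗ id)(id ⊗ s) = id` on `H`. Here
`H̄` carries the basis conjugate to that of `H`, and vectors are given by their coefficients. -/
def IsConjugate (U Ubar : Matrix n n Q) : Prop :=
  Ubar ∈ unitary (Matrix n n Q) ∧
    ∃ s t : Matrix n n ℂ,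
      (Ubar ⊗ₖ U).mulVec (scalarVec s) = scalarVec s ∧
      (U ⊗ₖ Ubar).mulVec (scalarVec t) = scalarVec t ∧
      s.map star * t = 1 ∧ t.map star * s = 1

/-- `U` is strongly right projective: it is a unitary that has a conjugate, and `U ⊗ V ⊗ Ubar` is a
corepresentation for all corepresentations `V` and all conjugates `Ubar` of `U`. -/
def IsStronglyRightProjective (U : Matrix n n Q) : Prop :=
  U ∈ unitary (Matrix n n Q) ∧ (∃ Ubar, IsConjugate U Ubar) ∧
    ∀ Ubar, IsConjugate U Ubar → ∀ (m : ℕ) (V : Matrix (Fin m) (Fin m) Q),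
      G.IsCorepresentation V → G.IsCorepresentation ((U ⊗ₖ V) ⊗ₖ Ubar)

/-- `U` is strongly left projective: it is a unitary that has a conjugate, and `Ubar ⊗ V ⊗ U` is a
corepresentation for all corepresentations `V` and all conjugates `Ubar` of `U`. -/
def IsStronglyLeftProjective (U : Matrix n n Q) : Prop :=
  U ∈ unitary (Matrix n n Q) ∧ (∃ Ubar, IsConjugate U Ubar) ∧
    ∀ Ubar, IsConjugate U Ubar → ∀ (m : ℕ) (V : Matrix (Fin m) (Fin m) Q),
      G.IsCorepresentation V → G.IsCorepresentation ((Ubar ⊗ₖ V) ⊗ₖ U)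

end Corep

end CompactQuantumGroup

end

end CQG

/-! Strong projectivity comes down to a single unitary. Call `ω` in `Q ⊗ Q` compensating for `U`,
`V` if it commutes with `Δ(Q)`, `Δ(U) = U₁₂U₁₃ω` and `Δ(V) = ω*V₁₂V₁₃` (`IsCompensated`). When `Δ`
is applied to `U ⊗ W ⊗ V` with `W` a corepresentation, `ω` and `ω*` surround `Δ(W)` and cancel, so
the product is a corepresentation. Conversely (`exists_isCompensated`), if all these products are
corepresentations, then `W = 1` shows that `V₁₂V₁₃Δ(V)*` and `(U₁₂U₁₃)*Δ(U)` are diagonal with the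
same constant entry `ω`. A general `W` shows that `ω` commutes with `Δ` of its coefficients, hence
with `Δ(Q)`, because such coefficients span a dense subspace. The notion is symmetric under
exchanging `U` with `V` and `ω` with `ω*`, which is (b).

For (a), comparing `Δ(U)Ω = U₁₂U₁₃` with `Δ(U) = U₁₂U₁₃ω` gives `Ω = ω*`, so strong projectivity
forces invariance. If `Ω` is invariant, `Ω*` is compensating for `U` and each of its conjugates,
since a conjugate is the entrywise adjoint of `U` up to a scalar similarity. It remains to produce a
conjugate, whose existence is part of strong projectivity. For (c), invariance makes `1 ⊗ Ω` commute
with the range of `id ⊗ Δ` and `Ω ⊗ 1` with that of `Δ ⊗ id`, so the two cocycle identities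
coincide.

The two substantial inputs, the density of coefficients and the existence of a conjugate, both rest
on the Haar state `h` (`exists_isHaar`). Cesàro means give a state invariant under convolution with
one given state. Invariance passes to the states of which that one is an average, and weak-*
compactness gives invariance under all states at once.

The conjugate comes from the matrix `F = (id ⊗ h)(UᵀŪ)`, where `Ū` is the entrywise adjoint. Since
`Ω` cancels in `Δ(UᵀŪ)`, invariance gives `UᵀFŪ = F`. As `h` need not be faithful, the invertibility
of `F` requires an argument (`eq_zero_of_null`). With `F = T*T`, the matrix `TŪT⁻¹` is an isometry;
the same construction for `U*` in the co-opposite makes it unitary.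

Density is the Peter–Weyl theorem. Convolution operators on the GNS space of `h` are compact
intertwiners of the regular corepresentation, and the nonzero eigenspaces of their squares `C*C`
carry finite-dimensional corepresentations. No nonzero vector is killed by all convolutions, so
these eigenspaces account for all coefficients of the regular corepresentation, which span a dense
subspace of `Q`. -/

namespace CQG
noncomputable section

set_option linter.unusedSectionVars false

/-! ### States and their representations -/

section States

variable {A : Type u} [CStarAlgebra A]

/-- A state: a functional of norm at most one taking the value one at the unit. -/
def IsState (f : A →L[ℂ] ℂ) : Prop := ‖f‖ ≤ 1 ∧ f 1 = 1

theorem IsState.norm_apply_le {f : A →L[ℂ] ℂ} (hf : IsState f) (x : A) : ‖f x‖ ≤ ‖x‖ :=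
  (f.le_opNorm x).trans (mul_le_of_le_one_left (norm_nonneg _) hf.1)

/-- Shifting `x` by `it` gives `(Im f(x) + t)² ≤ ‖x‖² + t²` for all real `t`, and the term linear in
`t` must then vanish. -/
theorem IsState.im_apply_eq_zero {f : A →L[ℂ] ℂ} (hf : IsState f) {x : A}
    (hx : IsSelfAdjoint x) : (f x).im = 0 := by
  rcases subsingleton_or_nontrivial A with hA | hA
  · rw [Subsingleton.elim x 0, map_zero, Complex.zero_im]
  have key : ∀ t : ℝ, ((f x).im + t) ^ 2 ≤ ‖x‖ ^ 2 + t ^ 2 := fun t => by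
    have h1 : ‖x + algebraMap ℂ A (t * Complex.I)‖ ^ 2 ≤ ‖x‖ ^ 2 + t ^ 2 := by
      rw [sq, ← CStarRing.norm_star_mul_self]
      have h2 : star (x + algebraMap ℂ A (t * Complex.I)) * (x + algebraMap ℂ A (t * Complex.I)) =
          x * x + algebraMap ℂ A ((t : ℂ) ^ 2) := by
        have h3 : star (algebraMap ℂ A (t * Complex.I)) = - algebraMap ℂ A (t * Complex.I) := by
          rw [← algebraMap_star_comm, ← map_neg]
          congr 1
          simp
        rw [star_add, hx.star_eq, h3, add_mul, mul_add, mul_add, neg_mul, neg_mul, ← map_mul,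
          Algebra.commutes]
        have h4 : (t * Complex.I) * (t * Complex.I) = -(t : ℂ) ^ 2 := by
          linear_combination (t : ℂ) ^ 2 * Complex.I_sq
        rw [h4, map_neg]
        abel
      rw [h2]
      refine (norm_add_le _ _).trans (add_le_add ((norm_mul_le _ _).trans (sq ‖x‖).ge) ?_)
      rw [norm_algebraMap']
      simp
    have h5 : ((f x).im + t) ^ 2 ≤ ‖f (x + algebraMap ℂ A (t * Complex.I))‖ ^ 2 := by
      have h6 : (f x).im + t = (f (x + algebraMap ℂ A (t * Complex.I))).im := by
        rw [map_add, Algebra.algebraMap_eq_smul_one, map_smul, hf.2]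
        simp
      rw [h6, ← sq_abs]
      exact pow_le_pow_left₀ (abs_nonneg _) (Complex.abs_im_le_norm _) 2
    exact h5.trans ((pow_le_pow_left₀ (norm_nonneg _) (hf.norm_apply_le _) 2).trans h1)
  by_contra h
  -- This `t` makes the cross term equal to `2(‖x‖² + 1)`, which exceeds the allowed `‖x‖²`.
  have h7 := key ((‖x‖ ^ 2 + 1) / (f x).im)
  have h8 : (f x).im * ((‖x‖ ^ 2 + 1) / (f x).im) = ‖x‖ ^ 2 + 1 := by field_simp
  nlinarith [sq_nonneg (f x).im, sq_nonneg ‖x‖]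

/-- States are positive. -/
theorem IsState.apply_star_mul_self_nonneg {f : A →L[ℂ] ℂ} (hf : IsState f) (x : A) :
    0 ≤ (f (star x * x)).re ∧ (f (star x * x)).im = 0 := by
  let _ := CStarAlgebra.spectralOrder A
  have _ := CStarAlgebra.spectralOrderedRing A
  refine ⟨?_, hf.im_apply_eq_zero (IsSelfAdjoint.star_mul_self x)⟩
  set y := star x * x with hy
  have hy0 : 0 ≤ y := star_mul_self_nonneg x
  -- Then `|‖y‖ - f(y)| ≤ ‖y‖`, which excludes a negative real part.
  have h1 : ‖algebraMap ℂ A (‖y‖ : ℂ) - y‖ ≤ ‖y‖ := by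
    have h2 : y ≤ algebraMap ℝ A ‖y‖ := IsSelfAdjoint.le_algebraMap_norm_self (.star_mul_self x)
    have h3 : algebraMap ℂ A (‖y‖ : ℂ) = algebraMap ℝ A ‖y‖ := by
      simp [Algebra.algebraMap_eq_smul_one]
    rw [h3, CStarAlgebra.norm_le_iff_le_algebraMap _ (norm_nonneg _) (sub_nonneg.2 h2)]
    exact sub_le_self _ hy0
  have h4 := (hf.norm_apply_le _).trans h1
  rw [map_sub, Algebra.algebraMap_eq_smul_one, map_smul, hf.2] at h4
  have h5 := (Complex.abs_re_le_norm _).trans h4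
  have h6 := (abs_le.1 h5).2
  simp at h6
  linarith

/-- The states of a C⋆-algebra attain the norm of each element of the form `x* x`. -/
theorem exists_state_apply_star_mul_self [Nontrivial A] (x : A) :
    ∃ f : A →L[ℂ] ℂ, IsState f ∧ f (star x * x) = (‖x‖ : ℂ) ^ 2 := by
  let _ := CStarAlgebra.spectralOrder A
  have _ := CStarAlgebra.spectralOrderedRing A
  have main : ∀ x : A, x ≠ 0 → ∃ f : A →L[ℂ] ℂ, IsState f ∧ f (star x * x) = (‖x‖ : ℂ) ^ 2 := by
    intro x hx
    set y := star x * x with hy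
    have hny : ‖y‖ = ‖x‖ ^ 2 := by rw [hy, CStarRing.norm_star_mul_self, sq]
    have hpos : 0 < ‖y‖ := by rw [hny]; have := norm_pos_iff.2 hx; positivity
    have hy0 : 0 ≤ y := star_mul_self_nonneg x
    have h1 : ‖y‖ ∈ spectrum ℝ y := CStarAlgebra.norm_mem_spectrum_of_nonneg hy0
    -- A functional norming `‖y‖·1 + y`, of norm `2‖y‖`, has to attain its bound at `1` and at `y`
    -- simultaneously, so it is a state norming `y`.
    have h2 : ‖y‖ + ‖y‖ ∈ spectrum ℝ (algebraMap ℝ A ‖y‖ + y) := by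
      rw [spectrum.add_mem_add_iff]; exact h1
    have h3 : ‖y‖ + ‖y‖ ≤ ‖algebraMap ℝ A ‖y‖ + y‖ := by
      have := spectrum.norm_le_norm_of_mem h2
      rwa [Real.norm_of_nonneg (by positivity)] at this
    have hz : ‖algebraMap ℝ A ‖y‖ + y‖ ≠ 0 := by linarith
    obtain ⟨g, hg1, hg2⟩ := exists_dual_vector ℂ _ hz
    have h4 : g (algebraMap ℝ A ‖y‖ + y) = ‖y‖ * g 1 + g y := by
      rw [map_add, Algebra.algebraMap_eq_smul_one, ← Complex.coe_smul, map_smul, smul_eq_mul]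
    have h5 : ‖g 1‖ ≤ 1 := (g.le_opNorm 1).trans (by rw [hg1, norm_one, one_mul])
    have h6 : ‖g y‖ ≤ ‖y‖ := (g.le_opNorm y).trans (by rw [hg1, one_mul])
    have h7 : (‖y‖ * g 1 + g y).re ≥ ‖y‖ + ‖y‖ := by
      rw [← h4, hg2]
      simpa using h3
    have h8 : (g 1).re ≤ 1 := (Complex.re_le_norm _).trans h5
    have h9 : (g y).re ≤ ‖y‖ := (Complex.re_le_norm _).trans h6
    have h10 : (‖y‖ * g 1 + g y).re = ‖y‖ * (g 1).re + (g y).re := by simp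
    have h11 : (g 1).re = 1 := by nlinarith
    have h12 : (g y).re = ‖y‖ := by nlinarith
    have eq_of : ∀ (z : ℂ) (r : ℝ), ‖z‖ ≤ r → z.re = r → z = r := fun z r hz hr => by
      have h13 : z.re ^ 2 + z.im ^ 2 ≤ r ^ 2 := by
        have := pow_le_pow_left₀ (norm_nonneg z) hz 2
        rw [Complex.sq_norm, Complex.normSq_apply] at this
        nlinarith
      have h14 : z.im = 0 := by
        rw [hr] at h13
        exact pow_eq_zero_iff (two_ne_zero) |>.1 (le_antisymm (by linarith) (sq_nonneg _))
      exact Complex.ext (by simpa using hr) (by simpa using h14)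
    refine ⟨g, ⟨hg1.le, by simpa using eq_of _ 1 h5 h11⟩, ?_⟩
    rw [eq_of _ _ h6 h12, hny]
    norm_cast
  by_cases hx : x = 0
  · obtain ⟨f, hf, -⟩ := main 1 one_ne_zero
    exact ⟨f, hf, by simp [hx]⟩
  · exact main x hx

/-- A vector functional `a ↦ ⟪l, π a r⟫`, for a representation `π`. -/
structure VectorFunctional (A : Type u) [CStarAlgebra A] extends HilbertRep A where
  /-- The left vector. -/
  l : space
  /-- The right vector. -/
  r : space

/-- The operator by which an element acts in a representation. -/
def HilbertRep.op (R : HilbertRep A) (a : A) : R.space →L[ℂ] R.space := R.hom a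

section Op

variable (R : HilbertRep A)

theorem HilbertRep.op_one : R.op 1 = 1 := map_one R.hom
theorem HilbertRep.op_mul (a b : A) : R.op (a * b) = R.op a * R.op b := map_mul R.hom a b
theorem HilbertRep.op_add (a b : A) : R.op (a + b) = R.op a + R.op b := map_add R.hom a b
theorem HilbertRep.op_sub (a b : A) : R.op (a - b) = R.op a - R.op b := map_sub R.hom a b
theorem HilbertRep.op_smul (c : ℂ) (a : A) : R.op (c • a) = c • R.op a := map_smul R.hom c a
theorem HilbertRep.op_star (a : A) : R.op (star a) = ContinuousLinearMap.adjoint (R.op a) :=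
  map_star R.hom a
theorem HilbertRep.norm_op_le (a : A) : ‖R.op a‖ ≤ ‖a‖ := NonUnitalStarAlgHom.norm_apply_le R.hom a

/-- The action of a representation, as a continuous linear map. -/
def HilbertRep.opL : A →L[ℂ] R.space →L[ℂ] R.space :=
  LinearMap.mkContinuous ⟨⟨R.op, R.op_add⟩, R.op_smul⟩ 1 fun a => by
    rw [one_mul]; exact R.norm_op_le a

theorem HilbertRep.opL_apply (a : A) : R.opL a = R.op a := rfl

theorem HilbertRep.op_mul_apply (a b : A) (x : R.space) : R.op (a * b) x = R.op a (R.op b x) := by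
  rw [R.op_mul]; rfl

theorem HilbertRep.inner_op_right (a : A) (x y : R.space) :
    Inner.inner ℂ x (R.op a y) = Inner.inner ℂ (R.op (star a) x) y := by
  rw [R.op_star, ContinuousLinearMap.adjoint_inner_left]

end Op

namespace VectorFunctional

/-- The functional `a ↦ ⟪l, π a r⟫`. -/
def eval (f : VectorFunctional A) : A →L[ℂ] ℂ :=
  (innerSL ℂ f.l) ∘L ((ContinuousLinearMap.apply ℂ f.space f.r) ∘L f.toHilbertRep.opL)

theorem eval_apply (f : VectorFunctional A) (a : A) :
    f.eval a = inner ℂ f.l (f.toHilbertRep.op a f.r) := rfl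

end VectorFunctional

section GNS

open scoped ComplexOrder

variable [PartialOrder A] [StarOrderedRing A]

/-- A state, as a positive linear map. -/
def IsState.toPositive {f : A →L[ℂ] ℂ} (hf : IsState f) : A →ₚ[ℂ] ℂ :=
  PositiveLinearMap.mk₀ f.toLinearMap fun a ha => by
    obtain ⟨b, rfl⟩ := CStarAlgebra.nonneg_iff_eq_star_mul_self.1 ha
    have := hf.apply_star_mul_self_nonneg b
    exact Complex.nonneg_iff.2 ⟨this.1, this.2.symm⟩

end GNS

/-- The GNS representation of a state. -/
theorem IsState.exists_cyclic {f : A →L[ℂ] ℂ} (hf : IsState f) :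
    ∃ (R : HilbertRep A) (ξ : R.space), ‖ξ‖ = 1 ∧ (∀ a, f a = inner ℂ ξ (R.op a ξ)) ∧
      DenseRange fun a => R.op a ξ := by
  let _ := CStarAlgebra.spectralOrder A
  have _ := CStarAlgebra.spectralOrderedRing A
  let p := hf.toPositive
  let R : HilbertRep A := ⟨p.GNS, p.gnsStarAlgHom⟩
  let ξ : R.space := ((p.toPreGNS 1 : p.PreGNS) : p.GNS)
  have hop : ∀ a, R.op a ξ = ((p.toPreGNS a : p.PreGNS) : p.GNS) := fun a => by
    change p.gnsStarAlgHom a ((p.toPreGNS 1 : p.PreGNS) : p.GNS) = _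
    simp
  have hin : ∀ a, f a = inner ℂ ξ (R.op a ξ) := fun a => by
    rw [hop]
    refine Eq.trans ?_ (Completion.inner_coe (𝕜 := ℂ) _ _).symm
    rw [p.preGNS_inner_def]
    simp
    rfl
  refine ⟨R, ξ, ?_, hin, ?_⟩
  · have h := hin 1
    rw [R.op_one, hf.2, one_apply_eq_self, inner_self_eq_norm_sq_to_K] at h
    have h2 : ‖ξ‖ ^ 2 = 1 := by
      have h3 : ((‖ξ‖ ^ 2 : ℝ) : ℂ) = ((1 : ℝ) : ℂ) := by rw [Complex.ofReal_pow]; exact h.symm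
      exact Complex.ofReal_injective h3
    nlinarith [norm_nonneg ξ]
  · simp_rw [hop]
    exact (Completion.denseRange_coe (α := p.PreGNS)).comp p.toPreGNS.surjective.denseRange
      (Completion.continuous_coe _)

end States

/-! ### Product functionals and slice maps -/

section Slices

variable {A B C D : Type u} [CStarAlgebra A] [CStarAlgebra B] [CStarAlgebra C] [CStarAlgebra D]

theorem HilbertTensor.inner_tmul {H K : Type u} [NormedAddCommGroup H] [InnerProductSpace ℂ H]
    [NormedAddCommGroup K] [InnerProductSpace ℂ K] (x x' : H) (y y' : K) :
    inner ℂ (HilbertTensor.tmul x y) (HilbertTensor.tmul x' y') = inner ℂ x x' * inner ℂ y y' :=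
  (Completion.inner_coe (𝕜 := ℂ) _ _).trans (TensorProduct.inner_tmul (𝕜 := ℂ) x x' y y')

theorem HilbertTensor.norm_tmul {H K : Type u} [NormedAddCommGroup H] [InnerProductSpace ℂ H]
    [NormedAddCommGroup K] [InnerProductSpace ℂ K] (x : H) (y : K) :
    ‖HilbertTensor.tmul x y‖ = ‖x‖ * ‖y‖ :=
  (Completion.norm_coe _).trans (TensorProduct.norm_tmul (𝕜 := ℂ) x y)

/-- The tensor product of two representations. -/
def HilbertRep.tensor (R : HilbertRep A) (S : HilbertRep B) : HilbertRep (SpatialTensor A B) where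
  space := HilbertTensor R.space S.space
  hom := spatialRep R.hom S.hom

theorem HilbertRep.tensor_op (R : HilbertRep A) (S : HilbertRep B) (a : A) (b : B) :
    (R.tensor S).op (ι₂ A B (a ⊗ₜ b)) = opTensor (R.op a) (S.op b) := by
  refine (spatialRep_ι₂ R.hom S.hom (a ⊗ₜ b)).trans ((tensorRep_tmul R.hom S.hom a b).trans ?_)
  refine (opTensor_mul (R.op a) 1 1 (S.op b)).symm.trans ?_
  rw [mul_one, one_mul]

/-- Elementary tensors in the tensor product of two representations. -/
def HilbertRep.tmul {R : HilbertRep A} {S : HilbertRep B} (x : R.space) (y : S.space) :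
    (R.tensor S).space := HilbertTensor.tmul x y

theorem HilbertRep.tensor_op_tmul {R : HilbertRep A} {S : HilbertRep B} (a : A) (b : B)
    (x : R.space) (y : S.space) :
    (R.tensor S).op (ι₂ A B (a ⊗ₜ b)) (HilbertRep.tmul x y) =
      HilbertRep.tmul (R.op a x) (S.op b y) := by
  rw [HilbertRep.tensor_op]
  exact opTensor_tmul _ _ _ _

theorem HilbertRep.inner_tmul {R : HilbertRep A} {S : HilbertRep B} (x x' : R.space)
    (y y' : S.space) : Inner.inner ℂ (HilbertRep.tmul x y) (HilbertRep.tmul x' y') =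
      Inner.inner ℂ x x' * Inner.inner ℂ y y' := HilbertTensor.inner_tmul _ _ _ _

theorem HilbertRep.norm_tmul {R : HilbertRep A} {S : HilbertRep B} (x : R.space) (y : S.space) :
    ‖HilbertRep.tmul x y‖ = ‖x‖ * ‖y‖ := HilbertTensor.norm_tmul _ _

theorem HilbertRep.tensor_ext {R : HilbertRep A} {S : HilbertRep B} {Y : Type*}
    [NormedAddCommGroup Y] [NormedSpace ℂ Y] {F G : (R.tensor S).space →L[ℂ] Y}
    (h : ∀ x y, F (HilbertRep.tmul x y) = G (HilbertRep.tmul x y)) : F = G :=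
  HilbertTensor.ext h

namespace VectorFunctional

theorem norm_eval_le (f : VectorFunctional A) (a : A) : ‖f.eval a‖ ≤ ‖f.l‖ * ‖f.r‖ * ‖a‖ := by
  rw [eval_apply]
  refine (norm_inner_le_norm _ _).trans ?_
  have h := (f.toHilbertRep.op a).le_opNorm f.r
  have h2 := mul_le_mul_of_nonneg_right (f.toHilbertRep.norm_op_le a) (norm_nonneg f.r)
  calc ‖f.l‖ * ‖f.toHilbertRep.op a f.r‖ ≤ ‖f.l‖ * (‖a‖ * ‖f.r‖) := by gcongr; exact h.trans h2
    _ = _ := by ring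

/-- The product of two vector functionals. -/
def prod (f : VectorFunctional A) (g : VectorFunctional B) :
    VectorFunctional (SpatialTensor A B) where
  toHilbertRep := f.toHilbertRep.tensor g.toHilbertRep
  l := HilbertRep.tmul f.l g.l
  r := HilbertRep.tmul f.r g.r

theorem prod_eval_tmul (f : VectorFunctional A) (g : VectorFunctional B) (a : A) (b : B) :
    (f.prod g).eval (ι₂ A B (a ⊗ₜ b)) = f.eval a * g.eval b := by
  rw [eval_apply, eval_apply, eval_apply]
  exact (congrArg (inner ℂ _) (HilbertRep.tensor_op_tmul _ _ _ _)).trans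
    (HilbertRep.inner_tmul _ _ _ _)

/-- The composition of a vector functional with a ⋆-homomorphism. -/
def comap (f : VectorFunctional B) (φ : A →⋆ₐ[ℂ] B) : VectorFunctional A where
  space := f.space
  hom := f.hom.comp φ
  l := f.l
  r := f.r

theorem comap_eval (f : VectorFunctional B) (φ : A →⋆ₐ[ℂ] B) (a : A) :
    (f.comap φ).eval a = f.eval (φ a) := rfl

end VectorFunctional

/-- In the GNS representation of a state with `f(a*a) = ‖a‖²` and cyclic vector `ξ`, the functional
`⟪π(a)ξ, π(·)ξ⟫` takes the value `‖a‖²` at `a`, while its vectors have norms `‖a‖` and `1`. -/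
theorem norm_le_of_vectorFunctional (a : A) {c : ℝ} (hc : 0 ≤ c)
    (h : ∀ f : VectorFunctional A, ‖f.eval a‖ ≤ c * (‖f.l‖ * ‖f.r‖)) : ‖a‖ ≤ c := by
  rcases subsingleton_or_nontrivial A with hA | hA
  · rwa [Subsingleton.elim a 0, norm_zero]
  obtain ⟨f, hf, hfa⟩ := exists_state_apply_star_mul_self a
  obtain ⟨R, ξ, hξ, hR, -⟩ := hf.exists_cyclic
  have h1 : ‖R.op a ξ‖ = ‖a‖ := by
    have h2 : ((‖R.op a ξ‖ ^ 2 : ℝ) : ℂ) = ((‖a‖ ^ 2 : ℝ) : ℂ) := by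
      rw [Complex.ofReal_pow, Complex.ofReal_pow, ← hfa, hR, R.op_mul_apply, R.inner_op_right,
        star_star]
      exact (inner_self_eq_norm_sq_to_K (𝕜 := ℂ) (R.op a ξ)).symm
    exact (sq_eq_sq₀ (norm_nonneg _) (norm_nonneg _)).1 (Complex.ofReal_injective h2)
  have h3 := h ⟨R, R.op a ξ, ξ⟩
  rw [VectorFunctional.eval_apply] at h3
  change ‖inner ℂ (R.op a ξ) (R.op a ξ)‖ ≤ c * (‖R.op a ξ‖ * ‖ξ‖) at h3
  rw [inner_self_eq_norm_sq_to_K, norm_pow, h1, hξ, mul_one] at h3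
  have h4 : ‖((‖a‖ : ℝ) : ℂ)‖ ^ 2 ≤ c * ‖a‖ := h3
  rw [Complex.norm_real, norm_norm] at h4
  by_contra h5
  push Not at h5
  nlinarith [norm_nonneg a]

theorem eq_of_vectorFunctional {a b : A} (h : ∀ f : VectorFunctional A, f.eval a = f.eval b) :
    a = b := by
  rw [← sub_eq_zero, ← norm_le_zero_iff]
  refine norm_le_of_vectorFunctional _ le_rfl fun f => ?_
  rw [map_sub, h f, sub_self, norm_zero, zero_mul]

/-- Two continuous linear maps on the spatial tensor product agree if they agree on elementary
tensors. -/
theorem spatialTensor_clm_ext {Y : Type*} [NormedAddCommGroup Y] [NormedSpace ℂ Y]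
    {S T : SpatialTensor A B →L[ℂ] Y}
    (h : ∀ a b, S (ι₂ A B (a ⊗ₜ b)) = T (ι₂ A B (a ⊗ₜ b))) : S = T := by
  refine DFunLike.coe_injective (denseRange_ι₂.equalizer S.continuous T.continuous
    (funext fun x => ?_))
  change S (ι₂ A B x) = T (ι₂ A B x)
  induction x using TensorProduct.induction_on with
  | zero => rw [map_zero, map_zero, map_zero]
  | tmul a b => exact h a b
  | add x y hx hy => rw [map_add, map_add, map_add, hx, hy]

/-- The slice map `id ⊗ g` on the algebraic tensor product. -/
def sliceRightAlg (g : B →L[ℂ] ℂ) : A ⊗[ℂ] B →ₗ[ℂ] A :=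
  TensorProduct.lift ((LinearMap.lsmul ℂ A).flip.compr₂ LinearMap.id |>.compl₂ g.toLinearMap)

theorem sliceRightAlg_tmul (g : B →L[ℂ] ℂ) (a : A) (b : B) :
    sliceRightAlg g (a ⊗ₜ b) = g b • a := rfl

/-- The slice map `f ⊗ id` on the algebraic tensor product. -/
def sliceLeftAlg (f : A →L[ℂ] ℂ) : A ⊗[ℂ] B →ₗ[ℂ] B :=
  TensorProduct.lift ((LinearMap.lsmul ℂ B).comp f.toLinearMap)

theorem sliceLeftAlg_tmul (f : A →L[ℂ] ℂ) (a : A) (b : B) :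
    sliceLeftAlg f (a ⊗ₜ b) = f a • b := rfl

theorem eval_sliceRightAlg (f : VectorFunctional A) (g : VectorFunctional B) (x : A ⊗[ℂ] B) :
    f.eval (sliceRightAlg g.eval x) = (f.prod g).eval (ι₂ A B x) := by
  induction x using TensorProduct.induction_on with
  | zero => simp
  | tmul a b =>
    rw [sliceRightAlg_tmul, map_smul, VectorFunctional.prod_eval_tmul, smul_eq_mul, mul_comm]
  | add x y hx hy => rw [map_add, map_add, map_add, map_add, hx, hy]

theorem eval_sliceLeftAlg (f : VectorFunctional A) (g : VectorFunctional B) (x : A ⊗[ℂ] B) :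
    g.eval (sliceLeftAlg f.eval x) = (f.prod g).eval (ι₂ A B x) := by
  induction x using TensorProduct.induction_on with
  | zero => simp
  | tmul a b =>
    rw [sliceLeftAlg_tmul, map_smul, VectorFunctional.prod_eval_tmul, smul_eq_mul]
  | add x y hx hy => rw [map_add, map_add, map_add, map_add, hx, hy]

/-- A product of vector functionals is again a vector functional, bounded for the spatial norm by
the norms of its vectors. This is the bound that extends the slice map to the completion. -/
theorem norm_sliceRightAlg_le (g : VectorFunctional B) (x : A ⊗[ℂ] B) :
    ‖sliceRightAlg g.eval x‖ ≤ ‖g.l‖ * ‖g.r‖ * ‖ι₂ A B x‖ := by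
  refine norm_le_of_vectorFunctional _ (by positivity) fun f => ?_
  rw [eval_sliceRightAlg]
  refine ((f.prod g).norm_eval_le _).trans_eq ?_
  change ‖HilbertRep.tmul f.l g.l‖ * ‖HilbertRep.tmul f.r g.r‖ * _ = _
  rw [HilbertRep.norm_tmul, HilbertRep.norm_tmul]
  ring

theorem norm_sliceLeftAlg_le (f : VectorFunctional A) (x : A ⊗[ℂ] B) :
    ‖sliceLeftAlg f.eval x‖ ≤ ‖f.l‖ * ‖f.r‖ * ‖ι₂ A B x‖ := by
  refine norm_le_of_vectorFunctional _ (by positivity) fun g => ?_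
  rw [eval_sliceLeftAlg]
  refine ((f.prod g).norm_eval_le _).trans_eq ?_
  change ‖HilbertRep.tmul f.l g.l‖ * ‖HilbertRep.tmul f.r g.r‖ * _ = _
  rw [HilbertRep.norm_tmul, HilbertRep.norm_tmul]
  ring

/-- The slice map `id ⊗ g`. -/
def sliceRight (g : VectorFunctional B) : SpatialTensor A B →L[ℂ] A :=
  (sliceRightAlg g.eval).extendOfNorm (ι₂ A B).toAlgHom.toLinearMap

/-- The slice map `f ⊗ id`. -/
def sliceLeft (f : VectorFunctional A) : SpatialTensor A B →L[ℂ] B :=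
  (sliceLeftAlg f.eval).extendOfNorm (ι₂ A B).toAlgHom.toLinearMap

theorem sliceRight_tmul (g : VectorFunctional B) (a : A) (b : B) :
    sliceRight g (ι₂ A B (a ⊗ₜ b)) = g.eval b • a :=
  LinearMap.extendOfNorm_eq denseRange_ι₂ ⟨_, norm_sliceRightAlg_le g⟩ (a ⊗ₜ b)

theorem sliceLeft_tmul (f : VectorFunctional A) (a : A) (b : B) :
    sliceLeft f (ι₂ A B (a ⊗ₜ b)) = f.eval a • b :=
  LinearMap.extendOfNorm_eq denseRange_ι₂ ⟨_, norm_sliceLeftAlg_le f⟩ (a ⊗ₜ b)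

theorem norm_sliceRight_le (g : VectorFunctional B) (z : SpatialTensor A B) :
    ‖sliceRight g z‖ ≤ ‖g.l‖ * ‖g.r‖ * ‖z‖ :=
  LinearMap.norm_extendOfNorm_apply_le denseRange_ι₂ _ (norm_sliceRightAlg_le g) z

theorem norm_sliceLeft_le (f : VectorFunctional A) (z : SpatialTensor A B) :
    ‖sliceLeft f z‖ ≤ ‖f.l‖ * ‖f.r‖ * ‖z‖ :=
  LinearMap.norm_extendOfNorm_apply_le denseRange_ι₂ _ (norm_sliceLeftAlg_le f) z

theorem eval_sliceRight (f : VectorFunctional A) (g : VectorFunctional B) (z : SpatialTensor A B) :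
    f.eval (sliceRight g z) = (f.prod g).eval z := by
  have h : f.eval ∘L sliceRight g = (f.prod g).eval := spatialTensor_clm_ext fun a b => by
    rw [ContinuousLinearMap.comp_apply, sliceRight_tmul, map_smul,
      VectorFunctional.prod_eval_tmul, smul_eq_mul, mul_comm]
  exact DFunLike.congr_fun h z

theorem eval_sliceLeft (f : VectorFunctional A) (g : VectorFunctional B) (z : SpatialTensor A B) :
    g.eval (sliceLeft f z) = (f.prod g).eval z := by
  have h : g.eval ∘L sliceLeft f = (f.prod g).eval := spatialTensor_clm_ext fun a b => by
    rw [ContinuousLinearMap.comp_apply, sliceLeft_tmul, map_smul,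
      VectorFunctional.prod_eval_tmul, smul_eq_mul]
  exact DFunLike.congr_fun h z

theorem tmul_eq (a : A) (b : B) : ι₂ A B (a ⊗ₜ b) = inLeft A B a * inRight A B b := by
  change _ = ι₂ A B (a ⊗ₜ 1) * ι₂ A B (1 ⊗ₜ b)
  rw [← map_mul, Algebra.TensorProduct.tmul_mul_tmul, one_mul, mul_one]

theorem inLeft_commute_inRight (a : A) (b : B) : Commute (inLeft A B a) (inRight A B b) := by
  change ι₂ A B (a ⊗ₜ 1) * ι₂ A B (1 ⊗ₜ b) = ι₂ A B (1 ⊗ₜ b) * ι₂ A B (a ⊗ₜ 1)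
  rw [← map_mul, ← map_mul, Algebra.TensorProduct.tmul_mul_tmul,
    Algebra.TensorProduct.tmul_mul_tmul, one_mul, mul_one, one_mul, mul_one]

theorem sliceRight_inLeft_mul (g : VectorFunctional B) (c : A) (z : SpatialTensor A B) :
    sliceRight g (inLeft A B c * z) = c * sliceRight g z := by
  have h : sliceRight g ∘L ContinuousLinearMap.mul ℂ _ (inLeft A B c) =
      ContinuousLinearMap.mul ℂ A c ∘L sliceRight g := spatialTensor_clm_ext fun a b => by
    simp only [ContinuousLinearMap.comp_apply, ContinuousLinearMap.mul_apply']
    change sliceRight g (ι₂ A B (c ⊗ₜ 1) * _) = _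
    rw [← map_mul, Algebra.TensorProduct.tmul_mul_tmul, one_mul, sliceRight_tmul, sliceRight_tmul,
      mul_smul_comm]
  exact DFunLike.congr_fun h z

theorem sliceRight_mul_inLeft (g : VectorFunctional B) (c : A) (z : SpatialTensor A B) :
    sliceRight g (z * inLeft A B c) = sliceRight g z * c := by
  have h : sliceRight g ∘L (ContinuousLinearMap.mul ℂ _).flip (inLeft A B c) =
      (ContinuousLinearMap.mul ℂ A).flip c ∘L sliceRight g := spatialTensor_clm_ext fun a b => by
    simp only [ContinuousLinearMap.comp_apply, ContinuousLinearMap.mul_apply',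
      ContinuousLinearMap.flip_apply]
    change sliceRight g (_ * ι₂ A B (c ⊗ₜ 1)) = _
    rw [← map_mul, Algebra.TensorProduct.tmul_mul_tmul, mul_one, sliceRight_tmul, sliceRight_tmul,
      smul_mul_assoc]
  exact DFunLike.congr_fun h z

theorem sliceLeft_inRight_mul (f : VectorFunctional A) (c : B) (z : SpatialTensor A B) :
    sliceLeft f (inRight A B c * z) = c * sliceLeft f z := by
  have h : sliceLeft f ∘L ContinuousLinearMap.mul ℂ _ (inRight A B c) =
      ContinuousLinearMap.mul ℂ B c ∘L sliceLeft f := spatialTensor_clm_ext fun a b => by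
    simp only [ContinuousLinearMap.comp_apply, ContinuousLinearMap.mul_apply']
    change sliceLeft f (ι₂ A B (1 ⊗ₜ c) * _) = _
    rw [← map_mul, Algebra.TensorProduct.tmul_mul_tmul, one_mul, sliceLeft_tmul, sliceLeft_tmul,
      mul_smul_comm]
  exact DFunLike.congr_fun h z

theorem sliceLeft_mul_inRight (f : VectorFunctional A) (c : B) (z : SpatialTensor A B) :
    sliceLeft f (z * inRight A B c) = sliceLeft f z * c := by
  have h : sliceLeft f ∘L (ContinuousLinearMap.mul ℂ _).flip (inRight A B c) =
      (ContinuousLinearMap.mul ℂ B).flip c ∘L sliceLeft f := spatialTensor_clm_ext fun a b => by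
    simp only [ContinuousLinearMap.comp_apply, ContinuousLinearMap.mul_apply',
      ContinuousLinearMap.flip_apply]
    change sliceLeft f (_ * ι₂ A B (1 ⊗ₜ c)) = _
    rw [← map_mul, Algebra.TensorProduct.tmul_mul_tmul, mul_one, sliceLeft_tmul, sliceLeft_tmul,
      smul_mul_assoc]
  exact DFunLike.congr_fun h z

/-- Product functionals separate the points of the spatial tensor product. -/
theorem eq_of_prod_eval {z w : SpatialTensor A B}
    (h : ∀ (f : VectorFunctional A) (g : VectorFunctional B),
      (f.prod g).eval z = (f.prod g).eval w) : z = w := by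
  rw [← sub_eq_zero, ← norm_le_zero_iff]
  -- The spatial norm is a supremum over product representations, so it suffices that `z` and `w`
  -- act equally in each of them.
  refine norm_le_of_supExtend_le _ (pointwiseBounded₂ A B) (z - w) le_rfl fun i => ?_
  have key : (i.1.tensor i.2).op z = (i.1.tensor i.2).op w := by
    refine HilbertRep.tensor_ext fun x y => ?_
    have h1 : innerSL ℂ ((i.1.tensor i.2).op z (HilbertRep.tmul x y)) =
        innerSL ℂ ((i.1.tensor i.2).op w (HilbertRep.tmul x y)) :=
      HilbertRep.tensor_ext fun s t => by
        rw [innerSL_apply_apply, innerSL_apply_apply, ← inner_conj_symm,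
          ← inner_conj_symm ((i.1.tensor i.2).op w (HilbertRep.tmul x y))]
        exact congrArg _ (h ⟨i.1, s, x⟩ ⟨i.2, t, y⟩)
    refine ext_inner_right ℂ fun t => ?_
    exact DFunLike.congr_fun h1 t
  change ‖(i.1.tensor i.2).op (z - w)‖ ≤ 0
  rw [HilbertRep.op_sub, key, sub_self, norm_zero]

theorem prod_eval_mul (f : VectorFunctional A) (g : VectorFunctional B) (a : A) (b : B) :
    (f.prod g).eval (inLeft A B a * inRight A B b) = f.eval a * g.eval b := by
  rw [← tmul_eq, VectorFunctional.prod_eval_tmul]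

end Slices

/-! ### Convolution of vector functionals -/

section Convolution

variable {A B C D : Type u} [CStarAlgebra A] [CStarAlgebra B] [CStarAlgebra C] [CStarAlgebra D]

theorem opTensor_one_mul_one {H K : Type u} [NormedAddCommGroup H] [InnerProductSpace ℂ H]
    [NormedAddCommGroup K] [InnerProductSpace ℂ K] (S : H →L[ℂ] H) (T : K →L[ℂ] K) :
    opTensor S 1 * opTensor 1 T = opTensor S T := by
  rw [← opTensor_mul, mul_one, one_mul]

theorem idTensor_tmul (φ : B →⋆ₐ[ℂ] SpatialTensor C D) (a : A) (b : B) :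
    idTensor φ (ι₂ A B (a ⊗ₜ b)) = leg₁ A C D a * leg₂₃ A C D (φ b) :=
  (lift₂_ι₂ _ _ _).trans (starLift_tmul _ _ _ a b)

theorem tensorId_tmul (φ : A →⋆ₐ[ℂ] SpatialTensor C D) (a : A) (b : B) :
    tensorId φ (ι₂ A B (a ⊗ₜ b)) = leg₁₂ C D B (φ a) * leg₃ C D B b :=
  (lift₂_ι₂ _ _ _).trans (starLift_tmul _ _ _ a b)

/-- A ⋆-homomorphism, as a continuous linear map. -/
def starHomL (φ : A →⋆ₐ[ℂ] B) : A →L[ℂ] B := ⟨φ.toAlgHom.toLinearMap, continuous_starHom φ⟩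

theorem starHomL_apply (φ : A →⋆ₐ[ℂ] B) (a : A) : starHomL φ a = φ a := rfl

namespace VectorFunctional

/-- The product of three vector functionals. -/
def prod₃ (f : VectorFunctional A) (g : VectorFunctional B) (k : VectorFunctional C) :
    VectorFunctional (SpatialTensor₃ A B C) where
  space := HilbertTensor f.space (HilbertTensor g.space k.space)
  hom := spatialRep₃ f.hom g.hom k.hom
  l := HilbertTensor.tmul f.l (HilbertTensor.tmul g.l k.l)
  r := HilbertTensor.tmul f.r (HilbertTensor.tmul g.r k.r)

theorem prod₃_leg₁_mul_leg₂₃ (f : VectorFunctional A) (g : VectorFunctional B)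
    (k : VectorFunctional C) (a : A) (y : SpatialTensor B C) :
    (f.prod₃ g k).eval (leg₁ A B C a * leg₂₃ A B C y) = f.eval a * (g.prod k).eval y := by
  have h : (f.prod₃ g k).toHilbertRep.op (leg₁ A B C a * leg₂₃ A B C y) =
      opTensor (f.toHilbertRep.op a) ((g.prod k).toHilbertRep.op y) := by
    refine (HilbertRep.op_mul _ _ _).trans ?_
    refine (congrArg₂ (· * ·) (spatialRep₃_leg₁ f.hom g.hom k.hom a)
      (spatialRep₃_leg₂₃ f.hom g.hom k.hom y)).trans ?_
    exact opTensor_one_mul_one (H := f.space) (K := HilbertTensor g.space k.space) _ _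
  rw [eval_apply, h]
  exact (congrArg (inner ℂ _) (opTensor_tmul _ _ _ _)).trans (HilbertTensor.inner_tmul _ _ _ _)

/-- The associativity unitary carries product vectors to product vectors, so the bracketing does not
affect the value. -/
theorem prod₃_leg₁₂_mul_leg₃ (f : VectorFunctional A) (g : VectorFunctional B)
    (k : VectorFunctional C) (y : SpatialTensor A B) (c : C) :
    (f.prod₃ g k).eval (leg₁₂ A B C y * leg₃ A B C c) = (f.prod g).eval y * k.eval c := by
  have h : (f.prod₃ g k).toHilbertRep.op (leg₁₂ A B C y * leg₃ A B C c) =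
      conj (hilbertAssoc f.space g.space k.space)
        (opTensor ((f.prod g).toHilbertRep.op y) (k.toHilbertRep.op c)) := by
    refine (HilbertRep.op_mul _ _ _).trans ?_
    refine (congrArg₂ (· * ·) (spatialRep₃_leg₁₂ f.hom g.hom k.hom y)
      ((spatialRep₃_leg₃ f.hom g.hom k.hom c).trans (reassoc_right _).symm)).trans ?_
    refine (map_mul (conj (hilbertAssoc f.space g.space k.space)) _ _).symm.trans
      (congrArg _ ?_)
    exact opTensor_one_mul_one (H := HilbertTensor f.space g.space) (K := k.space) _ _
  rw [eval_apply, h]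
  have h1 : ∀ (x : f.space) (y : g.space) (z : k.space),
      HilbertTensor.tmul x (HilbertTensor.tmul y z) =
      hilbertAssoc f.space g.space k.space (HilbertTensor.tmul (HilbertTensor.tmul x y) z) :=
    fun x y z => (hilbertAssoc_tmul x y z).symm
  change inner ℂ (HilbertTensor.tmul f.l (HilbertTensor.tmul g.l k.l))
    ((hilbertAssoc f.space g.space k.space)
      (opTensor ((f.prod g).toHilbertRep.op y) (k.toHilbertRep.op c)
        ((hilbertAssoc f.space g.space k.space).symm
          (HilbertTensor.tmul f.r (HilbertTensor.tmul g.r k.r))))) = _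
  rw [h1, h1, LinearIsometryEquiv.symm_apply_apply]
  refine (LinearIsometryEquiv.inner_map_map _ _ _).trans ?_
  exact (congrArg (inner ℂ _) (opTensor_tmul _ _ _ _)).trans (HilbertTensor.inner_tmul _ _ _ _)

/-- Together with its counterpart for `φ ⊗ id`, this turns coassociativity into associativity of
convolution. -/
theorem prod₃_idTensor (f : VectorFunctional A) (g : VectorFunctional C) (k : VectorFunctional D)
    (φ : B →⋆ₐ[ℂ] SpatialTensor C D) (z : SpatialTensor A B) :
    (f.prod₃ g k).eval (idTensor φ z) = (f.prod ((g.prod k).comap φ)).eval z := by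
  have h : (f.prod₃ g k).eval ∘L starHomL (idTensor (A := A) φ) = (f.prod ((g.prod k).comap φ)).eval :=
    spatialTensor_clm_ext fun a b => by
      rw [ContinuousLinearMap.comp_apply, starHomL_apply, idTensor_tmul, prod_eval_tmul,
        prod₃_leg₁_mul_leg₂₃, comap_eval]
  exact DFunLike.congr_fun h z

theorem prod₃_tensorId (f : VectorFunctional C) (g : VectorFunctional D) (k : VectorFunctional B)
    (φ : A →⋆ₐ[ℂ] SpatialTensor C D) (z : SpatialTensor A B) :
    (f.prod₃ g k).eval (tensorId φ z) = (((f.prod g).comap φ).prod k).eval z := by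
  have h : (f.prod₃ g k).eval ∘L starHomL (tensorId (B := B) φ) = (((f.prod g).comap φ).prod k).eval :=
    spatialTensor_clm_ext fun a b => by
      rw [ContinuousLinearMap.comp_apply, starHomL_apply, tensorId_tmul, prod_eval_tmul,
        prod₃_leg₁₂_mul_leg₃, comap_eval]
  exact DFunLike.congr_fun h z

/-- The functional is of the form `a ↦ ⟪ξ, π a ξ⟫`. -/
def IsPositive (f : VectorFunctional A) : Prop := f.l = f.r

theorem IsPositive.eval_star_mul_self {f : VectorFunctional A} (hf : f.IsPositive) (a : A) :
    f.eval (star a * a) = (‖f.toHilbertRep.op a f.r‖ : ℂ) ^ 2 := by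
  rw [eval_apply, hf, HilbertRep.op_mul_apply, HilbertRep.inner_op_right, star_star]
  exact inner_self_eq_norm_sq_to_K (𝕜 := ℂ) (f.toHilbertRep.op a f.r)

theorem IsPositive.eval_mul_eq_zero {f : VectorFunctional A} (hf : f.IsPositive) {a : A}
    (ha : f.eval (star a * a) = 0) (b : A) : f.eval (b * a) = 0 := by
  rw [hf.eval_star_mul_self, sq_eq_zero_iff, Complex.ofReal_eq_zero, norm_eq_zero] at ha
  rw [eval_apply, HilbertRep.op_mul_apply, ha, map_zero, inner_zero_right]

theorem IsPositive.eval_star {f : VectorFunctional A} (hf : f.IsPositive) (a : A) :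
    f.eval (star a) = star (f.eval a) := by
  rw [eval_apply, eval_apply, HilbertRep.inner_op_right, star_star, hf]
  exact (inner_conj_symm _ _).symm

theorem IsPositive.prod {f : VectorFunctional A} {g : VectorFunctional B} (hf : f.IsPositive)
    (hg : g.IsPositive) : (f.prod g).IsPositive := by
  change HilbertRep.tmul f.l g.l = HilbertRep.tmul f.r g.r
  rw [hf, hg]

end VectorFunctional

/-- A state, as a vector functional. -/
theorem IsState.exists_vectorFunctional {f : A →L[ℂ] ℂ} (hf : IsState f) :
    ∃ F : VectorFunctional A, F.eval = f ∧ F.IsPositive ∧ ‖F.r‖ = 1 := by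
  obtain ⟨R, ξ, h1, h2, -⟩ := hf.exists_cyclic
  exact ⟨⟨R, ξ, ξ⟩, ContinuousLinearMap.ext fun a => (h2 a).symm, rfl, h1⟩

/-- The convolution of two vector functionals on a compact quantum group. -/
def CompactQuantumGroup.conv {Q : Type u} [CStarAlgebra Q] (G : CompactQuantumGroup Q)
    (f g : VectorFunctional Q) : VectorFunctional Q := (f.prod g).comap G.comul

theorem CompactQuantumGroup.conv_assoc {Q : Type u} [CStarAlgebra Q] (G : CompactQuantumGroup Q)
    (f g k : VectorFunctional Q) (x : Q) :
    (G.conv (G.conv f g) k).eval x = (G.conv f (G.conv g k)).eval x := by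
  refine (VectorFunctional.prod₃_tensorId f g k G.comul (G.comul x)).symm.trans ?_
  rw [G.coassoc, VectorFunctional.prod₃_idTensor]
  rfl

/-- A coproduct `Δ : Q → R` with the two embeddings of `Q` in `R`, together with product
functionals, slice maps and convolution. The laws do not distinguish a compact quantum group from
its co-opposite. -/
structure SlicedCoproduct (Q R : Type u) [CStarAlgebra Q] [CStarAlgebra R] where
  /-- `a ↦ a ⊗ 1` -/
  i₁ : Q →⋆ₐ[ℂ] R
  /-- `a ↦ 1 ⊗ a` -/
  i₂ : Q →⋆ₐ[ℂ] R
  /-- the coproduct -/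
  Δ : Q →⋆ₐ[ℂ] R
  /-- the product functional `f ⊗ g` -/
  pr : VectorFunctional Q → VectorFunctional Q → VectorFunctional R
  /-- the slice map `id ⊗ g` -/
  slice₂ : VectorFunctional Q → R →L[ℂ] Q
  /-- the slice map `f ⊗ id` -/
  slice₁ : VectorFunctional Q → R →L[ℂ] Q
  /-- convolution -/
  cv : VectorFunctional Q → VectorFunctional Q → VectorFunctional Q
  commute : ∀ a b, Commute (i₁ a) (i₂ b)
  ext : ∀ F F' : R →L[ℂ] ℂ, (∀ a b, F (i₁ a * i₂ b) = F' (i₁ a * i₂ b)) → F = F'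
  pr_mul : ∀ f g a b, (pr f g).eval (i₁ a * i₂ b) = f.eval a * g.eval b
  pr_pos : ∀ f g, f.IsPositive → g.IsPositive → (pr f g).IsPositive
  eval_slice₂ : ∀ f g z, f.eval (slice₂ g z) = (pr f g).eval z
  eval_slice₁ : ∀ f g z, g.eval (slice₁ f z) = (pr f g).eval z
  norm_slice₂_le : ∀ g z, ‖slice₂ g z‖ ≤ ‖g.l‖ * ‖g.r‖ * ‖z‖
  norm_slice₁_le : ∀ g z, ‖slice₁ g z‖ ≤ ‖g.l‖ * ‖g.r‖ * ‖z‖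
  i₁_mul_slice₂ : ∀ g a z, slice₂ g (i₁ a * z) = a * slice₂ g z
  i₂_mul_slice₁ : ∀ g a z, slice₁ g (i₂ a * z) = a * slice₁ g z
  slice₂_mul_i₁ : ∀ g a z, slice₂ g (z * i₁ a) = slice₂ g z * a
  slice₁_mul_i₂ : ∀ g a z, slice₁ g (z * i₂ a) = slice₁ g z * a
  cv_eval : ∀ f g x, (cv f g).eval x = (pr f g).eval (Δ x)
  cv_assoc : ∀ f g k x, (cv (cv f g) k).eval x = (cv f (cv g k)).eval x
  dense₁ : Dense (Submodule.span ℂ (Set.range fun p : Q × Q => i₁ p.2 * Δ p.1) : Set R)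
  dense₂ : Dense (Submodule.span ℂ (Set.range fun p : Q × Q => i₂ p.2 * Δ p.1) : Set R)

variable {Q R : Type u} [CStarAlgebra Q] [CStarAlgebra R]

/-- The co-opposite. -/
def SlicedCoproduct.flip (S : SlicedCoproduct Q R) : SlicedCoproduct Q R where
  i₁ := S.i₂
  i₂ := S.i₁
  Δ := S.Δ
  pr f g := S.pr g f
  slice₂ := S.slice₁
  slice₁ := S.slice₂
  cv f g := S.cv g f
  commute a b := (S.commute b a).symm
  ext F F' h := S.ext F F' fun a b => by rw [(S.commute a b).eq]; exact h b a
  pr_mul f g a b := by rw [← (S.commute b a).eq, S.pr_mul, mul_comm]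
  pr_pos f g hf hg := S.pr_pos g f hg hf
  eval_slice₂ f g z := S.eval_slice₁ g f z
  eval_slice₁ f g z := S.eval_slice₂ g f z
  norm_slice₂_le := S.norm_slice₁_le
  norm_slice₁_le := S.norm_slice₂_le
  i₁_mul_slice₂ := S.i₂_mul_slice₁
  i₂_mul_slice₁ := S.i₁_mul_slice₂
  slice₂_mul_i₁ := S.slice₁_mul_i₂
  slice₁_mul_i₂ := S.slice₂_mul_i₁
  cv_eval f g x := S.cv_eval g f x
  cv_assoc f g k x := (S.cv_assoc k g f x).symm
  dense₁ := S.dense₂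
  dense₂ := S.dense₁

theorem dense_span_star {X : Type*} {ι : Type*} [CStarAlgebra X] {f : ι → X}
    (h : Dense (Submodule.span ℂ (Set.range f) : Set X)) :
    Dense (Submodule.span ℂ (Set.range fun i => star (f i)) : Set X) := by
  intro x
  have h1 := map_mem_closure (continuous_star (R := X)) (h (star x))
    (t := (Submodule.span ℂ (Set.range fun i => star (f i)) : Set X)) fun y hy => by
      induction hy using Submodule.span_induction with
      | mem y hy =>
        obtain ⟨i, rfl⟩ := hy
        exact Submodule.subset_span ⟨i, rfl⟩
      | zero => rw [star_zero]; exact Submodule.zero_mem _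
      | add a b _ _ ha hb => rw [star_add]; exact Submodule.add_mem _ ha hb
      | smul c a _ ha => rw [star_smul]; exact Submodule.smul_mem _ _ ha
  rwa [star_star] at h1

/-- The coproduct of a compact quantum group. -/
def CompactQuantumGroup.sliced (G : CompactQuantumGroup Q) :
    SlicedCoproduct Q (SpatialTensor Q Q) where
  i₁ := inLeft Q Q
  i₂ := inRight Q Q
  Δ := G.comul
  pr := VectorFunctional.prod
  slice₂ := sliceRight
  slice₁ := sliceLeft
  cv := G.conv
  commute := inLeft_commute_inRight
  ext F F' h := spatialTensor_clm_ext fun a b => by rw [tmul_eq]; exact h a b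
  pr_mul := prod_eval_mul
  pr_pos f g hf hg := hf.prod hg
  eval_slice₂ := eval_sliceRight
  eval_slice₁ := eval_sliceLeft
  norm_slice₂_le := norm_sliceRight_le
  norm_slice₁_le := norm_sliceLeft_le
  i₁_mul_slice₂ := sliceRight_inLeft_mul
  i₂_mul_slice₁ := sliceLeft_inRight_mul
  slice₂_mul_i₁ := sliceRight_mul_inLeft
  slice₁_mul_i₂ := sliceLeft_mul_inRight
  cv_eval f g x := rfl
  cv_assoc := G.conv_assoc
  -- Taking adjoints in the density axiom moves the factor from the right of `Δ(Q)` to its left.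
  dense₁ := by
    refine (dense_span_star G.dense_left).mono (Submodule.span_mono ?_)
    rintro _ ⟨p, rfl⟩
    exact ⟨(star p.1, star p.2), by simp [map_star]⟩
  dense₂ := by
    refine (dense_span_star G.dense_right).mono (Submodule.span_mono ?_)
    rintro _ ⟨p, rfl⟩
    exact ⟨(star p.1, star p.2), by simp [map_star]⟩

end Convolution

/-! ### The Haar state -/

section Haar

open Filter Topology

variable {Q R : Type u} [CStarAlgebra Q] [CStarAlgebra R]

theorem isCompact_setOf_isState :
    IsCompact {f : WeakDual ℂ Q | IsState (WeakDual.toStrongDual f)} := by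
  have h : {f : WeakDual ℂ Q | IsState (WeakDual.toStrongDual f)} =
      (WeakDual.toStrongDual ⁻¹' Metric.closedBall (0 : StrongDual ℂ Q) 1) ∩
        {f : WeakDual ℂ Q | f 1 = 1} := by
    ext f
    simp [IsState]
  rw [h]
  exact (WeakDual.isCompact_closedBall 0 1).inter_right
    (isClosed_eq (WeakDual.eval_continuous 1) continuous_const)

/-- The Cesàro means of the orbit of a state under a unital contraction `P` accumulate at a state
that is invariant under `P`. -/
theorem exists_invariant_state {ω : Q →L[ℂ] ℂ} (hω : IsState ω) (P : Q →L[ℂ] Q)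
    (hP : ∀ x, ‖P x‖ ≤ ‖x‖) (hP1 : P 1 = 1) :
    ∃ h : Q →L[ℂ] ℂ, IsState h ∧ (∀ x, h (P x) = h x) ∧
      ∀ P' : Q →L[ℂ] Q, (∀ x, P (P' x) = P' (P x)) → (∀ x, ω (P x) = ω (P' x)) →
        ∀ x, h (P' x) = h x := by
  have hpow : ∀ (k : ℕ) x, ‖P^[k] x‖ ≤ ‖x‖ := fun k x => by
    induction k with
    | zero => exact le_rfl
    | succ k ih => rw [Function.iterate_succ_apply']; exact (hP _).trans ih
  have hpow1 : ∀ k : ℕ, P^[k] 1 = 1 := fun k => Function.iterate_fixed hP1 k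
  have hcoe : ∀ (k : ℕ) x, (P ^ k) x = P^[k] x := fun k x => by
    induction k with
    | zero => rfl
    | succ k ih => rw [Function.iterate_succ_apply', ← ih, pow_succ']; rfl
  let c : ℕ → Q →L[ℂ] ℂ := fun n => ((n + 1 : ℝ) : ℂ)⁻¹ • ∑ k ∈ Finset.range (n + 1), ω ∘L (P ^ k)
  have hc : ∀ n x, c n x = ((n + 1 : ℝ) : ℂ)⁻¹ * ∑ k ∈ Finset.range (n + 1), ω (P^[k] x) :=
    fun n x => by simp [c, hcoe]
  have hn : ∀ n : ℕ, ‖((n + 1 : ℝ) : ℂ)⁻¹‖ = (n + 1 : ℝ)⁻¹ := fun n => by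
    rw [norm_inv, Complex.norm_real, Real.norm_of_nonneg (by positivity)]
  have hcs : ∀ n, IsState (c n) := fun n => by
    refine ⟨ContinuousLinearMap.opNorm_le_bound _ zero_le_one fun x => ?_, ?_⟩
    · rw [hc, norm_mul, hn, one_mul]
      have h1 : ‖∑ k ∈ Finset.range (n + 1), ω (P^[k] x)‖ ≤ (n + 1 : ℝ) * ‖x‖ := by
        refine (norm_sum_le_of_le _ fun k _ => (hω.norm_apply_le _).trans (hpow k x)).trans_eq ?_
        simp
      calc _ ≤ (n + 1 : ℝ)⁻¹ * ((n + 1 : ℝ) * ‖x‖) := by gcongr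
        _ = ‖x‖ := by field_simp
    · have h2 : ((n + 1 : ℝ) : ℂ) ≠ 0 := Complex.ofReal_ne_zero.2 (by positivity)
      rw [hc]
      simp only [hpow1, hω.2, Finset.sum_const, Finset.card_range, nsmul_eq_mul, mul_one]
      push_cast at h2 ⊢
      exact inv_mul_cancel₀ h2
  -- The state space is weak-* compact but perhaps not sequentially so, hence the limit along an
  -- ultrafilter.
  obtain ⟨h, hh, hlim⟩ := isCompact_setOf_isState.ultrafilter_le_nhds
    ((hyperfilter ℕ).map fun n => StrongDual.toWeakDual (c n)) (by
      rw [Ultrafilter.coe_map, le_principal_iff]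
      exact Filter.mem_map.2 (Filter.univ_mem' hcs))
  have hev : ∀ x, Tendsto (fun n => c n x) (hyperfilter ℕ) (𝓝 (h x)) := fun x =>
    ((WeakDual.eval_continuous x).tendsto h).comp hlim
  -- The difference telescopes to two boundary terms divided by `n + 1`.
  have key : ∀ x, Tendsto (fun n => c n (P x) - c n x) (hyperfilter ℕ) (𝓝 0) := fun x => by
    have h3 : Tendsto (fun n : ℕ => (n + 1 : ℝ)⁻¹ * (2 * ‖x‖)) atTop (𝓝 0) := by
      have := (tendsto_one_div_add_atTop_nhds_zero_nat (𝕜 := ℝ)).mul_const (2 * ‖x‖)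
      simpa using this
    refine squeeze_zero_norm (fun n => ?_) (h3.mono_left Nat.hyperfilter_le_atTop)
    have h4 : c n (P x) - c n x = ((n + 1 : ℝ) : ℂ)⁻¹ * (ω (P^[n + 1] x) - ω x) := by
      rw [hc, hc, ← mul_sub, ← Finset.sum_sub_distrib]
      congr 1
      have := Finset.sum_range_sub (fun k => ω (P^[k] x)) (n + 1)
      simpa [Function.iterate_succ_apply] using this
    rw [h4, norm_mul, hn]
    gcongr
    refine (norm_sub_le _ _).trans ?_
    have h5 := (hω.norm_apply_le _).trans (hpow (n + 1) x)
    have h6 := hω.norm_apply_le x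
    linarith
  have hPx : ∀ x, h (P x) = h x := fun x => by
    have := tendsto_nhds_unique ((hev (P x)).sub (hev x)) (key x)
    exact sub_eq_zero.1 this
  refine ⟨WeakDual.toStrongDual h, hh, hPx, fun P' hcomm hωP' x => ?_⟩
  have hcomm' : ∀ (k : ℕ) x, P^[k] (P' x) = P' (P^[k] x) := fun k x =>
    (Function.Semiconj.iterate_right (f := P') (fun x => (hcomm x).symm) k x).symm
  -- Termwise, `ω(PᵏP'x) = ω(P'Pᵏx) = ω(PPᵏx)`.
  have h7 : ∀ n, c n (P' x) = c n (P x) := fun n => by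
    rw [hc, hc]
    refine congrArg _ (Finset.sum_congr rfl fun k _ => ?_)
    rw [hcomm', ← hωP', ← Function.iterate_succ_apply' P, Function.iterate_succ_apply]
  have h8 := hev (P' x)
  simp only [h7] at h8
  exact (tendsto_nhds_unique h8 (hev (P x))).trans (hPx x)

namespace SlicedCoproduct

variable (S : SlicedCoproduct Q R)

/-- The product depends only on the functionals, not on the representations and vectors chosen to
realise them. -/
theorem pr_congr {f f' g g' : VectorFunctional Q} (hf : f.eval = f'.eval) (hg : g.eval = g'.eval) :
    (S.pr f g).eval = (S.pr f' g').eval :=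
  S.ext _ _ fun a b => by rw [S.pr_mul, S.pr_mul, hf, hg]

theorem slice₂_congr {g g' : VectorFunctional Q} (hg : g.eval = g'.eval) :
    S.slice₂ g = S.slice₂ g' := by
  ext z
  refine eq_of_vectorFunctional fun f => ?_
  rw [S.eval_slice₂, S.eval_slice₂, S.pr_congr rfl hg]

theorem slice₂_Δ_slice₂_Δ (ω h : VectorFunctional Q) (a : Q) :
    S.slice₂ ω (S.Δ (S.slice₂ h (S.Δ a))) = S.slice₂ (S.cv ω h) (S.Δ a) := by
  refine eq_of_vectorFunctional fun f => ?_
  rw [S.eval_slice₂, ← S.cv_eval, S.eval_slice₂, ← S.cv_eval, S.cv_assoc, S.eval_slice₂,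
    ← S.cv_eval]

theorem slice₂_i₂ (g : VectorFunctional Q) (b : Q) : S.slice₂ g (S.i₂ b) = g.eval b • (1 : Q) := by
  refine eq_of_vectorFunctional fun f => ?_
  have := S.pr_mul f g 1 b
  rw [map_one, one_mul] at this
  rw [S.eval_slice₂, this, map_smul, smul_eq_mul, mul_comm]

theorem slice₂_one (g : VectorFunctional Q) : S.slice₂ g 1 = g.eval 1 • (1 : Q) := by
  rw [← map_one S.i₂, S.slice₂_i₂]

theorem pr_i₁ (f g : VectorFunctional Q) (a : Q) :
    (S.pr f g).eval (S.i₁ a) = f.eval a * g.eval 1 := by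
  have := S.pr_mul f g a 1
  rwa [map_one, mul_one] at this

theorem pr_i₂ (f g : VectorFunctional Q) (a : Q) :
    (S.pr f g).eval (S.i₂ a) = f.eval 1 * g.eval a := by
  have := S.pr_mul f g 1 a
  rwa [map_one, one_mul] at this

theorem clm_eq_of_dense {X : Type*} [NormedAddCommGroup X] [NormedSpace ℂ X] {ι : Type*} {v : ι → X}
    (hv : Dense (Submodule.span ℂ (Set.range v) : Set X)) {Y : Type*} [NormedAddCommGroup Y]
    [NormedSpace ℂ Y] {F F' : X →L[ℂ] Y} (h : ∀ i, F (v i) = F' (v i)) : F = F' :=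
  ContinuousLinearMap.ext_on hv (by rintro _ ⟨i, rfl⟩; exact h i)

/-- If `h` is a state invariant under convolution with the state `ω`, then `ρ * h = ρ(1) h` for each
positive functional `ρ` dominated by `ω`. -/
theorem cv_eq_of_dominated {h ω ρ : VectorFunctional Q} (hh : h.IsPositive) (hω : ω.IsPositive)
    (hρ : ρ.IsPositive) (hh1 : h.eval 1 = 1) (hω1 : ω.eval 1 = 1)
    (h₁ : (S.cv ω h).eval = h.eval) (h₂ : (S.cv h ω).eval = h.eval)
    (hdom : ∀ z, (S.pr h ω).eval (star z * z) = 0 → (S.pr h ρ).eval (star z * z) = 0) (x : Q) :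
    (S.cv ρ h).eval x = ρ.eval 1 * h.eval x := by
  have main : ∀ a c : Q, (S.pr h (S.cv ρ h)).eval (S.i₁ c * S.Δ a) =
      (ρ.eval 1 • (S.pr h h).eval) (S.i₁ c * S.Δ a) := fun a c => by
    -- This `b` measures the failure of `h` to be invariant at `a`. It is fixed by `(id ⊗ ω)Δ`.
    set b := S.slice₂ h (S.Δ a) - h.eval a • (1 : Q) with hb
    have hωb : S.slice₂ ω (S.Δ b) = b := by
      rw [hb, map_sub, map_sub, map_smul, map_smul, map_one, S.slice₂_one, hω1, one_smul,
        S.slice₂_Δ_slice₂_Δ, S.slice₂_congr h₁]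
    have hρb : S.slice₂ ρ (S.Δ b) =
        S.slice₂ (S.cv ρ h) (S.Δ a) - h.eval a • ρ.eval 1 • (1 : Q) := by
      rw [hb, map_sub, map_sub, map_smul, map_smul, map_one, S.slice₂_one, S.slice₂_Δ_slice₂_Δ]
    have hP := S.pr_pos h ω hh hω
    have e1 : (S.pr h ω).eval (S.i₁ (star b) * S.Δ b) = h.eval (star b * b) := by
      rw [← S.eval_slice₂, S.i₁_mul_slice₂, hωb]
    have e2 : (S.pr h ω).eval (S.Δ (star b) * S.i₁ b) = h.eval (star b * b) := by
      have : S.Δ (star b) * S.i₁ b = star (S.i₁ (star b) * S.Δ b) := by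
        rw [star_mul, map_star, map_star, star_star]
      rw [this, hP.eval_star, e1, ← hh.eval_star, star_mul, star_star]
    have e3 : (S.pr h ω).eval (S.Δ (star b * b)) = h.eval (star b * b) := by
      rw [← S.cv_eval, h₂]
    -- Each of the four terms of the expansion equals `± h(b*b)`, and they cancel.
    have e4 : (S.pr h ω).eval (star (S.Δ b - S.i₁ b) * (S.Δ b - S.i₁ b)) = 0 := by
      have : star (S.Δ b - S.i₁ b) * (S.Δ b - S.i₁ b) = S.Δ (star b * b) - S.Δ (star b) * S.i₁ b -
          S.i₁ (star b) * S.Δ b + S.i₁ (star b * b) := by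
        simp only [map_mul, map_star, star_sub]
        noncomm_ring
      rw [this, map_add, map_sub, map_sub, e1, e2, e3, S.pr_i₁, hω1]
      ring
    -- Domination makes `Δ(b) - b ⊗ 1` null for `h ⊗ ρ`, so it stays null after left multiplication
    -- by `c ⊗ 1`. Expanding gives the identity on `(Q ⊗ 1)Δ(Q)`.
    have e5 := (S.pr_pos h ρ hh hρ).eval_mul_eq_zero (hdom _ e4) (S.i₁ c)
    rw [mul_sub, map_sub, ← map_mul, S.pr_i₁, ← S.eval_slice₂, S.i₁_mul_slice₂, hρb, hb, mul_sub,
      mul_sub, map_sub, map_sub, ← S.i₁_mul_slice₂, ← S.i₁_mul_slice₂, S.eval_slice₂,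
      S.eval_slice₂, mul_smul_comm, mul_smul_comm, mul_smul_comm, map_smul, map_smul, map_smul,
      smul_eq_mul, smul_eq_mul, smul_eq_mul, mul_one] at e5
    rw [smul_apply, smul_eq_mul]
    linear_combination e5
  have h3 : (S.pr h (S.cv ρ h)).eval = ρ.eval 1 • (S.pr h h).eval :=
    clm_eq_of_dense S.dense₁ fun p => main p.1 p.2
  -- By density the identity holds on the whole tensor product, in particular at `1 ⊗ x`.
  have h4 := DFunLike.congr_fun h3 (S.i₂ x)
  rwa [smul_apply, S.pr_i₂, S.pr_i₂, hh1, one_mul, one_mul, smul_eq_mul] at h4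

end SlicedCoproduct

theorem VectorFunctional.IsPositive.isState {f : VectorFunctional Q} (hf : f.IsPositive)
    (h1 : ‖f.r‖ = 1) : IsState f.eval := by
  refine ⟨ContinuousLinearMap.opNorm_le_bound _ zero_le_one fun x => ?_, ?_⟩
  · have := f.norm_eval_le x
    rwa [hf, h1, one_mul] at this
  · rw [VectorFunctional.eval_apply, HilbertRep.op_one, hf, one_apply_eq_self,
      inner_self_eq_norm_sq_to_K, h1]
    simp

/-- The states separate the points of a C⋆-algebra. -/
theorem eq_of_state {a b : Q} (h : ∀ f : Q →L[ℂ] ℂ, IsState f → f a = f b) : a = b := by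
  refine eq_of_vectorFunctional fun F => ?_
  suffices hop : F.toHilbertRep.op a = F.toHilbertRep.op b by
    rw [VectorFunctional.eval_apply, VectorFunctional.eval_apply, hop]
  rw [← sub_eq_zero, ← HilbertRep.op_sub]
  -- Over `ℂ` an operator vanishes once its quadratic form does, and unit vectors give states.
  refine ContinuousLinearMap.coe_injective ((inner_map_self_eq_zero _).1 fun x => ?_)
  rw [← inner_conj_symm]
  suffices h1 : inner ℂ x (F.toHilbertRep.op (a - b) x) = 0 by
    exact (congrArg _ h1).trans (map_zero _)
  by_cases hx : x = 0
  · rw [hx, inner_zero_left]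
  set y : F.space := ((‖x‖ : ℂ)⁻¹) • x with hy
  have hy1 : ‖y‖ = 1 := norm_smul_inv_norm hx
  have hxy : x = (‖x‖ : ℂ) • y := by
    rw [hy, smul_smul, mul_inv_cancel₀ (Complex.ofReal_ne_zero.2 (norm_ne_zero_iff.2 hx)), one_smul]
  have h2 : inner ℂ y (F.toHilbertRep.op (a - b) y) = 0 := by
    have h3 := h (VectorFunctional.mk F.toHilbertRep y y).eval
      (VectorFunctional.IsPositive.isState rfl hy1)
    rw [← sub_eq_zero, ← map_sub] at h3
    exact h3
  rw [hxy, map_smul, inner_smul_left, inner_smul_right, h2, mul_zero, mul_zero]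

namespace SlicedCoproduct

variable (S : SlicedCoproduct Q R)

/-- A Haar functional: a state which is invariant under convolution with positive functionals. -/
structure IsHaar (h : VectorFunctional Q) : Prop where
  pos : h.IsPositive
  one : h.eval 1 = 1
  slice₁ : ∀ x, S.slice₁ h (S.Δ x) = h.eval x • (1 : Q)
  slice₂ : ∀ x, S.slice₂ h (S.Δ x) = h.eval x • (1 : Q)

theorem norm_slice₂_Δ_le {ω : VectorFunctional Q} (hω : ω.IsPositive) (hω1 : ‖ω.r‖ = 1) (x : Q) :
    ‖S.slice₂ ω (S.Δ x)‖ ≤ ‖x‖ := by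
  refine (S.norm_slice₂_le ω _).trans ?_
  rw [hω, hω1, one_mul, one_mul]
  exact NonUnitalStarAlgHom.norm_apply_le S.Δ x

/-- For each state `ω` there is a state which is invariant under convolution with `ω`. -/
theorem exists_cv_invariant {ω : VectorFunctional Q} (hω : ω.IsPositive) (hω1 : ‖ω.r‖ = 1) :
    ∃ h : Q →L[ℂ] ℂ, IsState h ∧ (∀ x, h (S.slice₂ ω (S.Δ x)) = h x) ∧
      ∀ x, h (S.slice₁ ω (S.Δ x)) = h x := by
  have hs := hω.isState hω1
  obtain ⟨h, h1, h2, h3⟩ := exists_invariant_state hs (S.slice₂ ω ∘L starHomL S.Δ)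
    (fun x => S.norm_slice₂_Δ_le hω hω1 x) (by
      rw [ContinuousLinearMap.comp_apply, starHomL_apply, map_one, S.slice₂_one, hs.2, one_smul])
  -- Left and right convolution by `ω` commute by coassociativity, and both turn `ω` into `ω * ω`,
  -- so one limit of Cesàro means is invariant on both sides.
  refine ⟨h, h1, h2, h3 (S.slice₁ ω ∘L starHomL S.Δ) (fun x => ?_) fun x => ?_⟩
  · change S.slice₂ ω (S.Δ (S.slice₁ ω (S.Δ x))) = S.slice₁ ω (S.Δ (S.slice₂ ω (S.Δ x)))
    refine eq_of_vectorFunctional fun f => ?_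
    rw [S.eval_slice₂, ← S.cv_eval, S.eval_slice₁, ← S.cv_eval, S.eval_slice₁, ← S.cv_eval,
      S.eval_slice₂, ← S.cv_eval, S.cv_assoc]
  · change ω.eval (S.slice₂ ω (S.Δ x)) = ω.eval (S.slice₁ ω (S.Δ x))
    rw [S.eval_slice₂, S.eval_slice₁]

theorem isClosed_setOf_invariant (P : Q → Q) :
    IsClosed {h : WeakDual ℂ Q | ∀ x, h (P x) = h x} := by
  simp only [Set.ofPred_forall]
  exact isClosed_iInter fun x => isClosed_eq (WeakDual.eval_continuous _) (WeakDual.eval_continuous _)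

/-- Since `h ⊗ ω` is a positive multiple of the sum of the positive functionals `h ⊗ ρᵢ`, an element
null for `h ⊗ ω` is null for each of them, so `ρᵢ` is dominated by `ω` in the sense of
`cv_eq_of_dominated`. -/
theorem cv_invariant_of_average {h : Q →L[ℂ] ℂ} {ω : VectorFunctional Q} {ι : Type*}
    (hh : IsState h) (s : Finset ι) (ρ : ι → VectorFunctional Q) (hρ : ∀ i, (ρ i).IsPositive)
    (hρ1 : ∀ i, (ρ i).eval 1 = 1) (hω : ω.IsPositive) (hω1 : ω.eval 1 = 1) (c : ℝ) (hc : 0 < c)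
    (hav : ω.eval = (c : ℂ) • ∑ i ∈ s, (ρ i).eval)
    (h₁ : ∀ x, h (S.slice₂ ω (S.Δ x)) = h x) (h₂ : ∀ x, h (S.slice₁ ω (S.Δ x)) = h x)
    {i : ι} (hi : i ∈ s) (x : Q) : h (S.slice₁ (ρ i) (S.Δ x)) = h x := by
  obtain ⟨H, rfl, hH, hH1⟩ := hh.exists_vectorFunctional
  rw [S.eval_slice₁, ← S.cv_eval, S.cv_eq_of_dominated (ω := ω) hH hω (hρ i) hh.2 hω1, hρ1, one_mul]
  · ext x
    rw [S.cv_eval, ← S.eval_slice₁, h₂]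
  · ext x
    rw [S.cv_eval, ← S.eval_slice₂, h₁]
  · intro z hz
    have h3 : (S.pr H ω).eval = (c : ℂ) • ∑ i ∈ s, (S.pr H (ρ i)).eval :=
      S.ext _ _ fun a b => by
        simp only [S.pr_mul, hav, smul_apply, sum_apply, smul_eq_mul, Finset.mul_sum]
        exact Finset.sum_congr rfl fun i _ => by ring
    rw [h3, smul_apply, sum_apply, smul_eq_mul, mul_eq_zero,
      or_iff_right (Complex.ofReal_ne_zero.2 hc.ne')] at hz
    have h4 : ∀ i, (S.pr H (ρ i)).eval (star z * z) =
        ((‖(S.pr H (ρ i)).toHilbertRep.op z (S.pr H (ρ i)).r‖ ^ 2 : ℝ) : ℂ) := fun i => by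
      rw [(S.pr_pos H (ρ i) hH (hρ i)).eval_star_mul_self, Complex.ofReal_pow]
    simp only [h4] at hz ⊢
    rw [← Complex.ofReal_sum, Complex.ofReal_eq_zero,
      Finset.sum_eq_zero_iff_of_nonneg fun _ _ => sq_nonneg _] at hz
    rw [hz i hi, Complex.ofReal_zero]

/-- Existence of the Haar state. -/
theorem exists_isHaar [Nontrivial Q] :
    ∃ h : Q →L[ℂ] ℂ, IsState h ∧ ∀ H : VectorFunctional Q, H.IsPositive → H.eval = h →
      S.IsHaar H := by
  have hvf : ∀ ρ : {f : Q →L[ℂ] ℂ // IsState f}, ∃ F : VectorFunctional Q,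
      F.eval = ρ ∧ F.IsPositive ∧ ‖F.r‖ = 1 := fun ρ => ρ.2.exists_vectorFunctional
  choose F hF hFp hF1 using hvf
  -- The functionals invariant under `ρ` on both sides form a closed set, so compactness of the
  -- state space leaves only finitely many `ρ` to treat at a time.
  let K : {f : Q →L[ℂ] ℂ // IsState f} → Set (WeakDual ℂ Q) := fun ρ =>
    {h | ∀ x, h (S.slice₂ (F ρ) (S.Δ x)) = h x} ∩ {h | ∀ x, h (S.slice₁ (F ρ) (S.Δ x)) = h x}
  obtain ⟨σ, hσ, -⟩ := exists_state_apply_star_mul_self (1 : Q)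
  have hne := isCompact_setOf_isState.inter_iInter_nonempty K
    (fun ρ => (isClosed_setOf_invariant _).inter (isClosed_setOf_invariant _)) fun s => by
      classical
      -- The extra state `σ` guarantees that the average is over a nonempty set.
      let s' := insert ⟨σ, hσ⟩ s
      have hcard : (0 : ℝ) < s'.card := Nat.cast_pos.2 (Finset.card_pos.2 ⟨_, Finset.mem_insert_self _ _⟩)
      let c : ℝ := (s'.card : ℝ)⁻¹
      have hc : 0 < c := inv_pos.2 hcard
      have hs : IsState ((c : ℂ) • ∑ ρ ∈ s', ρ.1) := by
        have hcs : c * s'.card = 1 := inv_mul_cancel₀ hcard.ne'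
        refine ⟨?_, ?_⟩
        · rw [norm_smul, Complex.norm_real, Real.norm_of_nonneg hc.le, ← hcs]
          refine mul_le_mul_of_nonneg_left ?_ hc.le
          refine (norm_sum_le_of_le _ fun ρ _ => ρ.2.1).trans_eq ?_
          simp
        · rw [smul_apply, sum_apply, Finset.sum_congr rfl fun ρ _ => ρ.2.2]
          simp only [Finset.sum_const, nsmul_eq_mul, mul_one, smul_eq_mul]
          exact_mod_cast hcs
      obtain ⟨ω, hω, hωp, hω1⟩ := hs.exists_vectorFunctional
      obtain ⟨h, h1, h2, h3⟩ := S.exists_cv_invariant hωp hω1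
      have hav : ω.eval = (c : ℂ) • ∑ ρ ∈ s', (F ρ).eval := by rw [hω]; simp only [hF]
      have hω1' : ω.eval 1 = 1 := by rw [hω]; exact hs.2
      have hF1' : ∀ ρ, (F ρ).eval 1 = 1 := fun ρ => by rw [hF]; exact ρ.2.2
      refine ⟨StrongDual.toWeakDual h, h1, Set.mem_iInter₂.2 fun ρ hρ => ⟨fun x => ?_, fun x => ?_⟩⟩
      · exact S.flip.cv_invariant_of_average (ω := ω) h1 s' F hFp hF1' hωp hω1' c hc hav h3 h2
          (Finset.mem_insert_of_mem hρ) x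
      · exact S.cv_invariant_of_average (ω := ω) h1 s' F hFp hF1' hωp hω1' c hc hav h2 h3
          (Finset.mem_insert_of_mem hρ) x
  obtain ⟨h, hst, hK⟩ := hne
  refine ⟨WeakDual.toStrongDual h, hst, fun H hH hHh => ?_⟩
  have hone : H.eval 1 = 1 := by rw [hHh]; exact hst.2
  rw [Set.mem_iInter] at hK
  refine ⟨hH, hone, fun x => eq_of_state fun f hf => ?_, fun x => eq_of_state fun f hf => ?_⟩
  · have h1 : H.eval (S.slice₂ (F ⟨f, hf⟩) (S.Δ x)) = H.eval x := by
      rw [hHh]; exact (hK ⟨f, hf⟩).1 x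
    have h2 : (F ⟨f, hf⟩).eval = f := hF ⟨f, hf⟩
    rw [map_smul, hf.2, smul_eq_mul, mul_one, ← h1, S.eval_slice₂, ← S.eval_slice₁, h2]
  · have h1 : H.eval (S.slice₁ (F ⟨f, hf⟩) (S.Δ x)) = H.eval x := by
      rw [hHh]; exact (hK ⟨f, hf⟩).2 x
    have h2 : (F ⟨f, hf⟩).eval = f := hF ⟨f, hf⟩
    rw [map_smul, hf.2, smul_eq_mul, mul_one, ← h1, S.eval_slice₁, ← S.eval_slice₂, h2]

/-- A Haar functional for a coproduct is one for the co-opposite. -/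
theorem IsHaar.flip {S : SlicedCoproduct Q R} {h : VectorFunctional Q} (hh : S.IsHaar h) :
    S.flip.IsHaar h := ⟨hh.pos, hh.one, hh.slice₂, hh.slice₁⟩

end SlicedCoproduct

end Haar

/-! ### Contragredients of projective corepresentations -/

namespace SlicedCoproduct

variable {Q R : Type u} [CStarAlgebra Q] [CStarAlgebra R] {S : SlicedCoproduct Q R}
  {h : VectorFunctional Q} {n : Type*} [Fintype n] [DecidableEq n]

theorem IsHaar.pr_i₁_mul_Δ (hh : S.IsHaar h) (x y : Q) :
    (S.pr h h).eval (S.i₁ y * S.Δ x) = h.eval y * h.eval x := by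
  rw [← S.eval_slice₂, S.i₁_mul_slice₂, hh.slice₂, mul_smul_comm, mul_one, map_smul, smul_eq_mul,
    mul_comm]

theorem IsHaar.pr_Δ_mul_i₁ (hh : S.IsHaar h) (x y : Q) :
    (S.pr h h).eval (S.Δ x * S.i₁ y) = h.eval x * h.eval y := by
  rw [← S.eval_slice₂, S.slice₂_mul_i₁, hh.slice₂, smul_mul_assoc, one_mul, map_smul, smul_eq_mul]

variable (S) in
/-- `U` is a unitary with `Δ(U) Ω = U₁₂ U₁₃`, where the unitary `Ω` commutes with the range of
`Δ`. -/
structure IsTwisted (U : Matrix n n Q) (Ω : R) : Prop where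
  mem_unitary : U ∈ unitary (Matrix n n Q)
  mem_unitary' : Ω ∈ unitary R
  comm : ∀ x, Ω * S.Δ x = S.Δ x * Ω
  Δ_mul : ∀ i j, S.Δ (U i j) * Ω = ∑ k, S.i₁ (U i k) * S.i₂ (U k j)

theorem sum_star_mul_of_mem_unitary {X : Type*} [Ring X] [StarRing X] {U : Matrix n n X}
    (hU : U ∈ unitary (Matrix n n X)) (i j : n) :
    ∑ k, star (U k i) * U k j = if i = j then 1 else 0 := by
  have h : star U * U = 1 := (Unitary.mem_iff.1 hU).1
  have := congrFun (congrFun h i) j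
  rwa [Matrix.mul_apply, Matrix.one_apply] at this

theorem sum_mul_star_of_mem_unitary {X : Type*} [Ring X] [StarRing X] {U : Matrix n n X}
    (hU : U ∈ unitary (Matrix n n X)) (i j : n) :
    ∑ k, U i k * star (U j k) = if i = j then 1 else 0 := by
  have h : U * star U = 1 := (Unitary.mem_iff.1 hU).2
  have := congrFun (congrFun h i) j
  rwa [Matrix.mul_apply, Matrix.one_apply] at this

variable {U : Matrix n n Q} {Ω : R}

/-- Taking adjoints reverses the two legs, which is exactly the passage to the co-opposite. Results
for `U` thereby transfer to `U*`. -/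
theorem IsTwisted.flip (hU : S.IsTwisted U Ω) : S.flip.IsTwisted (star U) (star Ω) where
  mem_unitary := Unitary.star_mem hU.mem_unitary
  mem_unitary' := Unitary.star_mem hU.mem_unitary'
  comm x := by
    have := congrArg star (hU.comm (star x))
    rw [star_mul, star_mul, map_star, star_star] at this
    exact this.symm
  Δ_mul i j := by
    have h1 := congrArg star (hU.Δ_mul j i)
    have h2 := congrArg star (hU.comm (U j i))
    rw [star_mul, star_mul] at h2
    rw [star_mul, star_sum] at h1
    change S.Δ (star (U j i)) * star Ω = ∑ k, S.i₂ (star (U k i)) * S.i₁ (star (U j k))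
    rw [map_star, h2, h1]
    refine Finset.sum_congr rfl fun k _ => ?_
    rw [star_mul, map_star, map_star]

/-- This is `U₁₃Ω* = U₁₂*Δ(U)`, the defining relation solved for the second leg. -/
theorem IsTwisted.i₂_mul_star (hU : S.IsTwisted U Ω) (i j : n) :
    S.i₂ (U i j) * star Ω = ∑ k, S.i₁ (star (U k i)) * S.Δ (U k j) := by
  have h1 : S.i₂ (U i j) = (∑ k, S.i₁ (star (U k i)) * S.Δ (U k j)) * Ω := by
    simp_rw [Finset.sum_mul, mul_assoc, hU.Δ_mul, Finset.mul_sum, ← mul_assoc, ← map_mul]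
    rw [Finset.sum_comm]
    simp_rw [← Finset.sum_mul, ← map_sum, sum_star_mul_of_mem_unitary hU.mem_unitary]
    rw [Finset.sum_eq_single i (fun b _ hb => by rw [if_neg hb.symm, map_zero, zero_mul])
      (fun hb => absurd (Finset.mem_univ i) hb), if_pos rfl, map_one, one_mul]
  rw [h1, mul_assoc, Unitary.mul_star_self_of_mem hU.mem_unitary', mul_one]

theorem IsTwisted.mul_i₂_star (hU : S.IsTwisted U Ω) (i j : n) :
    Ω * S.i₂ (star (U i j)) = ∑ k, S.Δ (star (U k j)) * S.i₁ (U k i) := by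
  have := congrArg star (hU.i₂_mul_star i j)
  simpa only [star_mul, star_star, star_sum, ← map_star] using this

/-- A form of strong invariance: by the formulas for the second leg and invariance of `h`, both
sides equal `∑ₖ h(y Uₖᵢ*) h(Uₖⱼ x)`. It exchanges `U i j` for the adjoint of `U j i`. -/
theorem IsTwisted.pr_eq (hh : S.IsHaar h) (hU : S.IsTwisted U Ω) (x y : Q) (i j : n) :
    (S.pr h h).eval (S.i₁ y * (S.i₂ (U i j) * star Ω) * S.Δ x) =
      (S.pr h h).eval (S.Δ y * (Ω * S.i₂ (star (U j i))) * S.i₁ x) := by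
  rw [hU.i₂_mul_star, hU.mul_i₂_star]
  simp_rw [Finset.mul_sum, Finset.sum_mul, map_sum]
  refine Finset.sum_congr rfl fun k _ => ?_
  have e1 : S.i₁ y * (S.i₁ (star (U k i)) * S.Δ (U k j)) * S.Δ x =
      S.i₁ (y * star (U k i)) * S.Δ (U k j * x) := by simp only [map_mul, mul_assoc]
  have e2 : S.Δ y * (S.Δ (star (U k i)) * S.i₁ (U k j)) * S.i₁ x =
      S.Δ (y * star (U k i)) * S.i₁ (U k j * x) := by simp only [map_mul, mul_assoc]
  rw [e1, e2, hh.pr_i₁_mul_Δ, hh.pr_Δ_mul_i₁]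

/-- If all coefficients of `U v` are null for the Haar functional, then `v = 0`. -/
theorem IsTwisted.eq_zero_of_null (hh : S.IsHaar h) (hU : S.IsTwisted U Ω) (v : n → ℂ)
    (hv : ∀ j x, h.eval ((∑ i, v i • U j i) * x) = 0) : v = 0 := by
  -- `pr_eq` trades `bⱼ` for the adjoint of the null element `∑ᵢ vᵢ Uⱼᵢ`, so nullity in the rows of
  -- `U` becomes nullity in its columns.
  let b : n → Q := fun j => ∑ i, star (v i) • U i j
  have h0 : ∀ (j : n) (z : R), (S.pr h h).eval (z * star (S.i₂ (∑ i, v i • U j i))) = 0 := fun j => by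
    set w := ∑ i, v i • U j i with hw
    have : (S.pr h h).eval ∘L (ContinuousLinearMap.mul ℂ R).flip (star (S.i₂ w)) = 0 :=
      S.ext _ _ fun a c => by
        have e : S.i₁ a * S.i₂ c * star (S.i₂ w) = S.i₁ a * S.i₂ (c * star w) := by
          rw [map_mul, map_star, mul_assoc]
        have e2 : h.eval (c * star w) = 0 := by
          have := hh.pos.eval_star (w * star c)
          rwa [hv, star_zero, star_mul, star_star] at this
        change (S.pr h h).eval (S.i₁ a * S.i₂ c * star (S.i₂ w)) = 0
        rw [e, S.pr_mul, e2, mul_zero]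
    exact DFunLike.congr_fun this
  have h1 : ∀ (j : n) (x y : Q),
      (S.pr h h).eval (S.i₂ (b j) * (S.i₁ y * S.Δ x) * star Ω) = 0 := fun j x y => by
    have hc : star Ω * S.Δ x = S.Δ x * star Ω := (hU.flip.comm x)
    have e1 : S.i₂ (b j) * (S.i₁ y * S.Δ x) * star Ω =
        ∑ i, star (v i) • (S.i₁ y * (S.i₂ (U i j) * star Ω) * S.Δ x) := by
      rw [mul_assoc, mul_assoc, ← hc, ← mul_assoc, ← (S.commute y (b j)).eq, map_sum]
      simp only [map_smul, Finset.mul_sum, Finset.sum_mul, mul_smul_comm, smul_mul_assoc, mul_assoc]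
    have e2 : ∑ i, star (v i) • (S.Δ y * (Ω * S.i₂ (star (U j i))) * S.i₁ x) =
        (S.Δ y * Ω * S.i₁ x) * star (S.i₂ (∑ i, v i • U j i)) := by
      simp only [← map_star, star_sum, star_smul, map_sum, map_smul, Finset.mul_sum,
        mul_smul_comm]
      refine Finset.sum_congr rfl fun i _ => ?_
      rw [mul_assoc _ (S.i₁ x), (S.commute x _).eq]
      simp only [mul_assoc]
    rw [e1, map_sum]
    simp_rw [map_smul, hU.pr_eq hh]
    simp_rw [← map_smul]
    rw [← map_sum, e2, h0]
  -- By density `(y ⊗ 1)Δ(x)` may be replaced by `(1 ⊗ bⱼ*)Ω`, and then `Ω` cancels `Ω*`.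
  have h2 : ∀ j, h.eval (b j * star (b j)) = 0 := fun j => by
    have e1 : ((S.pr h h).eval ∘L (ContinuousLinearMap.mul ℂ R).flip (star Ω)) ∘L
        ContinuousLinearMap.mul ℂ R (S.i₂ (b j)) = 0 := clm_eq_of_dense S.dense₁ fun p =>
      h1 j p.1 p.2
    have e2 := DFunLike.congr_fun e1 (S.i₂ (star (b j)) * Ω)
    change (S.pr h h).eval (S.i₂ (b j) * (S.i₂ (star (b j)) * Ω) * star Ω) = 0 at e2
    rwa [mul_assoc, mul_assoc, Unitary.mul_star_self_of_mem hU.mem_unitary', mul_one, ← map_mul,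
      S.pr_i₂, hh.one, one_mul] at e2
  -- Unitarity of `U` turns the vanishing of all `h(bⱼbⱼ*)` into `‖v‖² = 0`.
  have h3 : ∑ j, b j * star (b j) = (∑ i, star (v i) * v i) • (1 : Q) := by
    have e1 : ∀ j, b j * star (b j) = ∑ i, ∑ k, (star (v i) * v k) • (U i j * star (U k j)) :=
      fun j => by
        simp only [b, star_sum, star_smul, star_star, Finset.sum_mul_sum, smul_mul_smul_comm]
    simp_rw [e1]
    rw [Finset.sum_comm, Finset.sum_smul]
    refine Finset.sum_congr rfl fun i _ => ?_
    rw [Finset.sum_comm]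
    simp_rw [← Finset.smul_sum, sum_mul_star_of_mem_unitary hU.mem_unitary]
    simp
  have h4 := congrArg h.eval h3
  rw [map_sum, Finset.sum_eq_zero fun j _ => h2 j, map_smul, hh.one, smul_eq_mul, mul_one] at h4
  have h5 : ∑ i, ‖v i‖ ^ 2 = 0 := by
    have e : ∀ i, star (v i) * v i = ((‖v i‖ ^ 2 : ℝ) : ℂ) := fun i => by
      rw [Complex.ofReal_pow]; exact Complex.conj_mul' _
    simp_rw [e] at h4
    rw [← Complex.ofReal_sum] at h4
    exact Complex.ofReal_eq_zero.1 h4.symm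
  funext i
  have := (Finset.sum_eq_zero_iff_of_nonneg fun i _ => sq_nonneg ‖v i‖).1 h5 i (Finset.mem_univ i)
  simpa using this

/-- The matrix `(id ⊗ h)(Uᵀ Uᶜ)`. -/
def gram (h : VectorFunctional Q) (U : Matrix n n Q) : Matrix n n ℂ :=
  fun i j => ∑ k, h.eval (U k i * star (U k j))

/-- In `Δ(Uₖᵢ Uₖⱼ*)` the twist appears as `ΩΩ* = 1`, so `UᵀŪ` transforms as for a genuine
corepresentation. Slicing by `h ⊗ id` gives the relation. -/
theorem IsTwisted.gram_intertwines (hh : S.IsHaar h) (hU : S.IsTwisted U Ω) :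
    U.transpose * (gram h U).map (algebraMap ℂ Q) * U.map star =
      (gram h U).map (algebraMap ℂ Q) := by
  ext i j
  have e1 : ∀ k, S.Δ (U k i * star (U k j)) =
      ∑ l, ∑ m, S.i₁ (U k l * star (U k m)) * S.i₂ (U l i * star (U m j)) := fun k => by
    have : S.Δ (U k i * star (U k j)) = (S.Δ (U k i) * Ω) * star (S.Δ (U k j) * Ω) := by
      rw [star_mul, map_mul, map_star, mul_assoc, ← mul_assoc Ω,
        Unitary.mul_star_self_of_mem hU.mem_unitary', one_mul]
    rw [this, hU.Δ_mul, hU.Δ_mul, star_sum, Finset.sum_mul_sum]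
    refine Finset.sum_congr rfl fun l _ => Finset.sum_congr rfl fun m _ => ?_
    rw [star_mul, ← map_star, ← map_star, map_mul, map_mul, ← (S.commute _ (star (U m j))).eq,
      mul_assoc, mul_assoc, ← mul_assoc (S.i₂ (U l i)), ← (S.commute _ (U l i)).eq, mul_assoc]
  have e2 : ∀ a c, S.slice₁ h (S.i₁ a * S.i₂ c) = h.eval a • c := fun a c => by
    have := S.flip.slice₂_i₂ h a
    rw [S.slice₁_mul_i₂]
    refine (congrArg (· * c) this).trans ?_
    rw [smul_mul_assoc, one_mul]
  have e3 : S.slice₁ h (S.Δ (∑ k, U k i * star (U k j))) =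
      ∑ k, ∑ l, ∑ m, h.eval (U k l * star (U k m)) • (U l i * star (U m j)) := by
    rw [map_sum, map_sum]
    simp_rw [e1, map_sum, e2]
  have e4 : h.eval (∑ k, U k i * star (U k j)) = gram h U i j := map_sum _ _ _
  rw [hh.slice₁, e4] at e3
  rw [Matrix.map_apply, Algebra.algebraMap_eq_smul_one, e3, Finset.sum_comm, Matrix.mul_apply]
  simp_rw [Matrix.mul_apply, Matrix.map_apply, Matrix.transpose_apply, Finset.sum_mul]
  rw [Finset.sum_comm]
  refine Finset.sum_congr rfl fun l _ => ?_
  rw [Finset.sum_comm]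
  refine Finset.sum_congr rfl fun m _ => ?_
  rw [← Finset.sum_smul, ← Algebra.commutes, mul_assoc, Algebra.algebraMap_eq_smul_one,
    smul_mul_assoc, one_mul, gram]

theorem gram_dotProduct (h : VectorFunctional Q) (U : Matrix n n Q) (x : n → ℂ) :
    star x ⬝ᵥ (gram h U).mulVec x =
      ∑ k, h.eval ((∑ i, star (x i) • U k i) * star (∑ i, star (x i) • U k i)) := by
  have e1 : ∀ k, h.eval ((∑ i, star (x i) • U k i) * star (∑ i, star (x i) • U k i)) =
      ∑ i, ∑ j, star (x i) * x j * h.eval (U k i * star (U k j)) := fun k => by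
    simp only [star_sum, star_smul, star_star, Finset.sum_mul_sum, smul_mul_smul_comm, map_sum,
      map_smul, smul_eq_mul]
  simp_rw [e1]
  rw [Finset.sum_comm, dotProduct]
  refine Finset.sum_congr rfl fun i _ => ?_
  rw [Finset.sum_comm, Matrix.mulVec, dotProduct, Finset.mul_sum]
  refine Finset.sum_congr rfl fun j _ => ?_
  rw [← Finset.mul_sum, gram, Pi.star_apply]
  ring

-- The quadratic form is a sum of terms `h(ww*)`. If it vanishes at `x`, Cauchy–Schwarz gives `h(wy)
-- = 0` for all `y`, and `eq_zero_of_null` applies; faithfulness of `h` is not needed.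
open scoped ComplexOrder in
theorem IsTwisted.gram_posDef (hh : S.IsHaar h) (hU : S.IsTwisted U Ω) : (gram h U).PosDef := by
  have hp : ∀ w, h.eval (w * star w) = ((‖h.op (star w) h.r‖ ^ 2 : ℝ) : ℂ) := fun w => by
    have := hh.pos.eval_star_mul_self (star w)
    rw [star_star] at this
    rw [this, Complex.ofReal_pow]
  refine Matrix.posDef_iff_dotProduct_mulVec.2 ⟨?_, fun x hx => ?_⟩
  · ext i j
    rw [Matrix.conjTranspose_apply, gram, gram, star_sum]
    refine Finset.sum_congr rfl fun k _ => ?_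
    have := hh.pos.eval_star (U k j * star (U k i))
    rw [star_mul, star_star] at this
    exact this.symm
  · rw [gram_dotProduct]
    simp_rw [hp]
    rw [← Complex.ofReal_sum, Complex.zero_lt_real]
    refine lt_of_le_of_ne (Finset.sum_nonneg fun _ _ => sq_nonneg _) fun h0 => hx ?_
    have h1 := (Finset.sum_eq_zero_iff_of_nonneg fun i _ => sq_nonneg _).1 h0.symm
    have h2 := hU.eq_zero_of_null hh (star x) fun j y => by
      have h3 : h.eval (star (star (∑ i, star (x i) • U j i)) * star (∑ i, star (x i) • U j i)) = 0 := by
        rw [star_star, hp, h1 j (Finset.mem_univ j), Complex.ofReal_zero]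
      have h4 := hh.pos.eval_mul_eq_zero h3 (star y)
      have h5 := hh.pos.eval_star ((∑ i, star (x i) • U j i) * y)
      rw [star_mul, h4] at h5
      exact star_eq_zero.1 h5.symm
    exact star_eq_zero.1 h2

end SlicedCoproduct

/-! ### Kronecker products of unitaries, conjugates and absorption -/

section Matrices

variable {Q R : Type*} [Ring Q] [StarRing Q] [Algebra ℂ Q] [StarModule ℂ Q] [Ring R] [StarRing R]
  [Algebra ℂ R] [StarModule ℂ R] {m n : Type*} [Fintype m] [Fintype n] [DecidableEq m]
  [DecidableEq n]

/-- Although the entries need not commute, in each product the inner pair of factors can be summed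
first to a scalar, after which the outer pair becomes adjacent. -/
theorem kronecker_mem_unitary {U : Matrix m m Q} {V : Matrix n n Q}
    (hU : U ∈ unitary (Matrix m m Q)) (hV : V ∈ unitary (Matrix n n Q)) :
    U ⊗ₖ V ∈ unitary (Matrix (m × n) (m × n) Q) := by
  rw [Unitary.mem_iff]
  constructor
  · ext ⟨i, k⟩ ⟨j, l⟩
    have e : ∀ a b, star (U a i * V b k) * (U a j * V b l) =
        star (V b k) * (star (U a i) * U a j) * V b l := fun a b => by
      rw [star_mul]; simp only [mul_assoc]
    simp only [Matrix.mul_apply, Matrix.star_apply, Matrix.kroneckerMap_apply,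
      Fintype.sum_prod_type, e]
    rw [Finset.sum_comm]
    simp_rw [← Finset.sum_mul, ← Finset.mul_sum,
      SlicedCoproduct.sum_star_mul_of_mem_unitary hU]
    by_cases hij : i = j
    · simp [hij, SlicedCoproduct.sum_star_mul_of_mem_unitary hV, Matrix.one_apply]
    · simp [hij]
  · ext ⟨i, k⟩ ⟨j, l⟩
    have e : ∀ a b, U i a * V k b * star (U j a * V l b) =
        U i a * (V k b * star (V l b)) * star (U j a) := fun a b => by
      rw [star_mul]; simp only [mul_assoc]
    simp only [Matrix.mul_apply, Matrix.star_apply, Matrix.kroneckerMap_apply,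
      Fintype.sum_prod_type, e]
    simp_rw [← Finset.sum_mul, ← Finset.mul_sum,
      SlicedCoproduct.sum_mul_star_of_mem_unitary hV]
    by_cases hkl : k = l
    · simp [hkl, SlicedCoproduct.sum_mul_star_of_mem_unitary hU, Matrix.one_apply]
    · simp [hkl]

theorem kronecker_legs {f g : Q →⋆ₐ[ℂ] R} (hfg : ∀ a b, Commute (f a) (g b)) (U : Matrix m m Q)
    (V : Matrix n n Q) (i j : m) (k l : n) :
    ((U ⊗ₖ V).map f * (U ⊗ₖ V).map g) (i, k) (j, l) =
      (U.map f * U.map g) i j * (V.map f * V.map g) k l := by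
  simp only [Matrix.mul_apply, Matrix.map_apply, Matrix.kroneckerMap_apply,
    Fintype.sum_prod_type, Finset.sum_mul_sum, map_mul]
  refine Finset.sum_congr rfl fun a _ => Finset.sum_congr rfl fun b _ => ?_
  rw [mul_assoc, ← mul_assoc (f (V k b)), (hfg _ _).eq]
  simp only [mul_assoc]

theorem map_mem_unitary (f : Q →⋆ₐ[ℂ] R) {U : Matrix n n Q} (hU : U ∈ unitary (Matrix n n Q)) :
    U.map f ∈ unitary (Matrix n n R) := by
  have e : star (U.map f) = (star U).map f := by
    ext i j; exact (map_star f _).symm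
  have h1 : (1 : Matrix n n Q).map f = 1 := Matrix.map_one f (map_zero f) (map_one f)
  rw [Unitary.mem_iff, e, ← Matrix.map_mul, ← Matrix.map_mul, (Unitary.mem_iff.1 hU).1,
    (Unitary.mem_iff.1 hU).2, h1]
  exact ⟨rfl, rfl⟩

variable (Q) in
/-- A scalar matrix as a matrix over `Q`. -/
abbrev scalarMatrix (A : Matrix n n ℂ) : Matrix n n Q := A.map (algebraMap ℂ Q)

theorem scalarMatrix_mul (A B : Matrix n n ℂ) :
    scalarMatrix Q (A * B) = scalarMatrix Q A * scalarMatrix Q B := Matrix.map_mul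

theorem scalarMatrix_one : scalarMatrix Q (1 : Matrix n n ℂ) = 1 :=
  Matrix.map_one _ (map_zero _) (map_one _)

theorem star_scalarMatrix (A : Matrix n n ℂ) : star (scalarMatrix Q A) = scalarMatrix Q (star A) := by
  ext i j; exact (algebraMap_star_comm _).symm

/-- An invariant vector of `U ⊗ V` is the same as an intertwiner from the entrywise adjoint of `U`
to `V`, by multiplying with `U*` on the left. -/
theorem kronecker_mulVec_scalarVec_iff {U V : Matrix n n Q} (hU : U ∈ unitary (Matrix n n Q))
    (t : Matrix n n ℂ) :
    (U ⊗ₖ V).mulVec (fun p : n × n => algebraMap ℂ Q (t p.1 p.2)) =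
        (fun p : n × n => algebraMap ℂ Q (t p.1 p.2)) ↔
      V * scalarMatrix Q t.transpose = scalarMatrix Q t.transpose * U.map star := by
  have e1 : (U ⊗ₖ V).mulVec (fun p : n × n => algebraMap ℂ Q (t p.1 p.2)) =
      fun p => (U * (V * scalarMatrix Q t.transpose).transpose) p.1 p.2 := by
    funext ⟨i, k⟩
    simp only [Matrix.mulVec, dotProduct, Fintype.sum_prod_type, Matrix.mul_apply,
      Matrix.kroneckerMap_apply, Matrix.transpose_apply, Matrix.map_apply, Finset.mul_sum, mul_assoc]
  have e2 : (star U * scalarMatrix Q t) =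
      (scalarMatrix Q t.transpose * U.map star).transpose := by
    ext i j
    simp only [Matrix.mul_apply, Matrix.transpose_apply, Matrix.map_apply, Matrix.star_apply]
    exact Finset.sum_congr rfl fun k _ => (Algebra.commutes _ _).symm
  have e3 : (U ⊗ₖ V).mulVec (fun p : n × n => algebraMap ℂ Q (t p.1 p.2)) =
        (fun p : n × n => algebraMap ℂ Q (t p.1 p.2)) ↔
      U * (V * scalarMatrix Q t.transpose).transpose = scalarMatrix Q t := by
    rw [e1]
    exact ⟨fun h => by ext i j; exact congrFun h (i, j), fun h => by rw [h]; rfl⟩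
  rw [e3, ← Matrix.transpose_inj (A := V * _), ← e2]
  constructor
  · intro h
    rw [← h, ← mul_assoc, (Unitary.mem_iff.1 hU).1, one_mul]
  · intro h
    rw [h, ← mul_assoc, (Unitary.mem_iff.1 hU).2, one_mul]

end Matrices

/-! ### Construction of a conjugate from the Gram matrices -/

namespace SlicedCoproduct

variable {Q R : Type u} [CStarAlgebra Q] [CStarAlgebra R] {S : SlicedCoproduct Q R}
  {h : VectorFunctional Q} {n : Type*} [Fintype n] [DecidableEq n] {U : Matrix n n Q} {Ω : R}

-- The entrywise adjoint `C` of `U` is unitary for the inner product given by `F`, so a square root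
-- of `F` conjugates it to a unitary matrix.
open scoped ComplexOrder MatrixOrder in
theorem IsTwisted.exists_isConjugate (hh : S.IsHaar h) (hU : S.IsTwisted U Ω) :
    ∃ Ubar, CompactQuantumGroup.IsConjugate U Ubar := by
  have hc : star (U.map star) = U.transpose := by ext i j; exact star_star _
  have hF := hU.gram_posDef hh
  have hF1 := hU.gram_intertwines hh
  have hG := hU.flip.gram_posDef hh.flip
  have hG1 := hU.flip.gram_intertwines hh.flip
  set F := gram h U
  set G := gram h (star U)
  have e1 : (star U).transpose = U.map star := by ext i j; rfl
  have e2 : (star U).map star = U.transpose := by ext i j; exact star_star _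
  rw [e1, e2, ← hc] at hG1
  rw [← hc] at hF1
  set C := U.map star
  -- Any `T` with `T*T = F` serves; it is invertible because `F` is.
  obtain ⟨T, hT⟩ := CStarAlgebra.nonneg_iff_eq_star_mul_self.mp hF.posSemidef.nonneg
  obtain ⟨Fi, hFi⟩ := hF.isUnit.exists_left_inv
  obtain ⟨Gi, hGi⟩ := hG.isUnit.exists_right_inv
  obtain ⟨Ti, hTi⟩ : ∃ Ti, Ti * T = 1 := ⟨Fi * star T, by rw [mul_assoc, ← hT, hFi]⟩
  have hTi' : T * Ti = 1 := mul_eq_one_comm.1 hTi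
  have sTi : scalarMatrix Q Ti * scalarMatrix Q T = 1 := by
    rw [← scalarMatrix_mul, hTi, scalarMatrix_one]
  have sTi' : scalarMatrix Q T * scalarMatrix Q Ti = 1 := by
    rw [← scalarMatrix_mul, hTi', scalarMatrix_one]
  set V := scalarMatrix Q T * C * scalarMatrix Q Ti with hV
  have hVT : V * scalarMatrix Q T = scalarMatrix Q T * C := by rw [hV, mul_assoc, sTi, mul_one]
  have hV1 : star V * V = 1 := by
    have : star V * V = star (scalarMatrix Q Ti) * (star C * (star (scalarMatrix Q T) *
        scalarMatrix Q T) * C) * scalarMatrix Q Ti := by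
      rw [hV]; simp only [star_mul, mul_assoc]
    rw [this, star_scalarMatrix T, ← scalarMatrix_mul, ← hT]
    refine (congrArg (fun X => star (scalarMatrix Q Ti) * X * scalarMatrix Q Ti) hF1).trans ?_
    change star (scalarMatrix Q Ti) * scalarMatrix Q F * scalarMatrix Q Ti = 1
    have e : star Ti * F * Ti = 1 := by
      calc star Ti * F * Ti = star (T * Ti) * (T * Ti) := by
            rw [hT, star_mul]; simp only [mul_assoc]
        _ = 1 := by rw [hTi', star_one, one_mul]
    rw [star_scalarMatrix, ← scalarMatrix_mul, ← scalarMatrix_mul, e, scalarMatrix_one]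
  -- `F` only yields a left inverse of `C`. The right inverse comes from the Gram matrix of `U*` in
  -- the co-opposite, where `C G C* = G`.
  have hV2 : V * (scalarMatrix Q T * (scalarMatrix Q G * star C * scalarMatrix Q Gi) *
      scalarMatrix Q Ti) = 1 := by
    have : C * (scalarMatrix Q G * star C * scalarMatrix Q Gi) = 1 := by
      have : C * scalarMatrix Q G * star C = scalarMatrix Q G := hG1
      rw [← mul_assoc, ← mul_assoc, this, ← scalarMatrix_mul, hGi, scalarMatrix_one]
    rw [← mul_assoc, ← mul_assoc, hVT, mul_assoc (scalarMatrix Q T) C, this, mul_one, sTi']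
  have hVu : V ∈ unitary (Matrix n n Q) := by
    refine Unitary.mem_iff.2 ⟨hV1, ?_⟩
    rw [left_inv_eq_right_inv hV1 hV2, hV2]
  have hV3 : V.map star * scalarMatrix Q (T.map star) = scalarMatrix Q (T.map star) * U := by
    ext i j
    have := congrArg star (congrFun (congrFun hVT i) j)
    simp only [Matrix.mul_apply, star_sum, star_mul, Matrix.map_apply, ← algebraMap_star_comm, C,
      star_star] at this
    simp only [Matrix.mul_apply, Matrix.map_apply, ← Algebra.commutes _ (star (V i _))]
    rw [this]
    exact Finset.sum_congr rfl fun k _ => (Algebra.commutes _ _).symm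
  have hst : ∀ A B : Matrix n n ℂ, (A * B).map star = A.map star * B.map star := fun A B =>
    Matrix.map_mul (f := starRingEnd ℂ)
  have h1 : (1 : Matrix n n ℂ).map star = 1 := Matrix.map_one _ (star_zero _) (star_one _)
  have hs1 : scalarMatrix Q (Ti.map star) * scalarMatrix Q (T.map star) = 1 := by
    rw [← scalarMatrix_mul, ← hst, hTi, h1, scalarMatrix_one]
  have hs2 : scalarMatrix Q (T.map star) * scalarMatrix Q (Ti.map star) = 1 := by
    rw [← scalarMatrix_mul, ← hst, hTi', h1, scalarMatrix_one]
  -- The invariant vectors encode the two intertwining relations of `T`, and the conjugate equations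
  -- are `T Ti = 1` and `Ti T = 1`.
  refine ⟨V, hVu, star Ti, T.transpose, ?_, ?_, ?_, ?_⟩
  · refine (kronecker_mulVec_scalarVec_iff hVu _).2 ?_
    have e : (star Ti).transpose = Ti.map star := by ext i j; rfl
    rw [e]
    calc U * scalarMatrix Q (Ti.map star)
        = scalarMatrix Q (Ti.map star) * (scalarMatrix Q (T.map star) * U) *
            scalarMatrix Q (Ti.map star) := by rw [← mul_assoc, hs1, one_mul]
      _ = _ := by rw [← hV3, mul_assoc, mul_assoc, hs2, mul_one]
  · refine (kronecker_mulVec_scalarVec_iff hU.mem_unitary _).2 ?_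
    rw [Matrix.transpose_transpose]; exact hVT
  · have e : (star Ti).map star = Ti.transpose := by ext i j; exact star_star _
    rw [e, ← Matrix.transpose_mul, hTi', Matrix.transpose_one]
  · have e : (T.transpose).map star = star T := by ext i j; rfl
    rw [e, ← star_mul, hTi, star_one]

end SlicedCoproduct

/-! ### Compensated pairs -/

namespace CompactQuantumGroup

variable {Q : Type u} [CStarAlgebra Q] (G : CompactQuantumGroup Q) {n : Type*} [Fintype n]
  [DecidableEq n]

/-- The zero algebra has no states, hence no Haar state, and is treated apart. -/
theorem exists_isConjugate_of_subsingleton [Subsingleton Q] (U : Matrix n n Q) :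
    ∃ Ubar, IsConjugate U Ubar := by
  have h1 : (1 : Matrix n n ℂ).map star = 1 := Matrix.map_one _ (star_zero _) (star_one _)
  exact ⟨U, Unitary.mem_iff.2 ⟨Subsingleton.elim _ _, Subsingleton.elim _ _⟩, 1, 1,
    Subsingleton.elim _ _, Subsingleton.elim _ _, by rw [h1, one_mul], by rw [h1, one_mul]⟩

/-- The matrix `U₁₂ U₁₃`. -/
def legs (U : Matrix n n Q) : Matrix n n (SpatialTensor Q Q) :=
  U.map (inLeft Q Q) * U.map (inRight Q Q)

theorem legs_kronecker {m : Type*} [Fintype m] [DecidableEq m] (U : Matrix n n Q) (V : Matrix m m Q) (i j : n)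
    (k l : m) : legs (U ⊗ₖ V) (i, k) (j, l) = legs U i j * legs V k l :=
  kronecker_legs inLeft_commute_inRight U V i j k l

variable {G} in
theorem IsCorepresentation.comul_apply {V : Matrix n n Q} (hV : G.IsCorepresentation V) (i j : n) :
    G.comul (V i j) = legs V i j :=
  congrFun (congrFun hV.2 i) j

theorem legs_mem_unitary {U : Matrix n n Q} (hU : U ∈ unitary (Matrix n n Q)) :
    legs U ∈ unitary (Matrix n n (SpatialTensor Q Q)) :=
  mul_mem (map_mem_unitary _ hU) (map_mem_unitary _ hU)

/-- For a unitary `ω` that commutes with the range of `Δ`, one has `Δ(U) = U₁₂ U₁₃ ω` and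
`Δ(V) = ω* V₁₂ V₁₃`. -/
structure IsCompensated (U V : Matrix n n Q) (ω : SpatialTensor Q Q) : Prop where
  mem_unitary : ω ∈ unitary (SpatialTensor Q Q)
  comm : ∀ x, ω * G.comul x = G.comul x * ω
  left : ∀ i j, G.comul (U i j) = legs U i j * ω
  right : ∀ i j, G.comul (V i j) = star ω * legs V i j

variable {G} {U V : Matrix n n Q}

/-- Since `ω` commutes with the range of `Δ`, it may be moved to either side of `Δ(U)` and `Δ(V)`.
This symmetry is what identifies the left and right notions. -/
theorem IsCompensated.symm {ω : SpatialTensor Q Q} (h : G.IsCompensated U V ω) :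
    G.IsCompensated V U (star ω) := by
  have hc : ∀ x, star ω * G.comul x = G.comul x * star ω := fun x => by
    have := congrArg star (h.comm (star x))
    rw [star_mul, star_mul, map_star, star_star] at this
    exact this.symm
  refine ⟨Unitary.star_mem h.mem_unitary, hc, fun i j => ?_, fun i j => ?_⟩
  · have : legs V i j = ω * G.comul (V i j) := by
      rw [h.right, ← mul_assoc, (Unitary.mem_iff.1 h.mem_unitary).2, one_mul]
    rw [this, h.comm, mul_assoc, (Unitary.mem_iff.1 h.mem_unitary).2, mul_one]
  · have : legs U i j = G.comul (U i j) * star ω := by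
      rw [h.left, mul_assoc, (Unitary.mem_iff.1 h.mem_unitary).2, mul_one]
    rw [this, ← hc, ← mul_assoc, star_star, (Unitary.mem_iff.1 h.mem_unitary).2, one_mul]

/-- Between `Δ(U)` and `Δ(V)` the middle factor becomes `ω Δ(W) ω* = Δ(W)`. -/
theorem IsCompensated.isCorepresentation {ω : SpatialTensor Q Q} (h : G.IsCompensated U V ω)
    (hU : U ∈ unitary (Matrix n n Q)) (hV : V ∈ unitary (Matrix n n Q)) {m : Type*} [Fintype m]
    [DecidableEq m] {W : Matrix m m Q} (hW : G.IsCorepresentation W) :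
    G.IsCorepresentation ((U ⊗ₖ W) ⊗ₖ V) := by
  refine ⟨kronecker_mem_unitary (kronecker_mem_unitary hU hW.1) hV, ?_⟩
  ext ⟨⟨i, k⟩, a⟩ ⟨⟨j, l⟩, b⟩
  change G.comul (U i j * W k l * V a b) = legs ((U ⊗ₖ W) ⊗ₖ V) ((i, k), a) ((j, l), b)
  have e : ω * legs W k l * star ω = legs W k l := by
    rw [← hW.comul_apply, h.comm, mul_assoc, (Unitary.mem_iff.1 h.mem_unitary).2, mul_one]
  calc G.comul (U i j * W k l * V a b)
      = legs U i j * (ω * legs W k l * star ω) * legs V a b := by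
        rw [map_mul, map_mul, h.left, h.right, hW.comul_apply]; simp only [mul_assoc]
    _ = _ := by rw [e, legs_kronecker, legs_kronecker]

/-- The conjugate is `T Ū T⁻¹` with `T` scalar. Adjoints give `Δ(Ū) = Ω Ū₁₂Ū₁₃`, and scalars commute
with `Ω`. -/
theorem IsRightProjective.isCompensated {Ω : SpatialTensor Q Q} (h : G.IsRightProjective U Ω)
    (hΩ : ∀ x, Ω * G.comul x = G.comul x * Ω) (hV : IsConjugate U V) :
    G.IsCompensated U V (star Ω) := by
  have hu := h.2.1.1
  have hc : ∀ x, star Ω * G.comul x = G.comul x * star Ω := fun x => by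
    have := congrArg star (hΩ (star x))
    rw [star_mul, star_mul, map_star, star_star] at this
    exact this.symm
  have hl : ∀ i j, G.comul (U i j) = legs U i j * star Ω := fun i j => by
    have : G.comul (U i j) * Ω = legs U i j := congrFun (congrFun h.2.2 i) j
    rw [← this, mul_assoc, (Unitary.mem_iff.1 hu).2, mul_one]
  refine ⟨Unitary.star_mem hu, hc, hl, fun i j => ?_⟩
  obtain ⟨_, s, t, h1, h2, h3, h4⟩ := hV
  have h5 := (kronecker_mulVec_scalarVec_iff h.1 _).1 h2
  set T := t.transpose
  obtain ⟨Ti, hTi⟩ : ∃ Ti, T * Ti = 1 :=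
    ⟨(s.map star).transpose, by rw [← Matrix.transpose_mul, h3, Matrix.transpose_one]⟩
  have hTi' : Ti * T = 1 := mul_eq_one_comm.1 hTi
  have hVe : V = scalarMatrix Q T * U.map star * scalarMatrix Q Ti := by
    rw [← h5, mul_assoc, ← scalarMatrix_mul, hTi, scalarMatrix_one, mul_one]
  have hf : ∀ (f : Q →⋆ₐ[ℂ] SpatialTensor Q Q), V.map f = scalarMatrix _ T * (U.map star).map f *
      scalarMatrix _ Ti := fun f => by
    have : ∀ A : Matrix n n ℂ, (scalarMatrix Q A).map f = scalarMatrix _ A := fun A => by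
      ext i j; exact AlgHomClass.commutes f _
    rw [hVe, Matrix.map_mul, Matrix.map_mul, this, this]
  have hlegs : legs V = scalarMatrix _ T * ((U.map star).map (inLeft Q Q) *
      (U.map star).map (inRight Q Q)) * scalarMatrix _ Ti := by
    rw [legs, hf, hf]
    have : scalarMatrix (SpatialTensor Q Q) Ti * scalarMatrix _ T = 1 := by
      rw [← scalarMatrix_mul, hTi', scalarMatrix_one]
    calc _ = scalarMatrix _ T * (U.map star).map (inLeft Q Q) * (scalarMatrix (SpatialTensor Q Q) Ti * scalarMatrix _ T)
          * (U.map star).map (inRight Q Q) * scalarMatrix _ Ti := by simp only [mul_assoc]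
      _ = _ := by rw [this, mul_one]; simp only [mul_assoc]
  have hΔ : (U.map star).map G.comul = Matrix.diagonal (fun _ => Ω) * ((U.map star).map (inLeft Q Q) *
      (U.map star).map (inRight Q Q)) := by
    ext i j
    have e1 : G.comul (star (U i j)) = Ω * star (legs U i j) := by
      rw [map_star, hl, star_mul, star_star]
    -- The adjoint reverses the two factors of each summand, and these commute because they lie in
    -- different legs.
    have e2 : star (legs U i j) = ((U.map star).map (inLeft Q Q) *
        (U.map star).map (inRight Q Q)) i j := by
      simp only [legs, Matrix.mul_apply, star_sum, star_mul, Matrix.map_apply, map_star]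
      refine Finset.sum_congr rfl fun k _ => ?_
      rw [← map_star, ← map_star, (inLeft_commute_inRight _ _).eq]
    rw [Matrix.diagonal_mul, ← e2, ← e1]
    rfl
  have hcs : scalarMatrix _ T * Matrix.diagonal (fun _ => Ω) =
      Matrix.diagonal (fun _ => Ω) * scalarMatrix _ T := by
    ext i j
    rw [Matrix.diagonal_mul, Matrix.mul_diagonal]
    exact Algebra.commutes (T i j) Ω
  have : V.map G.comul = Matrix.diagonal (fun _ => Ω) * legs V := by
    rw [hf, hΔ, hlegs, ← mul_assoc, hcs]
    simp only [mul_assoc]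
  have := congrFun (congrFun this i) j
  rw [Matrix.diagonal_mul] at this
  rw [star_star]
  exact this

variable (G) in
theorem isCorepresentation_one : G.IsCorepresentation (1 : Matrix n n Q) := by
  refine ⟨one_mem _, ?_⟩
  rw [Matrix.map_one _ (map_zero _) (map_one _), Matrix.map_one _ (map_zero _) (map_one _),
    Matrix.map_one _ (map_zero _) (map_one _), one_mul]

/-- Trivial `W` determines `ω`, and the remaining `W` make it commute with `Δ`. A nonempty index set
is needed to read `ω` off from an entry. -/
theorem exists_isCompensated [Nonempty n] (hU : U ∈ unitary (Matrix n n Q))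
    (hV : V ∈ unitary (Matrix n n Q))
    (hd : Dense (Submodule.span ℂ {x | ∃ (m : ℕ) (W : Matrix (Fin m) (Fin m) Q),
      G.IsCorepresentation W ∧ ∃ i j, W i j = x} : Set Q))
    (h : ∀ (m : ℕ) (W : Matrix (Fin m) (Fin m) Q), G.IsCorepresentation W →
      G.IsCorepresentation ((U ⊗ₖ W) ⊗ₖ V)) :
    ∃ ω, G.IsCompensated U V ω := by
  obtain ⟨i₀⟩ := ‹Nonempty n›
  have h1 : ∀ (m : ℕ) (W : Matrix (Fin m) (Fin m) Q), G.IsCorepresentation W → ∀ i j k l a b,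
      G.comul (U i j) * G.comul (W k l) * G.comul (V a b) =
        legs U i j * G.comul (W k l) * legs V a b := fun m W hW i j k l a b => by
    have := (h m W hW).comul_apply ((i, k), a) ((j, l), b)
    rw [legs_kronecker, legs_kronecker, ← hW.comul_apply] at this
    rw [← this, ← map_mul, ← map_mul]
    rfl
  have h2 : ∀ i j a b, G.comul (U i j) * G.comul (V a b) = legs U i j * legs V a b :=
    fun i j a b => by
      have := h1 1 1 (G.isCorepresentation_one) i j 0 0 a b
      rwa [Matrix.one_apply_eq, map_one, mul_one, mul_one] at this
  have uU := SlicedCoproduct.sum_star_mul_of_mem_unitary (legs_mem_unitary hU)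
  have uV := SlicedCoproduct.sum_mul_star_of_mem_unitary (legs_mem_unitary hV)
  have uV' := SlicedCoproduct.sum_star_mul_of_mem_unitary (map_mem_unitary G.comul hV)
  have uV'' := SlicedCoproduct.sum_mul_star_of_mem_unitary (map_mem_unitary G.comul hV)
  have uU' := SlicedCoproduct.sum_star_mul_of_mem_unitary (map_mem_unitary G.comul hU)
  have uU'' := SlicedCoproduct.sum_mul_star_of_mem_unitary (legs_mem_unitary hU)
  simp only [Matrix.map_apply] at uV' uV'' uU'
  -- `E = V₁₂V₁₃Δ(V)*` should be `ω` times the identity matrix.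
  let E : n → n → SpatialTensor Q Q := fun k l => ∑ b, legs V k b * star (G.comul (V l b))
  have hE : ∀ i j k l, (if k = l then G.comul (U i j) else 0) = legs U i j * E k l :=
    fun i j k l => by
      simp only [E, Finset.mul_sum, ← mul_assoc, ← h2]
      simp only [mul_assoc, ← Finset.mul_sum, uV'']
      rw [mul_ite, mul_one, mul_zero]
  -- Cancelling a column of `U₁₂U₁₃` expresses `E k l` through `U` alone, apart from the factor
  -- `δₖₗ`.
  have hE0 : ∀ k l, E k l = if k = l then E i₀ i₀ else 0 := fun k l => by
    have e1 : ∀ k l, E k l = ∑ i, star (legs U i i₀) * (if k = l then G.comul (U i i₀) else 0) :=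
      fun k l => by
        simp_rw [hE, ← mul_assoc]
        rw [← Finset.sum_mul, uU, if_pos rfl, one_mul]
    rw [e1 k l, e1 i₀ i₀]
    by_cases hkl : k = l <;> simp [hkl]
  set ω := E i₀ i₀
  have hl : ∀ i j, G.comul (U i j) = legs U i j * ω := fun i j => by
    simpa using hE i j i₀ i₀
  have hr : ∀ a b, legs V a b = ω * G.comul (V a b) := fun a b => by
    have : ∑ l, E a l * G.comul (V l b) = legs V a b := by
      simp only [E, Finset.sum_mul, mul_assoc]
      rw [Finset.sum_comm]
      simp only [← Finset.mul_sum, uV']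
      simp
    rw [← this]
    simp [hE0]
  have hω1 : star ω * ω = 1 := by
    have := uU' i₀ i₀
    simp_rw [hl, star_mul] at this
    have e : ∀ k, star ω * star (legs U k i₀) * (legs U k i₀ * ω) =
      star ω * (star (legs U k i₀) * legs U k i₀) * ω := fun k => by simp only [mul_assoc]
    simp_rw [e] at this
    rwa [← Finset.sum_mul, ← Finset.mul_sum, uU, if_pos rfl, mul_one] at this
  have hω2 : ω * star ω = 1 := by
    have := uV i₀ i₀
    simp_rw [hr, star_mul] at this
    have e : ∀ k, ω * G.comul (V i₀ k) * (star (G.comul (V i₀ k)) * star ω) =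
      ω * (G.comul (V i₀ k) * star (G.comul (V i₀ k))) * star ω := fun k => by
        simp only [mul_assoc]
    simp_rw [e] at this
    rwa [← Finset.sum_mul, ← Finset.mul_sum, uV'', if_pos rfl, mul_one] at this
  have hr' : ∀ a b, G.comul (V a b) = star ω * legs V a b := fun a b => by
    rw [hr, ← mul_assoc, hω1, one_mul]
  refine ⟨ω, Unitary.mem_iff.2 ⟨hω1, hω2⟩, ?_, hl, hr'⟩
  -- Both sides agree once flanked by entries of `U₁₂U₁₃` and `V₁₂V₁₃`; unitarity strips these off.
  have hcm : ∀ (m : ℕ) (W : Matrix (Fin m) (Fin m) Q), G.IsCorepresentation W → ∀ k l,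
      ω * G.comul (W k l) * star ω = G.comul (W k l) := fun m W hW k l => by
    have e1 : ∀ i b, legs U i i₀ * (ω * G.comul (W k l) * star ω) * legs V i₀ b =
        legs U i i₀ * G.comul (W k l) * legs V i₀ b := fun i b => by
      rw [← h1 m W hW, hl, hr' i₀ b]; simp only [mul_assoc]
    have e2 : ∀ X, ∑ i, ∑ b, star (legs U i i₀) * (legs U i i₀ * X * legs V i₀ b) *
        star (legs V i₀ b) = X := fun X => by
      have : ∀ i b, star (legs U i i₀) * (legs U i i₀ * X * legs V i₀ b) * star (legs V i₀ b) =
        star (legs U i i₀) * legs U i i₀ * X * (legs V i₀ b * star (legs V i₀ b)) := fun i b => by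
          simp only [mul_assoc]
      simp_rw [this, ← Finset.mul_sum, uV, if_true, mul_one]
      rw [← Finset.sum_mul, uU, if_pos rfl, one_mul]
    rw [← e2 (ω * G.comul (W k l) * star ω)]
    simp_rw [e1]
    exact e2 _
  have hΔ := continuous_starHom G.comul
  refine fun x => congrFun (Continuous.ext_on hd (hΔ.const_mul ω) (hΔ.mul_const ω) ?_) x
  intro y hy
  induction hy using Submodule.span_induction with
  | zero => simp
  | add a b _ _ ha hb =>
    change ω * G.comul (a + b) = G.comul (a + b) * ω
    rw [map_add, mul_add, add_mul]
    exact congrArg₂ _ ha hb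
  | smul c a _ ha =>
    change ω * G.comul (c • a) = G.comul (c • a) * ω
    rw [map_smul, mul_smul_comm, smul_mul_assoc]
    exact congrArg _ ha
  | mem y hy =>
    obtain ⟨m, W, hW, k, l, rfl⟩ := hy
    have := congrArg (· * ω) (hcm m W hW k l)
    change ω * G.comul (W k l) * star ω * ω = G.comul (W k l) * ω at this
    rwa [mul_assoc, hω1, mul_one] at this

end CompactQuantumGroup

/-! ### The regular representation -/

/-- Families with equal Gram matrices and dense spans are related by a unitary. -/
theorem exists_linearIsometryEquiv {ι E F : Type*} [NormedAddCommGroup E] [InnerProductSpace ℂ E]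
    [CompleteSpace E] [NormedAddCommGroup F] [InnerProductSpace ℂ F] [CompleteSpace F] (f : ι → E)
    (g : ι → F) (hfg : ∀ i j, inner ℂ (g i) (g j) = inner ℂ (f i) (f j))
    (hf : Dense (Submodule.span ℂ (Set.range f) : Set E))
    (hg : Dense (Submodule.span ℂ (Set.range g) : Set F)) :
    ∃ V : E ≃ₗᵢ[ℂ] F, ∀ i, V (f i) = g i := by
  have hf' : DenseRange (Finsupp.linearCombination ℂ f) := by
    rwa [← Finsupp.range_linearCombination] at hf
  have hg' : DenseRange (Finsupp.linearCombination ℂ g) := by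
    rwa [← Finsupp.range_linearCombination] at hg
  have hi : ∀ a, inner ℂ (Finsupp.linearCombination ℂ g a) (Finsupp.linearCombination ℂ g a) =
      inner ℂ (Finsupp.linearCombination ℂ f a) (Finsupp.linearCombination ℂ f a) := fun a => by
    simp only [Finsupp.linearCombination_apply, Finsupp.sum, sum_inner, inner_sum, inner_smul_left,
      inner_smul_right, hfg]
  have hn : ∀ a, ‖Finsupp.linearCombination ℂ g (LinearEquiv.refl ℂ (ι →₀ ℂ) a)‖ =
      ‖Finsupp.linearCombination ℂ f a‖ := fun a => by
    rw [LinearEquiv.refl_apply, @norm_eq_sqrt_re_inner ℂ, @norm_eq_sqrt_re_inner ℂ, hi]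
  refine ⟨LinearEquiv.extendOfIsometry (LinearEquiv.refl ℂ (ι →₀ ℂ)) _ _ hf' hg' hn, fun i => ?_⟩
  have := LinearEquiv.extendOfIsometry_eq (LinearEquiv.refl ℂ (ι →₀ ℂ)) _ _ hf' hg' hn
    (Finsupp.single i 1)
  simpa using this

section

variable {A B : Type u} [CStarAlgebra A] [CStarAlgebra B]

/-- The map `x ↦ x ⊗ y`. -/
def HilbertRep.tmulRight (R : HilbertRep A) {S : HilbertRep B} (y : S.space) :
    R.space →L[ℂ] (R.tensor S).space :=
  LinearMap.mkContinuous ⟨⟨fun x => HilbertRep.tmul x y, fun x x' => HilbertTensor.add_tmul x x' y⟩,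
    fun c x => HilbertTensor.smul_tmul c x y⟩ ‖y‖ fun x => by
      rw [mul_comm]; exact (HilbertRep.norm_tmul x y).le

theorem HilbertRep.span_tmul_dense (R : HilbertRep A) (S : HilbertRep B) :
    Dense (Submodule.span ℂ (Set.range fun p : R.space × S.space =>
      (HilbertRep.tmul p.1 p.2 : (R.tensor S).space)) : Set (R.tensor S).space) := by
  rw [Submodule.dense_iff_topologicalClosure_eq_top, Submodule.topologicalClosure_eq_top_iff,
    Submodule.eq_bot_iff]
  intro z hz
  have h0 : innerSL ℂ z = 0 := HilbertRep.tensor_ext fun x y =>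
    Submodule.inner_left_of_mem_orthogonal (Submodule.subset_span (Set.mem_range_self (x, y))) hz
  have := DFunLike.congr_fun h0 z
  exact inner_self_eq_zero.1 this

theorem HilbertRep.eq_of_inner_tmul {R : HilbertRep A} {S : HilbertRep B} {z w : (R.tensor S).space}
    (h : ∀ x y, Inner.inner ℂ (HilbertRep.tmul x y) z = Inner.inner ℂ (HilbertRep.tmul x y) w) :
    z = w := by
  refine (R.span_tmul_dense S).eq_of_inner_right (𝕜 := ℂ) fun v hv => ?_
  induction hv using Submodule.span_induction with
  | zero => rw [inner_zero_left, inner_zero_left]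
  | add a b _ _ ha hb => rw [inner_add_left, inner_add_left, ha, hb]
  | smul c a _ ha => rw [inner_smul_left, inner_smul_left, ha]
  | mem v hv => obtain ⟨p, rfl⟩ := hv; exact h p.1 p.2

theorem HilbertRep.tensor_op_inRight {R : HilbertRep A} {S : HilbertRep B} (b : B) (x : R.space)
    (y : S.space) : (R.tensor S).op (inRight A B b) (HilbertRep.tmul x y) =
      HilbertRep.tmul x (S.op b y) := by
  refine (HilbertRep.tensor_op_tmul 1 b x y).trans ?_
  rw [HilbertRep.op_one]; rfl

theorem HilbertRep.tensor_op_inLeft {R : HilbertRep A} {S : HilbertRep B} (a : A) (x : R.space)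
    (y : S.space) : (R.tensor S).op (inLeft A B a) (HilbertRep.tmul x y) =
      HilbertRep.tmul (R.op a x) y := by
  refine (HilbertRep.tensor_op_tmul a 1 x y).trans ?_
  rw [HilbertRep.op_one]; rfl

end

variable {Q : Type u} [CStarAlgebra Q]

/-- The cyclic representation of a Haar state. -/
structure CompactQuantumGroup.RegularRep (G : CompactQuantumGroup Q) extends HilbertRep Q where
  /-- The cyclic vector. -/
  vac : space
  norm_vac : ‖vac‖ = 1
  denseRange : DenseRange fun a => toHilbertRep.op a vac
  isHaar : G.sliced.IsHaar ⟨toHilbertRep, vac, vac⟩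

theorem CompactQuantumGroup.nonempty_regularRep [Nontrivial Q] (G : CompactQuantumGroup Q) :
    Nonempty G.RegularRep := by
  obtain ⟨h, hh, hH⟩ := G.sliced.exists_isHaar
  obtain ⟨R, ξ, hξ, he, hd⟩ := hh.exists_cyclic
  exact ⟨⟨R, ξ, hξ, hd, hH ⟨R, ξ, ξ⟩ rfl (ContinuousLinearMap.ext fun a => (he a).symm)⟩⟩

/-! ### The regular corepresentation and its matrix coefficients -/

namespace CompactQuantumGroup.RegularRep

variable {G : CompactQuantumGroup Q} (K : G.RegularRep)

/-- The Haar functional. -/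
abbrev haar : VectorFunctional Q := ⟨K.toHilbertRep, K.vac, K.vac⟩

/-- The orbit map `x ↦ x ξ₀`. -/
def orb : Q →ₗ[ℂ] K.space where
  toFun x := K.op x K.vac
  map_add' x y := by rw [K.op_add]; rfl
  map_smul' c x := by rw [K.op_smul]; rfl

theorem denseRange_orb : DenseRange K.orb := K.denseRange

theorem inner_orb (x : Q) (η : K.space) :
    Inner.inner ℂ η (K.orb x) = (⟨K.toHilbertRep, η, K.vac⟩ : VectorFunctional Q).eval x := rfl

theorem norm_orb_le (x : Q) : ‖K.orb x‖ ≤ ‖x‖ := by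
  have := (K.op x).le_of_opNorm_le (K.norm_op_le x) K.vac
  rwa [K.norm_vac, mul_one] at this

/-- The orbit map, as a bounded operator. -/
def orbL : Q →L[ℂ] K.space := K.orb.mkContinuous 1 fun x => by rw [one_mul]; exact K.norm_orb_le x

/-- The left side is a product functional of `Δ(x*y)`, and invariance `(h ⊗ id)Δ = h(·)1` evaluates
it. -/
theorem inner_comul (T : HilbertRep Q) (x y : Q) (κ κ' : T.space) :
    Inner.inner ℂ ((K.tensor T).op (G.comul x) (HilbertRep.tmul K.vac κ))
      ((K.tensor T).op (G.comul y) (HilbertRep.tmul K.vac κ')) =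
    Inner.inner ℂ (K.orb x) (K.orb y) * Inner.inner ℂ κ κ' := by
  have e1 : Inner.inner ℂ ((K.tensor T).op (G.comul x) (HilbertRep.tmul K.vac κ))
      ((K.tensor T).op (G.comul y) (HilbertRep.tmul K.vac κ')) =
      (K.haar.prod ⟨T, κ, κ'⟩).eval (G.comul (star x * y)) := by
    refine Eq.trans ?_ (VectorFunctional.eval_apply _ _).symm
    refine Eq.trans ?_ (congrArg (fun X => Inner.inner ℂ (HilbertRep.tmul K.vac κ)
      ((K.tensor T).op X (HilbertRep.tmul K.vac κ')))
      ((map_mul G.comul _ _).trans (congrArg (· * _) (map_star G.comul x))).symm)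
    refine Eq.trans ?_ (congrArg (Inner.inner ℂ (HilbertRep.tmul K.vac κ))
      (HilbertRep.op_mul_apply (K.tensor T) _ _ _)).symm
    refine Eq.trans ?_ (HilbertRep.inner_op_right (K.tensor T) _ _ _).symm
    rw [star_star]
  have e2 : sliceLeft K.haar (G.comul (star x * y)) = K.haar.eval (star x * y) • (1 : Q) :=
    K.isHaar.slice₁ _
  have e3 : K.haar.eval (star x * y) = Inner.inner ℂ (K.orb x) (K.orb y) := by
    refine (VectorFunctional.eval_apply _ _).trans ?_
    refine (congrArg (Inner.inner ℂ K.vac) (K.op_mul_apply _ _ _)).trans ?_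
    refine (K.inner_op_right _ _ _).trans ?_
    rw [star_star]; rfl
  rw [e1, ← eval_sliceLeft, e2, map_smul, smul_eq_mul, e3, VectorFunctional.eval_apply]
  change _ * Inner.inner ℂ κ (T.op 1 κ') = _
  rw [T.op_one]; rfl

theorem norm_comul (T : HilbertRep Q) (x : Q) (κ : T.space) :
    ‖(K.tensor T).op (G.comul x) (HilbertRep.tmul K.vac κ)‖ = ‖K.orb x‖ * ‖κ‖ := by
  rw [← sq_eq_sq₀ (norm_nonneg _) (by positivity), mul_pow]
  have := K.inner_comul T x x κ κ
  rw [inner_self_eq_norm_sq_to_K, inner_self_eq_norm_sq_to_K, inner_self_eq_norm_sq_to_K] at this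
  exact_mod_cast this

/-- `inner_comul` says that the two families have the same Gram matrix, so only density of their
spans is at stake. -/
theorem exists_unitary (T : HilbertRep Q) : ∃ V : (K.tensor T).space ≃ₗᵢ[ℂ] (K.tensor T).space,
    ∀ x κ, V (HilbertRep.tmul (K.orb x) κ) =
      (K.tensor T).op (G.comul x) (HilbertRep.tmul K.vac κ) := by
  have hred : ∀ M : Submodule ℂ (K.tensor T).space, IsClosed (M : Set (K.tensor T).space) →
      (∀ x κ, HilbertRep.tmul (K.orb x) κ ∈ M) → M = ⊤ := fun M hM h => by
    refine top_le_iff.1 ((Submodule.dense_iff_topologicalClosure_eq_top.1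
      (K.span_tmul_dense T)).ge.trans ?_)
    refine Submodule.topologicalClosure_minimal _ (Submodule.span_le.2 ?_) hM
    rintro _ ⟨⟨ξ, κ⟩, rfl⟩
    exact K.denseRange_orb.induction_on (p := fun ξ => (HilbertRep.tmul ξ κ : (K.tensor T).space) ∈
      M) ξ (hM.preimage (K.tmulRight κ).continuous) fun x => h x κ
  have hd1 : Dense (Submodule.span ℂ (Set.range fun p : Q × T.space =>
      (HilbertRep.tmul (K.orb p.1) p.2 : (K.tensor T).space)) : Set (K.tensor T).space) := by
    rw [Submodule.dense_iff_topologicalClosure_eq_top]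
    exact hred _ (Submodule.isClosed_topologicalClosure _) fun x κ =>
      Submodule.le_topologicalClosure _ (Submodule.subset_span (Set.mem_range_self (x, κ)))
  -- This is where density of `Δ(Q)(1 ⊗ Q)` enters: `1 ⊗ q` is absorbed into `κ`, so every `z(ξ₀ ⊗
  -- κ)` is a limit of the given vectors.
  have hd2 : Dense (Submodule.span ℂ (Set.range fun p : Q × T.space =>
      (K.tensor T).op (G.comul p.1) (HilbertRep.tmul K.vac p.2)) : Set (K.tensor T).space) := by
    set M : Submodule ℂ (K.tensor T).space := (Submodule.span ℂ (Set.range fun p : Q × T.space =>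
      (K.tensor T).op (G.comul p.1) (HilbertRep.tmul K.vac p.2))).topologicalClosure with hM
    have h1 : ∀ (z : SpatialTensor Q Q) (κ : T.space),
        (K.tensor T).op z (HilbertRep.tmul K.vac κ) ∈ M := fun z κ => by
      let L : SpatialTensor Q Q →L[ℂ] (K.tensor T).space :=
        (ContinuousLinearMap.apply ℂ _ (HilbertRep.tmul K.vac κ)) ∘L (K.tensor T).opL
      have h2 : IsClosed (L ⁻¹' (M : Set (K.tensor T).space)) :=
        (Submodule.isClosed_topologicalClosure _).preimage L.continuous
      have h3 : (Submodule.span ℂ (Set.range fun p : Q × Q =>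
          G.comul p.1 * inRight Q Q p.2)) ≤ M.comap (L : SpatialTensor Q Q →ₗ[ℂ] _) := by
        refine Submodule.span_le.2 ?_
        rintro _ ⟨p, rfl⟩
        change (K.tensor T).op (G.comul p.1 * inRight Q Q p.2) (HilbertRep.tmul K.vac κ) ∈ M
        rw [HilbertRep.op_mul_apply, HilbertRep.tensor_op_inRight]
        exact Submodule.le_topologicalClosure _ (Submodule.subset_span ⟨(p.1, T.op p.2 κ), rfl⟩)
      exact h2.closure_subset_iff.2 h3 (G.dense_right z)
    rw [Submodule.dense_iff_topologicalClosure_eq_top, ← hM]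
    refine hred _ (Submodule.isClosed_topologicalClosure _) fun x κ => ?_
    have := h1 (inLeft Q Q x) κ
    rwa [HilbertRep.tensor_op_inLeft] at this
  obtain ⟨V, hV⟩ := exists_linearIsometryEquiv _ _ (fun p q => by
    rw [inner_comul]; exact (HilbertRep.inner_tmul _ _ _ _).symm) hd1 hd2
  exact ⟨V, fun x κ => hV (x, κ)⟩

/-- The regular corepresentation, in the representation `T` of its second leg. -/
def V (T : HilbertRep Q) : (K.tensor T).space ≃ₗᵢ[ℂ] (K.tensor T).space :=
  (K.exists_unitary T).choose

theorem V_tmul_orb (T : HilbertRep Q) (x : Q) (κ : T.space) :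
    K.V T (HilbertRep.tmul (K.orb x) κ) = (K.tensor T).op (G.comul x) (HilbertRep.tmul K.vac κ) :=
  (K.exists_unitary T).choose_spec x κ

theorem eval_sliceLeft_mul_comul (f : VectorFunctional Q) (z : SpatialTensor Q Q) (x : Q) :
    f.eval (sliceLeft K.haar (z * G.comul x)) =
      Inner.inner ℂ ((K.tensor f.toHilbertRep).op (star z) (HilbertRep.tmul K.vac f.l))
        ((K.tensor f.toHilbertRep).op (G.comul x) (HilbertRep.tmul K.vac f.r)) := by
  rw [eval_sliceLeft]
  refine (VectorFunctional.eval_apply _ _).trans ?_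
  refine (congrArg (Inner.inner ℂ (HilbertRep.tmul K.vac f.l))
    (HilbertRep.op_mul_apply (K.tensor f.toHilbertRep) _ _ _)).trans ?_
  exact HilbertRep.inner_op_right (K.tensor f.toHilbertRep) _ _ _

theorem norm_sliceLeft_mul_comul_le (z : SpatialTensor Q Q) (x : Q) :
    ‖sliceLeft K.haar (z * G.comul x)‖ ≤ ‖z‖ * ‖K.orb x‖ := by
  refine norm_le_of_vectorFunctional _ (by positivity) fun f => ?_
  rw [eval_sliceLeft_mul_comul]
  refine (norm_inner_le_norm _ _).trans ?_
  rw [norm_comul]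
  have h1 := ((K.tensor f.toHilbertRep).op (star z)).le_of_opNorm_le
    (HilbertRep.norm_op_le _ _) (HilbertRep.tmul K.vac f.l)
  rw [HilbertRep.norm_tmul, K.norm_vac, one_mul, norm_star] at h1
  calc _ ≤ (‖z‖ * ‖f.l‖) * (‖K.orb x‖ * ‖f.r‖) := by gcongr
    _ = _ := by ring

theorem eval_sliceLeft_comul (η : K.space) (f : VectorFunctional Q) (x : Q) :
    f.eval (sliceLeft ⟨K.toHilbertRep, η, K.vac⟩ (G.comul x)) =
      Inner.inner ℂ (HilbertRep.tmul η f.l : (K.tensor f.toHilbertRep).space)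
        ((K.tensor f.toHilbertRep).op (G.comul x) (HilbertRep.tmul K.vac f.r)) := by
  rw [eval_sliceLeft]; rfl

/-- The bound involves only the orbit vector of `x`, so the coefficient descends to the GNS space
while its values remain in `Q`. -/
theorem norm_sliceLeft_comul_le (η : K.space) (x : Q) :
    ‖sliceLeft ⟨K.toHilbertRep, η, K.vac⟩ (G.comul x)‖ ≤ ‖η‖ * ‖K.orb x‖ := by
  refine norm_le_of_vectorFunctional _ (by positivity) fun f => ?_
  rw [eval_sliceLeft_comul]
  refine (norm_inner_le_norm _ _).trans ?_
  rw [norm_comul, HilbertRep.norm_tmul]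
  apply le_of_eq; ring

/-- The matrix coefficient map `ξ ↦ (⟪η, ·⟫ ⊗ id) V (ξ ⊗ 1)` of the regular corepresentation. -/
def coefAux (η : K.space) : K.space →L[ℂ] Q :=
  LinearMap.extendOfNorm ((sliceLeft ⟨K.toHilbertRep, η, K.vac⟩).toLinearMap ∘ₗ
    G.comul.toAlgHom.toLinearMap) K.orb

theorem coefAux_orb (η : K.space) (x : Q) :
    K.coefAux η (K.orb x) = sliceLeft ⟨K.toHilbertRep, η, K.vac⟩ (G.comul x) :=
  LinearMap.extendOfNorm_eq K.denseRange_orb ⟨‖η‖, fun x => K.norm_sliceLeft_comul_le η x⟩ x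

theorem eval_coefAux (f : VectorFunctional Q) (η ξ : K.space) :
    f.eval (K.coefAux η ξ) = Inner.inner ℂ (HilbertRep.tmul η f.l)
      (K.V f.toHilbertRep (HilbertRep.tmul ξ f.r)) := by
  refine K.denseRange_orb.induction_on (p := fun ξ => f.eval (K.coefAux η ξ) =
    Inner.inner ℂ (HilbertRep.tmul η f.l) (K.V f.toHilbertRep (HilbertRep.tmul ξ f.r))) ξ ?_
    fun x => ?_
  · exact isClosed_eq (f.eval.continuous.comp (K.coefAux η).continuous)
      ((innerSL ℂ (HilbertRep.tmul η f.l : (K.tensor f.toHilbertRep).space)).continuous.comp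
        ((K.V f.toHilbertRep).continuous.comp (K.tmulRight f.r).continuous))
  · rw [coefAux_orb, eval_sliceLeft_comul, V_tmul_orb]

theorem norm_coefAux_le (η ξ : K.space) : ‖K.coefAux η ξ‖ ≤ ‖η‖ * ‖ξ‖ := by
  refine norm_le_of_vectorFunctional _ (by positivity) fun f => ?_
  rw [eval_coefAux]
  refine (norm_inner_le_norm _ _).trans ?_
  rw [LinearIsometryEquiv.norm_map, HilbertRep.norm_tmul, HilbertRep.norm_tmul]
  apply le_of_eq; ring

/-- The matrix coefficients `(⟪η, ·⟫ ⊗ id) V (ξ ⊗ 1)` of the regular corepresentation. -/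
def coef : K.space →L⋆[ℂ] K.space →L[ℂ] Q :=
  LinearMap.mkContinuous
    { toFun := K.coefAux
      map_add' := fun η η' => by
        ext ξ
        refine eq_of_vectorFunctional fun f => ?_
        rw [add_apply, map_add, eval_coefAux, eval_coefAux, eval_coefAux, ← inner_add_left]
        exact congrArg (fun v => Inner.inner ℂ v _) ((K.tmulRight f.l).map_add η η')
      map_smul' := fun c η => by
        ext ξ
        refine eq_of_vectorFunctional fun f => ?_
        rw [smul_apply, map_smul, eval_coefAux, eval_coefAux, smul_eq_mul, ← inner_smul_left]
        exact congrArg (fun v => Inner.inner ℂ v _) ((K.tmulRight f.l).map_smul c η) } 1 fun η => by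
      rw [one_mul]
      exact ContinuousLinearMap.opNorm_le_bound _ (norm_nonneg _) (K.norm_coefAux_le η)

theorem coef_orb (η : K.space) (x : Q) :
    K.coef η (K.orb x) = sliceLeft ⟨K.toHilbertRep, η, K.vac⟩ (G.comul x) := K.coefAux_orb η x

theorem eval_coef (f : VectorFunctional Q) (η ξ : K.space) :
    f.eval (K.coef η ξ) = Inner.inner ℂ (HilbertRep.tmul η f.l)
      (K.V f.toHilbertRep (HilbertRep.tmul ξ f.r)) := K.eval_coefAux f η ξ

theorem inner_V (T : HilbertRep Q) (η ξ : K.space) (κ' κ : T.space) :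
    Inner.inner ℂ (HilbertRep.tmul η κ') (K.V T (HilbertRep.tmul ξ κ)) =
      Inner.inner ℂ κ' (T.op (K.coef η ξ) κ) := (K.eval_coef ⟨T, κ', κ⟩ η ξ).symm

/-- The comultiplication of matrix coefficients. -/
theorem prod_eval_comul_coef (φ ψ : VectorFunctional Q) (η ξ η' : K.space)
    (hη' : ∀ ζ, Inner.inner ℂ η' ζ = φ.eval (K.coef η ζ)) :
    (φ.prod ψ).eval (G.comul (K.coef η ξ)) = ψ.eval (K.coef η' ξ) := by
  refine K.denseRange_orb.induction_on (p := fun ξ => (φ.prod ψ).eval (G.comul (K.coef η ξ)) =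
    ψ.eval (K.coef η' ξ)) ξ ?_ fun x => ?_
  · exact isClosed_eq ((φ.prod ψ).eval.continuous.comp
      ((continuous_starHom G.comul).comp (K.coef η).continuous))
      (ψ.eval.continuous.comp (K.coef η').continuous)
  · let F : VectorFunctional Q := ⟨K.toHilbertRep, η, K.vac⟩
    let F' : VectorFunctional Q := ⟨K.toHilbertRep, η', K.vac⟩
    -- On orbit vectors the claim is coassociativity: convolving `F` with `φ` amounts to replacing
    -- `η` by `η'`.
    have h1 : (G.conv F φ).eval = F'.eval := ContinuousLinearMap.ext fun y => by
      change (F.prod φ).eval (G.comul y) = _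
      rw [← eval_sliceLeft, ← K.coef_orb, ← hη']
      rfl
    rw [coef_orb, coef_orb, eval_sliceLeft]
    change (G.conv φ ψ).eval (sliceLeft F (G.comul x)) = _
    rw [eval_sliceLeft]
    change (G.conv F (G.conv φ ψ)).eval x = (G.conv F' ψ).eval x
    rw [← G.conv_assoc]
    exact DFunLike.congr_fun (G.sliced.pr_congr h1 rfl) _

end CompactQuantumGroup.RegularRep

/-! ### Density of the coefficients of finite-dimensional corepresentations -/

/-- A vector orthogonal to the range of the symmetric operator `R - μ` is an eigenvector; passing to
orthogonal complements gives the claim, as `Z` is closed. -/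
theorem orthogonal_eigenspace_le {H : Type*} [NormedAddCommGroup H] [InnerProductSpace ℂ H]
    [CompleteSpace H] {R : H →L[ℂ] H} (hR : (R : H →ₗ[ℂ] H).IsSymmetric) (μ : ℝ)
    (Z : Submodule ℂ H) (hZ : IsClosed (Z : Set H)) (h : ∀ ζ, R ζ - (μ : ℂ) • ζ ∈ Z) :
    (Module.End.eigenspace (R : H →ₗ[ℂ] H) μ)ᗮ ≤ Z := by
  have h1 : Zᗮ ≤ Module.End.eigenspace (R : H →ₗ[ℂ] H) μ := fun y hy => by
    rw [Module.End.mem_eigenspace_iff, ← sub_eq_zero]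
    refine ext_inner_left ℂ fun ζ => ?_
    have h2 := Submodule.inner_right_of_mem_orthogonal (h ζ) hy
    rw [inner_sub_left, inner_smul_left, Complex.conj_ofReal] at h2
    rw [inner_sub_right, inner_smul_right, inner_zero_right, ← h2]
    exact congrArg (· - _) (hR ζ y).symm
  have h2 := Submodule.orthogonal_le h1
  rwa [Submodule.orthogonal_orthogonal_eq_closure, hZ.submodule_topologicalClosure_eq] at h2

/-- `R ζ` is orthogonal to every eigenspace, including the kernel, and the eigenspaces of a compact
symmetric operator have trivial common complement. -/
theorem apply_eq_zero_of_orthogonal_eigenspace {H : Type*} [NormedAddCommGroup H]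
    [InnerProductSpace ℂ H] [CompleteSpace H] {R : H →L[ℂ] H}
    (hR : (R : H →ₗ[ℂ] H).IsSymmetric) (hc : IsCompactOperator R) {ζ : H}
    (h : ∀ μ : ℝ, μ ≠ 0 → ∀ ξ ∈ Module.End.eigenspace (R : H →ₗ[ℂ] H) μ, inner ℂ ξ ζ = 0) :
    R ζ = 0 := by
  have h1 : R ζ ∈ (⨆ μ, Module.End.eigenspace (R : H →ₗ[ℂ] H) μ)ᗮ := by
    rw [← Submodule.iInf_orthogonal, Submodule.mem_iInf]
    intro μ
    rw [Submodule.mem_orthogonal]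
    intro ξ hξ
    have h2 : inner ℂ ξ (R ζ) = inner ℂ (μ • ξ) ζ := by
      have hξ' : R ξ = μ • ξ := Module.End.mem_eigenspace_iff.1 hξ
      rw [← hξ']
      exact (hR ξ ζ).symm
    rw [h2, inner_smul_left]
    by_cases hξ0 : ξ = 0
    · rw [hξ0, inner_zero_left, mul_zero]
    have hev : Module.End.HasEigenvalue (R : H →ₗ[ℂ] H) μ :=
      Module.End.hasEigenvalue_of_hasEigenvector ⟨hξ, hξ0⟩
    have h3 : (starRingEnd ℂ) μ = μ := hR.conj_eigenvalue_eq_self hev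
    have h4 : ((μ.re : ℝ) : ℂ) = μ := Complex.conj_eq_iff_re.1 h3
    by_cases hμ : μ.re = 0
    · rw [← h4, hμ, Complex.ofReal_zero, map_zero, zero_mul]
    · rw [h _ hμ ξ (by rwa [h4]), mul_zero]
  rwa [ContinuousLinearMap.orthogonalComplement_iSup_eigenspaces_eq_bot hc hR,
    Submodule.mem_bot] at h1

variable {Q : Type u} [CStarAlgebra Q]

/-! ### Compact intertwiners of the regular corepresentation -/

namespace CompactQuantumGroup.RegularRep

variable {G : CompactQuantumGroup Q} (K : G.RegularRep)

/-- The operator `C` commutes with the regular corepresentation. -/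
def IsIntertwiner (C : K.space →L[ℂ] K.space) : Prop :=
  ∀ η ξ, K.coef (ContinuousLinearMap.adjoint C η) ξ = K.coef η (C ξ)

variable {K}

theorem IsIntertwiner.mul {C D : K.space →L[ℂ] K.space} (hC : K.IsIntertwiner C)
    (hD : K.IsIntertwiner D) : K.IsIntertwiner (C * D) := fun η ξ => by
  change K.coef (ContinuousLinearMap.adjoint (C ∘L D) η) ξ = K.coef η (C (D ξ))
  rw [ContinuousLinearMap.adjoint_comp, ← hC, ← hD]; rfl

/-- The condition says that `C ⊗ 1` commutes with `V` in every representation of the second leg. As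
`V` is unitary, the adjoint commutes with it as well. -/
theorem IsIntertwiner.adjoint {C : K.space →L[ℂ] K.space} (hC : K.IsIntertwiner C) :
    K.IsIntertwiner (ContinuousLinearMap.adjoint C) := fun η ξ => by
  refine eq_of_vectorFunctional fun f => ?_
  let T := f.toHilbertRep
  let A : (K.tensor T).space →L[ℂ] (K.tensor T).space :=
    opTensor (H := K.space) (K := T.space) C 1
  let B : (K.tensor T).space →L[ℂ] (K.tensor T).space :=
    opTensor (H := K.space) (K := T.space) (star C) 1
  have hB : B = ContinuousLinearMap.adjoint A := by
    have := opTensor_star (H := K.space) (K := T.space) C 1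
    rw [star_one] at this
    exact this
  have hA : ∀ x y, A (HilbertRep.tmul x y) = HilbertRep.tmul (C x) y := fun x y =>
    opTensor_tmul _ _ _ _
  have hB' : ∀ x y, B (HilbertRep.tmul x y) =
      HilbertRep.tmul (ContinuousLinearMap.adjoint C x) y := fun x y => opTensor_tmul _ _ _ _
  have h1 : (K.V T : _ →L[ℂ] (K.tensor T).space) ∘L A = A ∘L (K.V T : _ →L[ℂ] _) :=
    HilbertRep.tensor_ext fun ξ κ => HilbertRep.eq_of_inner_tmul fun η κ' => by
      change inner ℂ (HilbertRep.tmul η κ') (K.V T (A (HilbertRep.tmul ξ κ))) =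
        inner ℂ (HilbertRep.tmul η κ') (A (K.V T (HilbertRep.tmul ξ κ)))
      rw [hA, inner_V, ← hC, ← inner_V, ← ContinuousLinearMap.adjoint_inner_left, ← hB, hB']
  have h2 : ∀ w, K.V T (A w) = A (K.V T w) := DFunLike.congr_fun h1
  have h3 : ∀ v w, inner ℂ (A v) (K.V T w) = inner ℂ v (K.V T (B w)) := fun v w => by
    obtain ⟨v, rfl⟩ := (K.V T).surjective v
    rw [← h2, LinearIsometryEquiv.inner_map_map, LinearIsometryEquiv.inner_map_map, hB,
      ContinuousLinearMap.adjoint_inner_right]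
  rw [ContinuousLinearMap.adjoint_adjoint, eval_coef, eval_coef]
  have := h3 (HilbertRep.tmul η f.l) (HilbertRep.tmul ξ f.r)
  rwa [hA, hB'] at this

variable (K)

/-- The operator of convolution with `h(a* ·)`. -/
def convOp (a : Q) : K.space →L[ℂ] K.space := K.orbL ∘L K.coef (K.orb a)

theorem convOp_apply (a : Q) (ξ : K.space) : K.convOp a ξ = K.orb (K.coef (K.orb a) ξ) := rfl

/-- Convolution acts on one side and the regular corepresentation on the other, so this is again
coassociativity, through `prod_eval_comul_coef`. -/
theorem isIntertwiner_convOp (a : Q) : K.IsIntertwiner (K.convOp a) := fun η ξ => by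
  refine eq_of_vectorFunctional fun ψ => ?_
  rw [convOp_apply, coef_orb, eval_sliceLeft]
  refine (K.prod_eval_comul_coef _ ψ _ _ _ fun ζ => ?_).symm
  rw [ContinuousLinearMap.adjoint_inner_left, convOp_apply, inner_orb]

/-- By continuity every coefficient of `ζ` kills the cyclic vector `ξ₀`, so `V(ζ ⊗ ξ₀) = 0`, and `V`
is isometric. -/
theorem eq_zero_of_convOp {ζ : K.space} (h : ∀ a, K.convOp a ζ = 0) : ζ = 0 := by
  have h1 : ∀ η, K.orbL (K.coef η ζ) = 0 := fun η => by
    refine K.denseRange_orb.induction_on (p := fun η => K.orbL (K.coef η ζ) = 0) η ?_ h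
    exact isClosed_eq (K.orbL.continuous.comp (K.coef.flip ζ).continuous) continuous_const
  have h2 : K.V K.toHilbertRep (HilbertRep.tmul ζ K.vac) = 0 :=
    HilbertRep.eq_of_inner_tmul fun η κ => by
      rw [inner_V, inner_zero_right]
      change inner ℂ κ (K.orbL (K.coef η ζ)) = 0
      rw [h1, inner_zero_right]
  have h3 : ‖(HilbertRep.tmul ζ K.vac : (K.tensor K.toHilbertRep).space)‖ = 0 := by
    rw [← (K.V K.toHilbertRep).norm_map, h2, norm_zero]
  rw [HilbertRep.norm_tmul, K.norm_vac, mul_one] at h3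
  exact norm_eq_zero.1 h3

/-- The operator `x ξ₀ ↦ (h ⊗ id)(z Δ(x))`. -/
def sliceOp (z : SpatialTensor Q Q) : K.space →L[ℂ] Q :=
  LinearMap.extendOfNorm ((sliceLeft K.haar).toLinearMap ∘ₗ
    (LinearMap.mulLeft ℂ z) ∘ₗ G.comul.toAlgHom.toLinearMap) K.orb

theorem sliceOp_orb (z : SpatialTensor Q Q) (x : Q) :
    K.sliceOp z (K.orb x) = sliceLeft K.haar (z * G.comul x) :=
  LinearMap.extendOfNorm_eq K.denseRange_orb ⟨‖z‖, fun x => K.norm_sliceLeft_mul_comul_le z x⟩ x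

variable {K} in
theorem clm_ext {Y : Type*} [NormedAddCommGroup Y] [NormedSpace ℂ Y] {S T : K.space →L[ℂ] Y}
    (h : ∀ x, S (K.orb x) = T (K.orb x)) : S = T :=
  DFunLike.coe_injective (K.denseRange_orb.equalizer S.continuous T.continuous (funext h))

theorem sliceOp_add (z w : SpatialTensor Q Q) : K.sliceOp (z + w) = K.sliceOp z + K.sliceOp w :=
  clm_ext fun x => by rw [add_apply, sliceOp_orb, sliceOp_orb, sliceOp_orb, add_mul, map_add]

theorem sliceOp_smul (c : ℂ) (z : SpatialTensor Q Q) : K.sliceOp (c • z) = c • K.sliceOp z :=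
  clm_ext fun x => by rw [smul_apply, sliceOp_orb, sliceOp_orb, smul_mul_assoc, map_smul]

theorem norm_sliceOp_le (z : SpatialTensor Q Q) : ‖K.sliceOp z‖ ≤ ‖z‖ := by
  refine ContinuousLinearMap.opNorm_le_bound _ (norm_nonneg _) fun ξ => ?_
  refine K.denseRange_orb.induction_on (p := fun ξ => ‖K.sliceOp z ξ‖ ≤ ‖z‖ * ‖ξ‖) ξ ?_ fun x => ?_
  · exact isClosed_le (K.sliceOp z).continuous.norm (continuous_norm.const_mul _)
  · rw [sliceOp_orb]; exact K.norm_sliceLeft_mul_comul_le z x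

/-- `sliceOp` as a bounded linear map. -/
def sliceOpL : SpatialTensor Q Q →L[ℂ] K.space →L[ℂ] Q :=
  LinearMap.mkContinuous ⟨⟨K.sliceOp, K.sliceOp_add⟩, K.sliceOp_smul⟩ 1 fun z => by
    rw [one_mul]; exact K.norm_sliceOp_le z

/-- Invariance of `h` turns `(h ⊗ id)((1 ⊗ q)Δ(yx))` into `h(yx)q`, an operator of rank at most one.
-/
theorem sliceOp_inRight_mul_comul (q y : Q) : K.sliceOp (inRight Q Q q * G.comul y) =
    (ContinuousLinearMap.toSpanSingleton ℂ q) ∘L (innerSL ℂ (K.orb (star y))) :=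
  clm_ext fun x => by
    have e2 : sliceLeft K.haar (G.comul (y * x)) = K.haar.eval (y * x) • (1 : Q) :=
      K.isHaar.slice₁ _
    have e3 : K.haar.eval (y * x) = inner ℂ (K.orb (star y)) (K.orb x) := by
      refine (VectorFunctional.eval_apply _ _).trans ?_
      refine (congrArg (Inner.inner ℂ K.vac) (K.op_mul_apply _ _ _)).trans ?_
      exact K.inner_op_right _ _ _
    rw [sliceOp_orb, mul_assoc, ← map_mul, sliceLeft_inRight_mul, e2, e3, mul_smul_comm, mul_one]
    rfl

/-- The span of `(1 ⊗ Q)Δ(Q)` is dense and yields finite-rank operators, and compactness survives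
norm limits. -/
theorem isCompactOperator_sliceOp (z : SpatialTensor Q Q) : IsCompactOperator (K.sliceOp z) := by
  have hcl : IsClosed (K.sliceOpL ⁻¹' {T | IsCompactOperator T}) :=
    isClosed_setOfPred_isCompactOperator.preimage K.sliceOpL.continuous
  refine hcl.closure_subset_iff.2 (fun w hw => ?_) (G.sliced.dense₂ z)
  change IsCompactOperator (K.sliceOp w)
  induction hw using Submodule.span_induction with
  | zero =>
    have : K.sliceOp 0 = 0 := map_zero K.sliceOpL
    rw [this]; exact isCompactOperator_zero
  | add a b _ _ ha hb => rw [sliceOp_add]; exact ha.add hb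
  | smul c a _ ha => rw [sliceOp_smul]; exact ha.smul c
  | mem w hw =>
    obtain ⟨p, rfl⟩ := hw
    refine (congrArg (fun T : K.space →L[ℂ] Q => IsCompactOperator T)
      (K.sliceOp_inRight_mul_comul p.2 p.1)).mpr ?_
    exact (isCompactOperator_of_locallyCompactSpace_rng
      (ContinuousLinearMap.toSpanSingleton ℂ p.2)).comp_clm _

/-- It makes the coefficient maps, and with them the convolution operators, compact. -/
theorem sliceOp_inLeft (a : Q) : K.sliceOp (inLeft Q Q (star a)) = K.coef (K.orb a) :=
  clm_ext fun x => eq_of_vectorFunctional fun f => by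
    rw [sliceOp_orb, coef_orb, eval_sliceLeft_mul_comul, eval_sliceLeft_comul, map_star, star_star,
      HilbertRep.tensor_op_inLeft]
    rfl

theorem isCompactOperator_convOp (a : Q) : IsCompactOperator (K.convOp a) := by
  have := K.isCompactOperator_sliceOp (inLeft Q Q (star a))
  rw [sliceOp_inLeft] at this
  exact this.clm_comp K.orbL

/-- The positive compact intertwiner `C* C`, for `C` a convolution operator. -/
def sqOp (a : Q) : K.space →L[ℂ] K.space := ContinuousLinearMap.adjoint (K.convOp a) * K.convOp a

theorem isCompactOperator_sqOp (a : Q) : IsCompactOperator (K.sqOp a) :=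
  (K.isCompactOperator_convOp a).clm_comp (ContinuousLinearMap.adjoint (K.convOp a))

theorem adjoint_sqOp (a : Q) : ContinuousLinearMap.adjoint (K.sqOp a) = K.sqOp a := by
  change star (star (K.convOp a) * K.convOp a) = _
  rw [star_mul, star_star]; rfl

theorem isSymmetric_sqOp (a : Q) : (K.sqOp a : K.space →ₗ[ℂ] K.space).IsSymmetric := fun x y => by
  change inner ℂ (K.sqOp a x) y = inner ℂ x (K.sqOp a y)
  rw [← ContinuousLinearMap.adjoint_inner_left, adjoint_sqOp]

theorem coef_sqOp (a : Q) (η ξ : K.space) :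
    K.coef (K.sqOp a η) ξ = K.coef η (K.sqOp a ξ) := by
  have := ((K.isIntertwiner_convOp a).adjoint.mul (K.isIntertwiner_convOp a)) η ξ
  rw [show ContinuousLinearMap.adjoint (K.convOp a) * K.convOp a = K.sqOp a from rfl,
    adjoint_sqOp] at this
  exact this

/-! ### Corepresentations on finite-dimensional invariant subspaces -/

section Corep

variable {m : Type*} [Fintype m] [DecidableEq m] {e : m → K.space}

/-- An operator on the span of `e` with matrix `M` that extends to an isometry in every
representation has `M*M = 1`. It is applied to `V` and to its inverse. -/
theorem star_mul_self_eq_one (he : Orthonormal ℂ e) (M : Matrix m m Q)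
    (h : ∀ T : HilbertRep Q, ∃ U : (K.tensor T).space ≃ₗᵢ[ℂ] (K.tensor T).space,
      ∀ j κ, U (HilbertRep.tmul (e j) κ) = ∑ k, HilbertRep.tmul (e k) (T.op (M k j) κ)) :
    star M * M = 1 := by
  have he' := orthonormal_iff_ite.1 he
  ext i j
  refine eq_of_vectorFunctional fun f => ?_
  obtain ⟨U, hU⟩ := h f.toHilbertRep
  have h1 := U.inner_map_map (HilbertRep.tmul (e i) f.l) (HilbertRep.tmul (e j) f.r)
  rw [hU, hU, sum_inner] at h1
  simp_rw [inner_sum, HilbertRep.inner_tmul, he'] at h1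
  simp only [ite_mul, one_mul, zero_mul, Finset.sum_ite_eq, Finset.mem_univ, if_true] at h1
  rw [Matrix.mul_apply, map_sum, Matrix.one_apply]
  refine Eq.trans (Finset.sum_congr rfl fun k _ => ?_) (h1.trans ?_)
  · rw [Matrix.star_apply]
    refine (VectorFunctional.eval_apply _ _).trans ?_
    refine (congrArg (Inner.inner ℂ f.l) (f.op_mul_apply _ _ _)).trans ?_
    refine (f.inner_op_right _ _ _).trans ?_
    rw [star_star]
  · by_cases hij : i = j
    · rw [if_pos hij, if_pos hij]
      refine Eq.trans ?_ (VectorFunctional.eval_apply _ _).symm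
      rw [f.op_one]; rfl
    · rw [if_neg hij, if_neg hij, map_zero]

/-- The hypotheses say that the span of `e` is invariant under `V` and under its inverse. The first
gives isometry and the comultiplication rule, the second gives coisometry. -/
theorem isCorepresentation_coef (he : Orthonormal ℂ e)
    (h₁ : ∀ η j, K.coef η (e j) = ∑ k, inner ℂ η (e k) • K.coef (e k) (e j))
    (h₂ : ∀ i ξ, K.coef (e i) ξ = ∑ k, inner ℂ (e k) ξ • K.coef (e i) (e k)) :
    G.IsCorepresentation (fun i j => K.coef (e i) (e j) : Matrix m m Q) := by
  set W : Matrix m m Q := fun i j => K.coef (e i) (e j) with hW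
  have hopsum : ∀ (T : HilbertRep Q) (c : m → ℂ) (q : m → Q) (κ : T.space),
      T.op (∑ k, c k • q k) κ = ∑ k, c k • T.op (q k) κ := fun T c q κ => by
    rw [← T.opL_apply, map_sum, sum_apply]
    exact Finset.sum_congr rfl fun k _ => by rw [map_smul]; rfl
  have u1 : star W * W = 1 := K.star_mul_self_eq_one he W fun T => ⟨K.V T, fun j κ => by
    refine HilbertRep.eq_of_inner_tmul fun η κ' => ?_
    rw [inner_V, h₁, hopsum, inner_sum, inner_sum]
    refine Finset.sum_congr rfl fun k _ => ?_
    rw [inner_smul_right, HilbertRep.inner_tmul]⟩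
  have u2 : star (star W) * star W = 1 := K.star_mul_self_eq_one he _ fun T =>
    ⟨(K.V T).symm, fun i κ => by
      refine HilbertRep.eq_of_inner_tmul fun η κ' => ?_
      have e1 : Inner.inner ℂ (HilbertRep.tmul η κ') ((K.V T).symm (HilbertRep.tmul (e i) κ)) =
          Inner.inner ℂ (K.V T (HilbertRep.tmul η κ')) (HilbertRep.tmul (e i) κ) := by
        rw [← (K.V T).inner_map_map, LinearIsometryEquiv.apply_symm_apply]
      rw [e1, ← inner_conj_symm, inner_V, h₂, hopsum, inner_sum, map_sum, inner_sum]
      refine Finset.sum_congr rfl fun k _ => ?_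
      rw [inner_smul_right, HilbertRep.inner_tmul, map_mul, inner_conj_symm, inner_conj_symm,
        Matrix.star_apply, T.inner_op_right, star_star]⟩
  rw [star_star] at u2
  refine ⟨Unitary.mem_iff.2 ⟨u1, u2⟩, ?_⟩
  ext i j
  refine eq_of_prod_eval fun φ ψ => ?_
  -- The Riesz vector of `φ` applied to the coefficients replaces an infinite sum over an
  -- orthonormal basis.
  let η' := (InnerProductSpace.toDual ℂ K.space).symm (φ.eval ∘L K.coef (e i))
  have hη' : ∀ ζ, inner ℂ η' ζ = φ.eval (K.coef (e i) ζ) := fun ζ =>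
    InnerProductSpace.toDual_symm_apply
  have h3 := K.prod_eval_comul_coef φ ψ (e i) (e j) η' hη'
  refine h3.trans ?_
  rw [h₁, map_sum, Matrix.mul_apply, map_sum]
  refine Finset.sum_congr rfl fun k _ => ?_
  rw [map_smul, hη', smul_eq_mul]
  exact (prod_eval_mul φ ψ _ _).symm

end Corep

variable (G) in
/-- The span of the coefficients of finite-dimensional corepresentations. -/
def coefSpan : Submodule ℂ Q :=
  Submodule.span ℂ {x | ∃ (m : ℕ) (W : Matrix (Fin m) (Fin m) Q),
    G.IsCorepresentation W ∧ ∃ i j, W i j = x}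

/-- The hypotheses make `X` a reducing subspace, so an orthonormal basis of `X` gives a
corepresentation, and every coefficient with one vector in `X` is a combination of its entries. -/
theorem coef_mem_coefSpan (X : Submodule ℂ K.space) [FiniteDimensional ℂ X]
    (h₁ : ∀ ξ ∈ X, ∀ η ∈ Xᗮ, K.coef η ξ = 0) (h₂ : ∀ η ∈ X, ∀ ξ ∈ Xᗮ, K.coef η ξ = 0)
    {ξ : K.space} (hξ : ξ ∈ X) (η : K.space) : K.coef η ξ ∈ coefSpan G := by
  let b := stdOrthonormalBasis ℂ X
  let e : Fin (Module.finrank ℂ X) → K.space := fun i => b i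
  have he : Orthonormal ℂ e := b.orthonormal.comp_linearIsometry X.subtypeₗᵢ
  have hp : ∀ ζ : K.space, ∃ z ∈ Xᗮ, ζ = (∑ k, inner ℂ (e k) ζ • e k) + z := fun ζ => by
    refine ⟨ζ - X.starProjection ζ, X.sub_starProjection_mem_orthogonal ζ, ?_⟩
    have h3 : ∀ k, inner ℂ (e k) (X.starProjection ζ) = inner ℂ (e k) ζ := fun k => by
      have := Submodule.inner_right_of_mem_orthogonal (b k).2
        (X.sub_starProjection_mem_orthogonal ζ)
      rw [inner_sub_right, sub_eq_zero] at this
      exact this.symm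
    have h4 := congrArg X.subtype (b.sum_repr' (X.orthogonalProjectionOnto ζ))
    rw [map_sum] at h4
    have h5 : ∑ k, inner ℂ (e k) ζ • e k = X.starProjection ζ := by
      refine Eq.trans (Finset.sum_congr rfl fun k _ => ?_) h4
      rw [← h3 k]; rfl
    rw [h5, add_sub_cancel]
  have c₁ : ∀ ξ ∈ X, ∀ η, K.coef η ξ = ∑ k, inner ℂ η (e k) • K.coef (e k) ξ := fun ξ hξ η => by
    obtain ⟨z, hz, hη⟩ := hp η
    conv_lhs => rw [hη, map_add, add_apply, h₁ ξ hξ z hz, add_zero, map_sum, sum_apply]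
    refine Finset.sum_congr rfl fun k _ => ?_
    rw [map_smulₛₗ, smul_apply, inner_conj_symm]
  have c₂ : ∀ η ∈ X, ∀ ξ, K.coef η ξ = ∑ k, inner ℂ (e k) ξ • K.coef η (e k) := fun η hη ξ => by
    obtain ⟨z, hz, hξ⟩ := hp ξ
    conv_lhs => rw [hξ, map_add, h₂ η hη z hz, add_zero, map_sum]
    exact Finset.sum_congr rfl fun k _ => map_smul _ _ _
  have hW := K.isCorepresentation_coef he (fun η j => c₁ _ (b j).2 η) fun i ξ => c₂ _ (b i).2 ξ
  have hmem : ∀ k j, K.coef (e k) (e j) ∈ coefSpan G := fun k j =>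
    Submodule.subset_span ⟨_, _, hW, k, j, rfl⟩
  rw [c₁ ξ hξ]
  refine Submodule.sum_mem _ fun k _ => Submodule.smul_mem _ _ ?_
  rw [c₂ _ (b k).2]
  exact Submodule.sum_mem _ fun l _ => Submodule.smul_mem _ _ (hmem k l)

/-- Compactness makes the eigenspace finite-dimensional, and the intertwining property makes it
reducing: coefficients against an eigenvector vanish on the range of `sqOp a - μ`, hence on the
orthogonal complement of the eigenspace. -/
theorem coef_mem_of_eigenspace (a : Q) {μ : ℝ} (hμ : μ ≠ 0) {ξ : K.space}
    (hξ : ξ ∈ Module.End.eigenspace (K.sqOp a : K.space →ₗ[ℂ] K.space) μ) (η : K.space) :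
    K.coef η ξ ∈ coefSpan G := by
  have : FiniteDimensional ℂ (Module.End.eigenspace (K.sqOp a : K.space →ₗ[ℂ] K.space) μ) :=
    ContinuousLinearMap.finite_dimensional_eigenspace (K.isCompactOperator_sqOp a) _
      (Complex.ofReal_ne_zero.2 hμ)
  refine K.coef_mem_coefSpan _ (fun ξ hξ η hη => ?_) (fun η hη ξ hξ => ?_) hξ η
  · rw [Module.End.mem_eigenspace_iff] at hξ
    have hξ' : K.sqOp a ξ = (μ : ℂ) • ξ := hξ
    refine orthogonal_eigenspace_le (K.isSymmetric_sqOp a) μ (K.coef.flip ξ).ker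
      (K.coef.flip ξ).isClosed_ker (fun ζ => ?_) hη
    change K.coef (K.sqOp a ζ - (μ : ℂ) • ζ) ξ = 0
    rw [map_sub, sub_apply, coef_sqOp, hξ', (K.coef ζ).map_smul, K.coef.map_smulₛₗ, smul_apply, Complex.conj_ofReal,
      sub_self]
  · rw [Module.End.mem_eigenspace_iff] at hη
    have hη' : K.sqOp a η = (μ : ℂ) • η := hη
    refine orthogonal_eigenspace_le (K.isSymmetric_sqOp a) μ (K.coef η).ker
      (K.coef η).isClosed_ker (fun ζ => ?_) hξ
    change K.coef η (K.sqOp a ζ - (μ : ℂ) • ζ) = 0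
    rw [map_sub, ← coef_sqOp, hη', (K.coef η).map_smul, K.coef.map_smulₛₗ, smul_apply, Complex.conj_ofReal,
      sub_self]

theorem convOp_eq_zero_of_orthogonal (a : Q) {ζ : K.space}
    (h : ∀ μ : ℝ, μ ≠ 0 → ∀ ξ ∈ Module.End.eigenspace (K.sqOp a : K.space →ₗ[ℂ] K.space) μ,
      inner ℂ ξ ζ = 0) : K.convOp a ζ = 0 := by
  have h1 := apply_eq_zero_of_orthogonal_eigenspace (K.isSymmetric_sqOp a)
    (K.isCompactOperator_sqOp a) h
  have h2 := ContinuousLinearMap.adjoint_inner_right (K.convOp a) ζ (K.convOp a ζ)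
  have h3 : ContinuousLinearMap.adjoint (K.convOp a) (K.convOp a ζ) = K.sqOp a ζ := rfl
  rw [h3, h1, inner_zero_right] at h2
  exact inner_self_eq_zero.1 h2.symm

-- Peter–Weyl density in norm in `Q` itself, not only in the image of the GNS representation.
include K in
theorem dense_coefSpan : Dense (coefSpan G : Set Q) := by
  have hAc := (coefSpan G).isClosed_topologicalClosure
  set A := (coefSpan G).topologicalClosure with hA
  -- `Y` is closed and contains all eigenspaces with nonzero eigenvalue, so every convolution
  -- operator kills its complement.
  let Y : Submodule ℂ K.space := ⨅ η, A.comap (K.coef η : K.space →ₗ[ℂ] Q)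
  have hYc : IsClosed (Y : Set K.space) := by
    rw [Submodule.coe_iInf]
    exact isClosed_iInter fun η => hAc.preimage (K.coef η).continuous
  have hY : Y = ⊤ := by
    rw [← hYc.submodule_topologicalClosure_eq, Submodule.topologicalClosure_eq_top_iff,
      Submodule.eq_bot_iff]
    intro ζ hζ
    refine K.eq_zero_of_convOp fun a => K.convOp_eq_zero_of_orthogonal a fun μ hμ ξ hξ => ?_
    refine Submodule.inner_right_of_mem_orthogonal (Submodule.mem_iInf _ |>.2 fun η => ?_) hζ
    exact Submodule.le_topologicalClosure _ (K.coef_mem_of_eigenspace a hμ hξ η)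
  have h1 : ∀ η ξ, K.coef η ξ ∈ A := fun η ξ => by
    have : ξ ∈ Y := hY ▸ Submodule.mem_top
    exact (Submodule.mem_iInf _).1 this η
  -- On the dense span of `(Q ⊗ 1)Δ(Q)` these slices are regular coefficients. Taking `z = 1 ⊗ q`
  -- then recovers `q`.
  have h2 : ∀ z, sliceLeft K.haar z ∈ A := fun z => by
    refine (hAc.preimage (sliceLeft K.haar).continuous).closure_subset_iff.2 (fun w hw => ?_)
      (G.sliced.dense₁ z)
    change sliceLeft K.haar w ∈ A
    induction hw using Submodule.span_induction with
    | zero => rw [map_zero]; exact A.zero_mem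
    | add a b _ _ ha hb => rw [map_add]; exact A.add_mem ha hb
    | smul c a _ ha => rw [map_smul]; exact A.smul_mem c ha
    | mem w hw =>
      obtain ⟨p, rfl⟩ := hw
      have e := K.sliceOp_inLeft (star p.2)
      rw [star_star] at e
      have e2 : sliceLeft K.haar (inLeft Q Q p.2 * G.comul p.1) =
          K.coef (K.orb (star p.2)) (K.orb p.1) := by rw [← sliceOp_orb, e]
      exact e2.symm ▸ h1 _ _
  intro q
  have h3 : sliceLeft K.haar (inRight Q Q q) = q := by
    have := sliceLeft_tmul K.haar (1 : Q) q
    rw [show K.haar.eval 1 = 1 from K.isHaar.one, one_smul] at this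
    exact this
  have := h2 (inRight Q Q q)
  rwa [h3] at this

end CompactQuantumGroup.RegularRep

namespace CompactQuantumGroup

variable {Q : Type u} [CStarAlgebra Q] {G : CompactQuantumGroup Q}

/-! ### Invariant cocycles -/

/-- On `a ⊗ b` the image is `(a ⊗ 1 ⊗ 1)(1 ⊗ Δ(b))`; the first factor commutes because the legs are
disjoint, the second by invariance. -/
theorem IsInvariant.leg₂₃_commute {Ω : SpatialTensor Q Q} (hΩ : G.IsInvariant Ω)
    (z : SpatialTensor Q Q) :
    leg₂₃ Q Q Q Ω * idTensor G.comul z = idTensor G.comul z * leg₂₃ Q Q Q Ω := by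
  have h : ContinuousLinearMap.mul ℂ _ (leg₂₃ Q Q Q Ω) ∘L starHomL (idTensor (A := Q) G.comul) =
      (ContinuousLinearMap.mul ℂ _).flip (leg₂₃ Q Q Q Ω) ∘L starHomL (idTensor G.comul) :=
    spatialTensor_clm_ext fun a b => by
      change leg₂₃ Q Q Q Ω * idTensor G.comul (ι₂ Q Q (a ⊗ₜ b)) =
        idTensor G.comul (ι₂ Q Q (a ⊗ₜ b)) * leg₂₃ Q Q Q Ω
      rw [idTensor_tmul, ← mul_assoc, ← (leg₁_commute_leg₂₃ a Ω).eq, mul_assoc, mul_assoc,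
        ← map_mul, ← map_mul, hΩ]
  exact DFunLike.congr_fun h z

theorem IsInvariant.leg₁₂_commute {Ω : SpatialTensor Q Q} (hΩ : G.IsInvariant Ω)
    (z : SpatialTensor Q Q) :
    leg₁₂ Q Q Q Ω * tensorId G.comul z = tensorId G.comul z * leg₁₂ Q Q Q Ω := by
  have h : ContinuousLinearMap.mul ℂ _ (leg₁₂ Q Q Q Ω) ∘L starHomL (tensorId (B := Q) G.comul) =
      (ContinuousLinearMap.mul ℂ _).flip (leg₁₂ Q Q Q Ω) ∘L starHomL (tensorId G.comul) :=
    spatialTensor_clm_ext fun a b => by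
      change leg₁₂ Q Q Q Ω * tensorId G.comul (ι₂ Q Q (a ⊗ₜ b)) =
        tensorId G.comul (ι₂ Q Q (a ⊗ₜ b)) * leg₁₂ Q Q Q Ω
      rw [tensorId_tmul, mul_assoc, ← (leg₁₂_commute_leg₃ Ω b).eq, ← mul_assoc, ← mul_assoc,
        ← map_mul, ← map_mul, hΩ]
  exact DFunLike.congr_fun h z

theorem isRightCocycle_iff_isLeftCocycle {Ω : SpatialTensor Q Q} (hΩ : G.IsInvariant Ω) :
    G.IsRightCocycle Ω ↔ G.IsLeftCocycle Ω := by
  rw [IsRightCocycle, IsLeftCocycle, hΩ.leg₂₃_commute, hΩ.leg₁₂_commute]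

/-! ### Strongly projective unitaries -/

variable (G) in
theorem dense_coefficients :
    Dense (Submodule.span ℂ {x | ∃ (m : ℕ) (W : Matrix (Fin m) (Fin m) Q),
      G.IsCorepresentation W ∧ ∃ i j, W i j = x} : Set Q) := by
  rcases subsingleton_or_nontrivial Q with hQ | hQ
  · exact fun x => subset_closure (by rw [Subsingleton.elim x 0]; exact Submodule.zero_mem _)
  · obtain ⟨K⟩ := G.nonempty_regularRep
    exact K.dense_coefSpan

variable {n : Type*} [Fintype n] [DecidableEq n] {U V : Matrix n n Q}

/-- If all `U ⊗ W ⊗ V` are corepresentations, then so are all `V ⊗ W ⊗ U`. -/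
theorem isCorepresentation_swap (hU : U ∈ unitary (Matrix n n Q)) (hV : V ∈ unitary (Matrix n n Q))
    (h : ∀ (m : ℕ) (W : Matrix (Fin m) (Fin m) Q), G.IsCorepresentation W →
      G.IsCorepresentation ((U ⊗ₖ W) ⊗ₖ V)) (m : ℕ) (W : Matrix (Fin m) (Fin m) Q)
    (hW : G.IsCorepresentation W) : G.IsCorepresentation ((V ⊗ₖ W) ⊗ₖ U) := by
  rcases isEmpty_or_nonempty n with hn | hn
  -- On the zero Hilbert space all matrices coincide, and no `ω` is available or needed.
  · exact ⟨Unitary.mem_iff.2 ⟨Subsingleton.elim _ _, Subsingleton.elim _ _⟩, Subsingleton.elim _ _⟩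
  · obtain ⟨ω, hω⟩ := exists_isCompensated hU hV G.dense_coefficients h
    exact hω.symm.isCorepresentation hV hU hW

theorem isStronglyRightProjective_iff_left :
    G.IsStronglyRightProjective U ↔ G.IsStronglyLeftProjective U :=
  ⟨fun h => ⟨h.1, h.2.1, fun Ubar hc => isCorepresentation_swap h.1 hc.1 (h.2.2 Ubar hc)⟩,
    fun h => ⟨h.1, h.2.1, fun Ubar hc => isCorepresentation_swap hc.1 h.1 (h.2.2 Ubar hc)⟩⟩

theorem IsRightProjective.exists_isConjugate {Ω : SpatialTensor Q Q}
    (h : G.IsRightProjective U Ω) (hΩ : G.IsInvariant Ω) : ∃ Ubar, IsConjugate U Ubar := by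
  rcases subsingleton_or_nontrivial Q with hQ | hQ
  · exact exists_isConjugate_of_subsingleton U
  · obtain ⟨K⟩ := G.nonempty_regularRep
    have hU : G.sliced.IsTwisted U Ω := ⟨h.1, h.2.1.1, hΩ, fun i j =>
      congrFun (congrFun h.2.2 i) j⟩
    exact hU.exists_isConjugate K.isHaar

/-- A single conjugate already determines the compensating unitary, and comparison with the cocycle
relation identifies it as `Ω*`. -/
theorem IsRightProjective.isStronglyRightProjective_iff [Nonempty n] {Ω : SpatialTensor Q Q}
    (h : G.IsRightProjective U Ω) : G.IsStronglyRightProjective U ↔ G.IsInvariant Ω := by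
  constructor
  · rintro ⟨-, ⟨Ubar, hc⟩, hs⟩ x
    obtain ⟨ω, hω⟩ := exists_isCompensated h.1 hc.1 G.dense_coefficients (hs Ubar hc)
    -- `U₁₂U₁₃ = Δ(U)Ω = U₁₂U₁₃ωΩ`, and one column of the unitary `U₁₂U₁₃` suffices to cancel it.
    have h1 : ω * Ω = 1 := by
      obtain ⟨i₀⟩ := ‹Nonempty n›
      have h2 : ∀ k, legs U k i₀ * (ω * Ω) = legs U k i₀ := fun k => by
        have : G.comul (U k i₀) * Ω = legs U k i₀ := congrFun (congrFun h.2.2 k) i₀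
        rw [← mul_assoc, ← hω.left, this]
      have h3 := SlicedCoproduct.sum_star_mul_of_mem_unitary (legs_mem_unitary h.1) i₀ i₀
      rw [if_pos rfl] at h3
      calc ω * Ω = (∑ k, star (legs U k i₀) * legs U k i₀) * (ω * Ω) := by rw [h3, one_mul]
        _ = ∑ k, star (legs U k i₀) * legs U k i₀ := by
          rw [Finset.sum_mul]
          exact Finset.sum_congr rfl fun k _ => by rw [mul_assoc, h2]
        _ = 1 := h3
    have h2 : Ω = star ω := (left_inv_eq_right_inv (Unitary.mem_iff.1 hω.mem_unitary).1 h1).symm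
    rw [h2]
    exact hω.symm.comm x
  · intro hΩ
    exact ⟨h.1, h.exists_isConjugate hΩ, fun Ubar hc m W hW =>
      (h.isCompensated hΩ hc).isCorepresentation h.1 hc.1 hW⟩

end CompactQuantumGroup

end

end CQG

theorem mainTheorem12 {Q : Type u} [CStarAlgebra Q] (G : CQG.CompactQuantumGroup Q) :
    (∀ (n : ℕ), 0 < n → ∀ (U : Matrix (Fin n) (Fin n) Q) (Ω : CQG.SpatialTensor Q Q),
      G.IsRightProjective U Ω →
        (G.IsStronglyRightProjective U ↔ ∀ x, Ω * G.comul x = G.comul x * Ω)) ∧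
    (∀ (n : ℕ) (U : Matrix (Fin n) (Fin n) Q),
      G.IsStronglyRightProjective U ↔ G.IsStronglyLeftProjective U) ∧
    (∀ Ω : CQG.SpatialTensor Q Q,
      (G.IsRightCocycle Ω ∧ G.IsInvariant Ω) ↔ (G.IsLeftCocycle Ω ∧ G.IsInvariant Ω)) := by
  refine ⟨fun n hn U Ω h => ?_, fun n U => CQG.CompactQuantumGroup.isStronglyRightProjective_iff_left,
    fun Ω => and_congr_left fun hΩ => CQG.CompactQuantumGroup.isRightCocycle_iff_isLeftCocycle hΩ⟩
  have : Nonempty (Fin n) := ⟨⟨0, hn⟩⟩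
  exact h.isStronglyRightProjective_iff
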